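/- Let $1<s<2$, let $n\in\mathbb N$ with $n>2s$, and let $p>\frac{n+2s}{n-2s}$ satisfy $$ p\,\frac{\Gamma\left(\frac n2-\frac{s}{p-1}\right)\Gamma\left(s+\frac{s}{p-1}\right)}{\Gamma\left(\frac{s}{p-1}\right)\Gamma\left(\frac{n-2s}{2}-\frac{s}{p-1}\right)} > \frac{\Gamma\left(\frac{n+2s}{4}\right)^2}{\Gamma\left(\frac{n-2s}{4}\right)^2}. $$ For a real-valued $\varphi\in C_c^\infty(\mathbb R^n)$ let $(-\Delta)^s\varphi$ be the function with Fourier transform $|\xi|^{2s}\hat\varphi(\xi)$, where the Fourier transform is normalized to be unitary on $L^2(\mathbb{R}^n)$. Let $\psi\in L^{p+1}(\mathbb S^{n-1})$ be real-valued and put $$u(x)=r^{-\frac{2s}{p-1}}\psi(\theta),\qquad r=|x|,\quad \theta=x/|x|,\quad x\neq 0 .$$ Suppose that $u$ is a solution of $(-\Delta)^s u=|u|^{p-1}u$ in $\mathbb R^n\setminus\{0\}$ in the sense of distributions, that is, $\int_{\mathbb R^n}\frac{|u(x)|}{(1+|x|)^{n+2s}}\,dx<\infty$, $|u|^p\in L^1_{\mathrm{loc}}(\mathbb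 R^n\setminus\{0\})$ and $$\int_{\mathbb R^n}u\,(-\Delta)^s\varphi\,dx=\int_{\mathbb R^n}|u|^{p-1}u\,\varphi\,dx\qquad\text{for all }\varphi\in C_c^\infty(\mathbb R^n\setminus\{0\}),$$ and that $u$ is stable there, that is, $|u|^{p-1}\in L^1_{\mathrm{loc}}(\mathbb R^n\setminus\{0\})$ and $$\int_{\mathbb R^n}|\xi|^{2s}|\hat\varphi(\xi)|^2\,d\xi-p\int_{\mathbb R^n}|u|^{p-1}\varphi^2\,dx\ \ge 0\qquad\text{for all }\varphi\in C_c^\infty(\mathbb R^n\setminus\{0\}).$$ Then $\psi=0$ almost everywhere on $\mathbb S^{n-1}$ with respect to the surface measure. -/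

import Mathlib

open MeasureTheory FourierTransform
open scoped ContDiff

noncomputable section

namespace FracLaneEmden

/-- Euclidean space `ℝⁿ`. -/
abbrev E (n : ℕ) : Type := EuclideanSpace ℝ (Fin n)

/-- The unit sphere of `ℝⁿ`. -/
abbrev S (n : ℕ) : Type := Metric.sphere (0 : E n) 1

/-- The surface measure of the unit sphere. -/
def surface (n : ℕ) : Measure (S n) := (volume : Measure (E n)).toSphere

/-- The function `x = r θ ↦ r ^ (-γ) * ψ θ` (`r = ‖x‖`, `θ = x / ‖x‖`), homogeneous of degree `-γ`
on `ℝⁿ` without the origin. Its value at the origin is irrelevant and is set to `0`. -/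
def homogeneous {n : ℕ} (γ : ℝ) (ψ : S n → ℝ) (x : E n) : ℝ :=
  if hx : x = 0 then 0
  else ‖x‖ ^ (-γ) * ψ ⟨‖x‖⁻¹ • x, by
    rw [mem_sphere_zero_iff_norm]; exact norm_smul_inv_norm (𝕜 := ℝ) hx⟩

/-- Real test functions: smooth with compact support contained in `Ω`. -/
structure IsTest {n : ℕ} (Ω : Set (E n)) (φ : E n → ℝ) : Prop where
  smooth : ContDiff ℝ ∞ φ
  compact : HasCompactSupport φ
  support : tsupport φ ⊆ Ω

/-- `(-Δ)^s φ`, the Fourier multiplier of symbol `|ξ| ^ (2 s)`. Mathlib's Fourier transform is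
`𝓕 φ ξ = ∫ exp (-2 π i ⟨x, ξ⟩) φ x`, so that the symbol reads `(2 π |ξ|) ^ (2 s)`.
For real `φ` the inverse transform is real, so that taking the real part loses nothing. -/
def fracLaplacian {n : ℕ} (s : ℝ) (φ : E n → ℝ) (x : E n) : ℝ :=
  (𝓕⁻ (fun ξ : E n =>
    (((2 * Real.pi * ‖ξ‖) ^ (2 * s) : ℝ) : ℂ) * 𝓕 (fun y : E n => (φ y : ℂ)) ξ) x).re

/-- The quadratic form `⟨(-Δ)^s φ, φ⟩ = ∫ |ξ| ^ (2 s) |φ̂| ^ 2`. -/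
def fracEnergy {n : ℕ} (s : ℝ) (φ : E n → ℝ) : ℝ :=
  ∫ ξ : E n, (2 * Real.pi * ‖ξ‖) ^ (2 * s) * ‖𝓕 (fun y : E n => (φ y : ℂ)) ξ‖ ^ 2

/-- `u` solves `(-Δ)^s u = |u|^(p-1) u` in `Ω` in the sense of distributions. The weighted
integrability makes the pairing of `u` with `(-Δ)^s φ`, which decays like `|x| ^ (-n-2s)`,
absolutely convergent. -/
structure IsSolution {n : ℕ} (s p : ℝ) (Ω : Set (E n)) (u : E n → ℝ) : Prop where
  weighted : Integrable (fun x : E n => u x / (1 + ‖x‖) ^ ((n : ℝ) + 2 * s))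
  source : LocallyIntegrableOn (fun x : E n => |u x| ^ (p - 1) * u x) Ω
  eqn : ∀ φ : E n → ℝ, IsTest Ω φ →
    ∫ x : E n, u x * fracLaplacian s φ x = ∫ x : E n, |u x| ^ (p - 1) * u x * φ x

/-- Stability of `u` in `Ω`: the second variation of the energy of `(-Δ)^s u = |u|^(p-1) u` at `u`
is nonnegative on test functions. -/
structure IsStable {n : ℕ} (s p : ℝ) (Ω : Set (E n)) (u : E n → ℝ) : Prop where
  potential : LocallyIntegrableOn (fun x : E n => |u x| ^ (p - 1)) Ω
  form_nonneg : ∀ φ : E n → ℝ, IsTest Ω φ →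
    0 ≤ fracEnergy s φ - p * ∫ x : E n, |u x| ^ (p - 1) * φ x ^ 2

end FracLaneEmden

end

/-! Put γ = 2s/(p-1) and γ₀ = (n-2s)/2. For a spherical harmonic Y of degree k, (-Δ)^s maps r^(-γ) Y
to λ_k(γ) r^(-γ-2s) Y, where λ_k is `symbol`, up to a constant a product of two Gamma ratios.
Supercriticality of p means γ < γ₀, and the Gamma function hypothesis says exactly λ_0(γ₀) < p
λ_0(γ).

Let Y_k be the degree-k component of ψ and B a partial sum of the Y_k. Projecting the equation onto
harmonics (`IsSolution.symbol_mul_integral`) gives ∫|ψ|^(p-1) ψ B = Σ λ_k(γ) ‖Y_k‖². Stability on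
r^(-γ₀) g(ε log r) B(θ), as ε → 0, gives p ∫|ψ|^(p-1) B² ≤ Σ λ_k(γ₀) ‖Y_k‖²
(`IsStable.mul_integral_le`). The quotient λ_k(γ₀)/λ_k(γ) is largest at k = 0
(`symbol_mul_symbol_zero_le`), hence ∫|ψ|^(p-1) B² ≤ θ ∫|ψ|^(p-1) ψ B with θ = λ_0(γ₀)/(p λ_0(γ)) <
1. Completing a square bounds the left side by θ² ∫|ψ|^(p+1), and Fatou along a.e. convergent
partial sums gives ∫|ψ|^(p+1) ≤ θ² ∫|ψ|^(p+1), so ψ = 0 (`ae_eq_zero_of_forall_integral_le`). Finite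
sums B make it unnecessary to know that ψ itself has finite energy on the sphere.

The symbol comes from Fourier analysis. Bochner–Hecke (`fourier_polyGaussian`) is integrated against
t^(a-1) dt to give a functional equation for pairings with P |x|^(-2a) (`zetaPairing_fourier`); two
uses of it give `IsTest.zetaPairing_fracLaplacian` for complex γ with 0 < Re γ < n-2s. Real γ serves
the equation, the line Re γ = γ₀ serves stability. Convergence rests on the decay |x|^(-n-2s) of
(-Δ)^s φ (`IsTest.exists_abs_fracLaplacian_le`), obtained by subordination to the heat flow. -/

noncomputable section

namespace FracLaneEmden

open Filter Topology Set MvPolynomial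

variable {n : ℕ}

/-! ### Gamma ratios: monotonicity and vertical growth. -/

/-- The ratio `Γ(x + s) / Γ(x)`. -/
def gammaRatio (s x : ℝ) : ℝ := Real.Gamma (x + s) / Real.Gamma x

lemma gammaRatio_pos {s x : ℝ} (hs : 0 ≤ s) (hx : 0 < x) : 0 < gammaRatio s x :=
  div_pos (Real.Gamma_pos_of_pos (by linarith)) (Real.Gamma_pos_of_pos hx)

/-- Quotient of the Euler limits for Γ(x + s) and Γ(x); it reduces inequalities between Gamma ratios
to inequalities between single factors. -/
lemma tendsto_gammaRatio {s x : ℝ} (hs : 0 ≤ s) (hx : 0 < x) :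
    Tendsto (fun m : ℕ => (m : ℝ) ^ s * ∏ j ∈ Finset.range (m + 1), (x + j) / (x + s + j)) atTop
      (𝓝 (gammaRatio s x)) := by
  have h := (Real.GammaSeq_tendsto_Gamma (x + s)).div (Real.GammaSeq_tendsto_Gamma x)
    (Real.Gamma_pos_of_pos hx).ne'
  refine h.congr' ?_
  filter_upwards [eventually_gt_atTop 0] with m hm
  have hm' : (0 : ℝ) < m := by exact_mod_cast hm
  have h1 : ∏ j ∈ Finset.range (m + 1), (x + j) ≠ 0 :=
    Finset.prod_ne_zero_iff.2 fun j _ => by positivity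
  have h2 : ∏ j ∈ Finset.range (m + 1), (x + s + j) ≠ 0 :=
    Finset.prod_ne_zero_iff.2 fun j _ => by positivity
  simp only [Pi.div_apply, Real.GammaSeq, Finset.prod_div_distrib]
  rw [Real.rpow_add hm']
  have h3 := (Real.rpow_pos_of_pos hm' x).ne'
  have h4 : (m.factorial : ℝ) ≠ 0 := by positivity
  field_simp

/-- For f(u) = 1 - d²/u² the quotient f(u)/f(u + h) is nondecreasing in u > d, since log f is
concave there. -/
lemma sq_sub_div_mono {d h u v : ℝ} (hd : 0 < d) (hh : 0 ≤ h) (hu : d < u) (huv : u ≤ v) :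
    (u ^ 2 - d ^ 2) / u ^ 2 * (((v + h) ^ 2 - d ^ 2) / (v + h) ^ 2) ≤
      (v ^ 2 - d ^ 2) / v ^ 2 * (((u + h) ^ 2 - d ^ 2) / (u + h) ^ 2) := by
  have hu0 : 0 < u := hd.trans hu
  have hv0 : 0 < v := hu0.trans_le huv
  -- In terms of d, e = u - d, w = v - u and h, the cleared difference has only nonnegative
  -- coefficients.
  obtain ⟨w, rfl⟩ : ∃ w, v = u + w := ⟨v - u, by ring⟩
  have hw : 0 ≤ w := by linarith
  obtain ⟨e, rfl⟩ : ∃ e, u = d + e := ⟨u - d, by ring⟩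
  have he : 0 < e := by linarith
  rw [div_mul_div_comm, div_mul_div_comm, div_le_div_iff₀ (by positivity) (by positivity)]
  rw [← sub_nonneg]
  ring_nf
  positivity

/-- The Euler products compare factor by factor: with u = c + j and v = c + x + j, each factor is an
instance of `sq_sub_div_mono` with h = s. -/
lemma gammaRatio_mul_mono {s c d x : ℝ} (hs : 0 ≤ s) (hd : 0 < d) (hdc : d < c) (hx : 0 ≤ x) :
    gammaRatio s (c - d) * gammaRatio s (c + d) * gammaRatio s (c + x) ^ 2 ≤
      gammaRatio s (c - d + x) * gammaRatio s (c + d + x) * gammaRatio s c ^ 2 := by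
  have h1 := tendsto_gammaRatio hs (x := c - d) (by linarith)
  have h2 := tendsto_gammaRatio hs (x := c + d) (by linarith)
  have h3 := tendsto_gammaRatio hs (x := c + x) (by linarith)
  have h4 := tendsto_gammaRatio hs (x := c - d + x) (by linarith)
  have h5 := tendsto_gammaRatio hs (x := c + d + x) (by linarith)
  have h6 := tendsto_gammaRatio hs (x := c) (by linarith)
  refine le_of_tendsto_of_tendsto ((h1.mul h2).mul (h3.pow 2)) ((h4.mul h5).mul (h6.pow 2)) ?_
  refine Eventually.of_forall fun m => ?_
  -- Both sides contain the normalisation m^s exactly four times, so it drops out.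
  have key : ∀ (K A B C A' B' C' : ℝ), A * B * C ^ 2 ≤ A' * B' * C' ^ 2 → 0 ≤ K →
      K * A * (K * B) * (K * C) ^ 2 ≤ K * A' * (K * B') * (K * C') ^ 2 := by
    intro K A B C A' B' C' h hK
    calc _ = K ^ 4 * (A * B * C ^ 2) := by ring
      _ ≤ K ^ 4 * (A' * B' * C' ^ 2) := by gcongr
      _ = _ := by ring
  refine key _ _ _ _ _ _ _ ?_ (by positivity)
  rw [← Finset.prod_mul_distrib, ← Finset.prod_pow, ← Finset.prod_mul_distrib,
    ← Finset.prod_mul_distrib, ← Finset.prod_pow, ← Finset.prod_mul_distrib]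
  refine Finset.prod_le_prod (fun j _ => ?_) fun j _ => ?_
  · have : 0 < c - d := by linarith
    have : 0 < c := by linarith
    positivity
  have hj : (0 : ℝ) ≤ j := by positivity
  have hc : 0 < c := by linarith
  have hcd : 0 < c - d := by linarith
  have := sq_sub_div_mono (h := s) hd hs (u := c + j) (v := c + x + j) (by linarith) (by linarith)
  have hA' : 0 < (c + j + s) ^ 2 - d ^ 2 := by nlinarith
  have hB' : 0 < (c + x + j + s) ^ 2 - d ^ 2 := by nlinarith
  have hu : 0 < c + j := by linarith
  have hv : 0 < c + x + j := by linarith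
  have h7 := mul_le_mul_of_nonneg_right this
    (show 0 ≤ (c + j) ^ 2 * (c + x + j) ^ 2 /
      (((c + j + s) ^ 2 - d ^ 2) * ((c + x + j + s) ^ 2 - d ^ 2)) by positivity)
  have e1 : (c + j + s) ^ 2 - d ^ 2 = (c - d + s + j) * (c + d + s + j) := by ring
  have e2 : (c + x + j + s) ^ 2 - d ^ 2 = (c - d + x + s + j) * (c + d + x + s + j) := by ring
  have p1 : 0 < c - d + s + j := by linarith
  have p2 : 0 < c + d + s + j := by linarith
  have p3 : 0 < c - d + x + s + j := by linarith
  have p4 : 0 < c + d + x + s + j := by linarith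
  have p5 : 0 < c + j + s := by linarith
  have p6 : 0 < c + x + j + s := by linarith
  have p7 : 0 < c + x + s + j := by linarith
  have p8 : 0 < c + s + j := by linarith
  rw [e1, e2] at h7
  convert h7 using 1
  · rw [show c + x + j + s = c + x + s + j by ring]
    field_simp
    ring
  · rw [show c + j + s = c + s + j by ring]
    field_simp
    ring

/-- The ratio `Γ(z + s) / Γ(z)` at complex argument. -/
def gammaRatioC (s : ℝ) (z : ℂ) : ℂ := Complex.Gamma (z + s) / Complex.Gamma z

lemma gammaRatioC_ofReal (s x : ℝ) : gammaRatioC s x = gammaRatio s x := by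
  simp [gammaRatioC, gammaRatio, ← Complex.ofReal_add, Complex.Gamma_ofReal]

lemma norm_betaIntegral_le (u v : ℂ) :
    ‖Complex.betaIntegral u v‖ ≤ ∫ x in (0 : ℝ)..1, x ^ (u.re - 1) * (1 - x) ^ (v.re - 1) := by
  unfold Complex.betaIntegral
  refine (intervalIntegral.norm_integral_le_integral_norm zero_le_one).trans (le_of_eq ?_)
  rw [intervalIntegral.integral_of_le zero_le_one, intervalIntegral.integral_of_le zero_le_one,
    integral_Ioc_eq_integral_Ioo, integral_Ioc_eq_integral_Ioo]
  refine setIntegral_congr_fun measurableSet_Ioo fun x hx => ?_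
  have h1 : (1 : ℂ) - x = ((1 - x : ℝ) : ℂ) := by push_cast; ring
  simp only [norm_mul, h1]
  rw [Complex.norm_cpow_eq_rpow_re_of_pos hx.1,
    Complex.norm_cpow_eq_rpow_re_of_pos (sub_pos.2 hx.2)]
  simp

/-- Polynomial growth of the Gamma ratio on a vertical line. -/
lemma exists_norm_gammaRatioC_le {s a : ℝ} (hs0 : 0 < s) (hs2 : s < 2) (ha : 0 < a) :
    ∃ C, ∀ z : ℂ, z.re = a → ‖gammaRatioC s z‖ ≤ C * (‖z‖ * (‖z‖ + 1)) := by
  refine ⟨‖(Complex.Gamma (2 - s : ℝ))‖⁻¹ *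
    ∫ x in (0 : ℝ)..1, x ^ (a + s - 1) * (1 - x) ^ (2 - s - 1), fun z hz => ?_⟩
  have hz0 : z ≠ 0 := by rintro rfl; simp at hz; linarith
  have hz1 : z + 1 ≠ 0 := by
    intro h
    have := congrArg Complex.re h
    simp at this
    linarith
  have hg : Complex.Gamma z ≠ 0 := Complex.Gamma_ne_zero_of_re_pos (by rw [hz]; exact ha)
  have hg2 : Complex.Gamma (2 - s : ℝ) ≠ 0 :=
    Complex.Gamma_ne_zero_of_re_pos (by simpa using hs2)
  have hu : 0 < (z + s).re := by simp [hz]; linarith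
  have hv : 0 < ((2 - s : ℝ) : ℂ).re := by simpa using hs2
  have hb := Complex.Gamma_mul_Gamma_eq_betaIntegral hu hv
  -- The second Beta argument 2 - s makes the sum z + 2, so that Γ(z + 2) = z(z + 1)Γ(z); s < 2
  -- keeps the Beta integral convergent.
  have he : z + s + ((2 - s : ℝ) : ℂ) = z + 1 + 1 := by push_cast; ring
  rw [he, Complex.Gamma_add_one _ hz1, Complex.Gamma_add_one _ hz0] at hb
  have h2 : gammaRatioC s z = z * (z + 1) * Complex.betaIntegral (z + s) ((2 - s : ℝ) : ℂ) /
      Complex.Gamma (2 - s : ℝ) := by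
    rw [gammaRatioC, div_eq_div_iff hg hg2, hb]; ring
  have h3 := norm_betaIntegral_le (z + s) ((2 - s : ℝ) : ℂ)
  have h4 : (z + s).re - 1 = a + s - 1 := by simp [hz]
  rw [h4, Complex.ofReal_re] at h3
  rw [h2, norm_div, norm_mul, norm_mul, div_eq_inv_mul]
  have h5 : ‖z + 1‖ ≤ ‖z‖ + 1 := (norm_add_le _ _).trans (by simp)
  calc _ ≤ ‖Complex.Gamma (2 - s : ℝ)‖⁻¹ * (‖z‖ * (‖z‖ + 1) *
        ∫ x in (0 : ℝ)..1, x ^ (a + s - 1) * (1 - x) ^ (2 - s - 1)) := by gcongr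
    _ = _ := by ring

lemma continuousAt_gammaRatioC {s : ℝ} {z : ℂ} (hs0 : 0 < s) (hz : 0 < z.re) :
    ContinuousAt (gammaRatioC s) z := by
  have h : ∀ w : ℂ, 0 < w.re → ContinuousAt Complex.Gamma w := fun w hw =>
    (Complex.differentiableAt_Gamma w fun m hm => by
      rw [hm] at hw; simp at hw; linarith [(Nat.cast_nonneg m : (0 : ℝ) ≤ m)]).continuousAt
  refine ContinuousAt.div ?_ (h z hz) (Complex.Gamma_ne_zero_of_re_pos hz)
  exact ContinuousAt.comp (f := fun w : ℂ => w + s) (h _ (by simp; linarith)) (by fun_prop)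

/-! ### The symbol and its comparison across degrees. -/

/-- The symbol of `(-Δ) ^ s` on functions `r ^ (-γ) Y` with `Y` a spherical harmonic of degree
`k`. -/
def symbolC (n : ℕ) (s : ℝ) (k : ℕ) (γ : ℂ) : ℂ :=
  2 ^ (2 * s : ℂ) * gammaRatioC s (γ / 2 + k / 2) * gammaRatioC s (n / 2 - s - γ / 2 + k / 2)

/-- The symbol of `(-Δ) ^ s` on functions `r ^ (-γ) Y` with `Y` a spherical harmonic of degree
`k`, for real `γ`. -/
def symbol (n : ℕ) (s : ℝ) (k : ℕ) (γ : ℝ) : ℝ :=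
  2 ^ (2 * s) * gammaRatio s (γ / 2 + k / 2) * gammaRatio s (n / 2 - s - γ / 2 + k / 2)

lemma symbolC_ofReal (n : ℕ) (s : ℝ) (k : ℕ) (γ : ℝ) :
    symbolC n s k γ = symbol n s k γ := by
  simp only [symbolC, symbol, Complex.ofReal_mul, ← gammaRatioC_ofReal]
  rw [Complex.ofReal_cpow (by norm_num)]
  push_cast
  rfl

lemma symbol_pos {n : ℕ} {s γ : ℝ} (hs : 0 ≤ s) (hγ : 0 < γ) (hγ' : γ < n - 2 * s) (k : ℕ) :
    0 < symbol n s k γ := by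
  unfold symbol
  have h1 := gammaRatio_pos hs (x := γ / 2 + k / 2) (by positivity)
  have h2 := gammaRatio_pos hs (x := n / 2 - s - γ / 2 + k / 2)
    (by have : (0 : ℝ) ≤ k / 2 := by positivity
        linarith)
  positivity

/-- The quotient of the symbols at `γ` and at the midpoint `(n - 2 s) / 2` is smallest for
`k = 0`. -/
lemma symbol_mul_symbol_zero_le {n : ℕ} {s γ : ℝ} (hs : 0 ≤ s) (hγ : 0 < γ)
    (hγ' : γ < (n - 2 * s) / 2) (k : ℕ) :
    symbol n s k ((n - 2 * s) / 2) * symbol n s 0 γ ≤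
      symbol n s 0 ((n - 2 * s) / 2) * symbol n s k γ := by
  -- The two ratios in `symbol` have arguments c - d + k/2 and c + d + k/2 with d = (γ₀ - γ)/2; at
  -- the midpoint γ₀ both are c + k/2.
  have h := gammaRatio_mul_mono (s := s) (c := (n - 2 * s) / 4) (d := (n - 2 * s) / 4 - γ / 2)
    (x := k / 2) hs (by linarith) (by linarith) (by positivity)
  unfold symbol
  have e1 : ((n : ℝ) - 2 * s) / 4 - ((n - 2 * s) / 4 - γ / 2) = γ / 2 := by ring
  have e2 : ((n : ℝ) - 2 * s) / 4 + ((n - 2 * s) / 4 - γ / 2) = n / 2 - s - γ / 2 := by ring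
  have e3 : ((n : ℝ) - 2 * s) / 2 / 2 = (n - 2 * s) / 4 := by ring
  have e4 : (n : ℝ) / 2 - s - (n - 2 * s) / 4 = (n - 2 * s) / 4 := by ring
  rw [e1, e2] at h
  rw [e3, e4]
  simp only [Nat.cast_zero, zero_div, add_zero]
  have h2 := mul_le_mul_of_nonneg_left h (show (0 : ℝ) ≤ (2 ^ (2 * s)) ^ 2 by positivity)
  refine le_trans (le_of_eq ?_) (h2.trans (le_of_eq ?_)) <;> ring

/-! ### Solid harmonics, Gaussians and Bochner–Hecke. -/

/-- Evaluation of a real polynomial on Euclidean space. -/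
def peval (P : MvPolynomial (Fin n) ℝ) (x : E n) : ℝ := eval (fun i => x i) P

/-- The Laplacian of a polynomial. -/
def lap (P : MvPolynomial (Fin n) ℝ) : MvPolynomial (Fin n) ℝ := ∑ i, pderiv i (pderiv i P)

/-- Solid harmonics: harmonic homogeneous polynomials of degree `k`. -/
structure IsSolid (k : ℕ) (P : MvPolynomial (Fin n) ℝ) : Prop where
  homogeneous : P.IsHomogeneous k
  lap_eq : lap P = 0

@[simp] lemma peval_C (a : ℝ) : peval (C a : MvPolynomial (Fin n) ℝ) = fun _ => a := by
  ext x; simp [peval]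

@[simp] lemma peval_X (i : Fin n) (x : E n) : peval (X i) x = x i := by simp [peval]

@[simp] lemma peval_zero (x : E n) : peval (0 : MvPolynomial (Fin n) ℝ) x = 0 := by simp [peval]

@[simp] lemma peval_one (x : E n) : peval (1 : MvPolynomial (Fin n) ℝ) x = 1 := by simp [peval]

@[simp] lemma peval_add (P Q : MvPolynomial (Fin n) ℝ) (x : E n) :
    peval (P + Q) x = peval P x + peval Q x := by simp [peval]

@[simp] lemma peval_mul (P Q : MvPolynomial (Fin n) ℝ) (x : E n) :
    peval (P * Q) x = peval P x * peval Q x := by simp [peval]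

@[simp] lemma peval_sum {ι : Type*} (t : Finset ι) (P : ι → MvPolynomial (Fin n) ℝ) (x : E n) :
    peval (∑ i ∈ t, P i) x = ∑ i ∈ t, peval (P i) x := by simp [peval]

lemma hasFDerivAt_peval (P : MvPolynomial (Fin n) ℝ) (x : E n) :
    HasFDerivAt (peval P) (∑ i, peval (pderiv i P) x • (EuclideanSpace.proj i : E n →L[ℝ] ℝ)) x := by
  induction P using MvPolynomial.induction_on with
  | C a =>
    simp only [peval_C, pderiv_C, peval_zero, zero_smul, Finset.sum_const_zero]
    exact hasFDerivAt_const a x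
  | add p q hp hq =>
    convert! hp.add hq using 1
    · ext y; simp
    · simp [add_smul, Finset.sum_add_distrib]
  | mul_X p j hp =>
    have h2 : HasFDerivAt (fun y : E n => y j) (EuclideanSpace.proj j : E n →L[ℝ] ℝ) x :=
      (EuclideanSpace.proj j : E n →L[ℝ] ℝ).hasFDerivAt
    convert! hp.mul h2 using 1
    · ext y; simp
    · ext v
      simp only [Derivation.leibniz, pderiv_X, smul_eq_mul, peval_add, peval_mul, peval_X,
        sum_apply, smul_apply, add_apply, add_mul, Finset.sum_add_distrib]
      congr 1
      · rw [Finset.sum_eq_single j]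
        · simp
        · intro b _ hb; simp [hb.symm]
        · simp
      · rw [Finset.mul_sum]; exact Finset.sum_congr rfl fun i _ => by ring

lemma contDiff_peval (P : MvPolynomial (Fin n) ℝ) : ContDiff ℝ ∞ (peval P) := by
  induction P using MvPolynomial.induction_on with
  | C a => rw [peval_C]; exact contDiff_const
  | add p q hp hq =>
    have := hp.add hq
    convert! this using 1
    ext y; simp
  | mul_X p j hp =>
    have := hp.mul (EuclideanSpace.proj j : E n →L[ℝ] ℝ).contDiff
    convert! this using 1
    ext y; simp

lemma continuous_peval (P : MvPolynomial (Fin n) ℝ) : Continuous (peval P) :=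
  (contDiff_peval P).continuous

lemma peval_smul {k : ℕ} {P : MvPolynomial (Fin n) ℝ} (hP : P.IsHomogeneous k) (c : ℝ) (x : E n) :
    peval P (c • x) = c ^ k * peval P x := by
  simp only [peval, eval_eq', PiLp.smul_apply, smul_eq_mul, mul_pow, Finset.prod_mul_distrib,
    Finset.mul_sum]
  refine Finset.sum_congr rfl fun d hd => ?_
  have h := hP (mem_support_iff.1 hd)
  have h2 : ∏ i, c ^ d i = c ^ k := by
    rw [Finset.prod_pow_eq_pow_sum, ← h, Finsupp.weight_apply, Finsupp.sum_fintype _ _ (by simp)]; simp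
  rw [h2]; ring

lemma exists_abs_peval_le {k : ℕ} {P : MvPolynomial (Fin n) ℝ} (hP : P.IsHomogeneous k) :
    ∃ C, 0 ≤ C ∧ ∀ x : E n, |peval P x| ≤ C * ‖x‖ ^ k := by
  obtain ⟨C, hC⟩ := (isCompact_sphere (0 : E n) 1).exists_bound_of_continuousOn
    (continuous_peval P).continuousOn
  refine ⟨max C |peval P 0|, le_max_of_le_right (abs_nonneg _), fun x => ?_⟩
  rcases eq_or_ne x 0 with rfl | hx
  · rcases Nat.eq_zero_or_pos k with rfl | hk
    · simp
    · have := peval_smul hP 0 (0 : E n)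
      simp only [zero_smul, zero_pow hk.ne', zero_mul] at this
      simp [this, zero_pow hk.ne']
  · have h1 : x = ‖x‖ • (‖x‖⁻¹ • x) := by
      rw [smul_smul, mul_inv_cancel₀ (norm_ne_zero_iff.2 hx), one_smul]
    have h2 := hC (‖x‖⁻¹ • x) (by simpa using norm_smul_inv_norm (𝕜 := ℝ) hx)
    rw [h1, peval_smul hP, abs_mul, abs_of_nonneg (by positivity), ← h1, mul_comm]
    gcongr
    exact h2.trans (le_max_left _ _)

lemma integrable_norm_pow_mul_gaussian (k : ℕ) {b : ℝ} (hb : 0 < b) (hn : 0 < n) :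
    Integrable (fun x : E n => ‖x‖ ^ k * Real.exp (-b * ‖x‖ ^ 2)) := by
  have : Nontrivial (E n) := Module.nontrivial_of_finrank_pos (R := ℝ) (by simpa using hn)
  refine (integrable_fun_norm_addHaar (volume : Measure (E n))
    (f := fun r => r ^ k * Real.exp (-b * r ^ 2))).2 ?_
  have h := integrableOn_rpow_mul_exp_neg_mul_sq hb
    (s := ((Module.finrank ℝ (E n) - 1 + k : ℕ) : ℝ)) (by linarith [(Nat.cast_nonneg _ : (0:ℝ) ≤ ((Module.finrank ℝ (E n) - 1 + k : ℕ) : ℝ))])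
  refine h.congr_fun (fun r _ => ?_) measurableSet_Ioi
  simp only [Real.rpow_natCast, smul_eq_mul, pow_add]
  ring

/-- A homogeneous polynomial times a Gaussian. -/
def polyGaussian (t : ℝ) (P : MvPolynomial (Fin n) ℝ) (x : E n) : ℂ :=
  ((peval P x * Real.exp (-(Real.pi * t) * ‖x‖ ^ 2) : ℝ) : ℂ)

lemma norm_polyGaussian (t : ℝ) (P : MvPolynomial (Fin n) ℝ) (x : E n) :
    ‖polyGaussian t P x‖ = |peval P x| * Real.exp (-(Real.pi * t) * ‖x‖ ^ 2) := by
  rw [polyGaussian, Complex.norm_real, norm_mul, Real.norm_eq_abs, Real.norm_eq_abs, Real.abs_exp]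

lemma continuous_polyGaussian (t : ℝ) (P : MvPolynomial (Fin n) ℝ) :
    Continuous (polyGaussian t P) := by
  unfold polyGaussian
  have := continuous_peval P
  fun_prop

lemma integrable_polyGaussian {k : ℕ} {t : ℝ} (ht : 0 < t) (hn : 0 < n)
    {P : MvPolynomial (Fin n) ℝ} (hP : P.IsHomogeneous k) : Integrable (polyGaussian t P) := by
  obtain ⟨C, hC0, hC⟩ := exists_abs_peval_le hP
  refine ((integrable_norm_pow_mul_gaussian k (b := Real.pi * t) (by positivity) hn).const_mul
    C).mono' (continuous_polyGaussian t P).aestronglyMeasurable (Eventually.of_forall fun x => ?_)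
  rw [norm_polyGaussian, ← mul_assoc]
  gcongr
  exact hC x

lemma fourier_const_smul (c : ℂ) (f : E n → ℂ) (ξ : E n) :
    𝓕 (fun x => c • f x) ξ = c • 𝓕 f ξ := by
  simp only [Real.fourier_eq, ← integral_smul]
  congr 1
  ext x
  rw [smul_comm]

/-- Multiplication by a coordinate is differentiation on the Fourier side. The derivative is an
argument, so that it can be computed from an explicit formula for 𝓕 f. -/
lemma fourier_coord_mul {f : E n → ℂ} (hf : Integrable f)
    (hf' : Integrable fun x => ‖x‖ * ‖f x‖) (j : Fin n) (ξ : E n)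
    {f' : E n →L[ℝ] ℂ} (h : HasFDerivAt (𝓕 f) f' ξ) :
    𝓕 (fun x : E n => (x j : ℂ) * f x) ξ =
      Complex.I / (2 * Real.pi) * f' (EuclideanSpace.single j 1) := by
  have h1 := Real.hasFDerivAt_fourier hf hf' ξ
  have hm : AEStronglyMeasurable f := hf.1
  have hi : Integrable (VectorFourier.fourierSMulRight (innerSL ℝ) f) := by
    refine (hf'.const_mul (2 * Real.pi * ‖innerSL ℝ (E := E n)‖)).mono'
      hm.fourierSMulRight (Eventually.of_forall fun x => ?_)
    simpa [mul_assoc] using VectorFourier.norm_fourierSMulRight_le (innerSL ℝ) f x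
  rw [h.unique h1, Real.fourier_continuousLinearMap_apply hi]
  have h2 : (fun x => (VectorFourier.fourierSMulRight (innerSL ℝ) f x) (EuclideanSpace.single j 1))
      = (fun x : E n => (-(2 * Real.pi * Complex.I)) • ((x j : ℂ) * f x)) := by
    ext x
    have h3 : (innerSL ℝ x) (EuclideanSpace.single j (1 : ℝ)) = x j := by
      rw [innerSL_apply_apply, EuclideanSpace.inner_single_right]; simp
    simp only [VectorFourier.fourierSMulRight_apply, h3]
    simp
  rw [h2]
  rw [fourier_const_smul, smul_eq_mul]
  have := Complex.I_sq
  have hpi : (Real.pi : ℂ) ≠ 0 := by exact_mod_cast Real.pi_ne_zero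
  field_simp
  rw [this]; ring

lemma IsSolid.pderiv {k : ℕ} {P : MvPolynomial (Fin n) ℝ} (hP : IsSolid (k + 1) P) (i : Fin n) :
    IsSolid k (pderiv i P) := by
  refine ⟨hP.homogeneous.pderiv, ?_⟩
  have h : lap (MvPolynomial.pderiv i P) = MvPolynomial.pderiv i (lap P) := by
    simp only [lap, map_sum]
    refine Finset.sum_congr rfl fun j _ => ?_
    have hc : ∀ Q : MvPolynomial (Fin n) ℝ, MvPolynomial.pderiv j (MvPolynomial.pderiv i Q) =
        MvPolynomial.pderiv i (MvPolynomial.pderiv j Q) := fun Q => by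
      -- A commutator of derivations is a derivation, so it vanishes once it kills the variables.
      have h0 : ⁅(MvPolynomial.pderiv j :
          Derivation ℝ (MvPolynomial (Fin n) ℝ) (MvPolynomial (Fin n) ℝ)),
          MvPolynomial.pderiv i⁆ = 0 :=
        MvPolynomial.derivation_ext fun l => by
          change MvPolynomial.pderiv j (MvPolynomial.pderiv i (X l : MvPolynomial (Fin n) ℝ)) -
            MvPolynomial.pderiv i (MvPolynomial.pderiv j (X l : MvPolynomial (Fin n) ℝ)) = 0
          classical
          simp only [pderiv_X, Pi.single_apply]
          split_ifs <;> simp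
      exact sub_eq_zero.1 (DFunLike.congr_fun h0 Q)
    rw [hc P, hc]
  rw [h, hP.lap_eq, map_zero]

lemma exists_hasFDerivAt_polyGaussian (t : ℝ) (P : MvPolynomial (Fin n) ℝ) (x : E n) :
    ∃ f' : E n →L[ℝ] ℂ, HasFDerivAt (polyGaussian t P) f' x ∧
      ∀ j, f' (EuclideanSpace.single j 1) = polyGaussian t (MvPolynomial.pderiv j P) x -
        2 * Real.pi * t * x j * polyGaussian t P x := by
  have h1 := hasFDerivAt_peval P x
  have h2 : HasFDerivAt (fun y : E n => ‖y‖ ^ 2) (2 • (innerSL ℝ x)) x :=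
    (hasStrictFDerivAt_norm_sq x).hasFDerivAt
  have h3 := h1.mul (h2.const_mul (-(Real.pi * t))).exp
  refine ⟨_, Complex.ofRealCLM.hasFDerivAt.comp x h3, fun j => ?_⟩
  have h4 : (innerSL ℝ x) (EuclideanSpace.single j (1 : ℝ)) = x j := by
    rw [innerSL_apply_apply, EuclideanSpace.inner_single_right]; simp
  have h5 : (∑ i, peval (MvPolynomial.pderiv i P) x • (EuclideanSpace.proj i : E n →L[ℝ] ℝ))
      (EuclideanSpace.single j (1 : ℝ)) = peval (MvPolynomial.pderiv j P) x := by
    rw [sum_apply, Finset.sum_eq_single j]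
    · simp
    · intro b _ hb; simp [hb]
    · simp
  simp only [ContinuousLinearMap.comp_apply, add_apply, smul_apply, h4, h5, polyGaussian,
    Complex.ofRealCLM_apply]
  simp
  ring

lemma polyGaussian_sum {ι : Type*} (u : Finset ι) (t : ℝ) (P : ι → MvPolynomial (Fin n) ℝ)
    (x : E n) : polyGaussian t (∑ i ∈ u, P i) x = ∑ i ∈ u, polyGaussian t (P i) x := by
  simp [polyGaussian, Finset.sum_mul]

lemma polyGaussian_X_mul (t : ℝ) (i : Fin n) (P : MvPolynomial (Fin n) ℝ) (x : E n) :
    polyGaussian t (X i * P) x = x i * polyGaussian t P x := by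
  simp [polyGaussian, mul_assoc]

lemma sum_coord_mul_polyGaussian {k : ℕ} {P : MvPolynomial (Fin n) ℝ} (hP : P.IsHomogeneous k)
    (t : ℝ) (x : E n) :
    ∑ i, (x i : ℂ) * polyGaussian t (MvPolynomial.pderiv i P) x = k * polyGaussian t P x := by
  simp only [← polyGaussian_X_mul]
  rw [← polyGaussian_sum, hP.sum_X_mul_pderiv]
  simp [polyGaussian, peval, mul_assoc]

/-- Bochner–Hecke: the Fourier transform of a solid harmonic times a Gaussian. -/
theorem fourier_polyGaussian (hn : 0 < n) {t : ℝ} (ht : 0 < t) {k : ℕ}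
    {P : MvPolynomial (Fin n) ℝ} (hP : IsSolid k P) (ξ : E n) :
    𝓕 (polyGaussian t P) ξ =
      (-Complex.I) ^ k * ((t ^ (-((n : ℝ) / 2 + k)) : ℝ) : ℂ) * polyGaussian t⁻¹ P ξ := by
  induction k generalizing P ξ with
  | zero =>
    obtain ⟨c, rfl⟩ : ∃ c, P = C c :=
      ⟨_, (totalDegree_eq_zero_iff_eq_C).1 (Nat.le_zero.1 hP.homogeneous.totalDegree_le)⟩
    have h := fourier_gaussian_innerProductSpace (V := E n) (b := ((Real.pi * t : ℝ) : ℂ))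
      (by simpa using by positivity) ξ
    have h1 : polyGaussian t (C c : MvPolynomial (Fin n) ℝ) =
        fun v : E n => (c : ℂ) • Complex.exp (-((Real.pi * t : ℝ) : ℂ) * ‖v‖ ^ 2) := by
      ext v; simp [polyGaussian]
    have h3 := fourier_const_smul (c : ℂ)
      (fun v : E n => Complex.exp (-((Real.pi * t : ℝ) : ℂ) * ‖v‖ ^ 2)) ξ
    rw [h1, h3, h]
    have hpi : (Real.pi : ℂ) ≠ 0 := by exact_mod_cast Real.pi_ne_zero
    have htc : (t : ℂ) ≠ 0 := by exact_mod_cast ht.ne'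
    have h4 : ((Real.pi : ℂ) / ((Real.pi * t : ℝ) : ℂ)) = ((t⁻¹ : ℝ) : ℂ) := by
      push_cast; field_simp
    rw [h4, Real.rpow_neg ht.le, ← Real.inv_rpow ht.le, Complex.ofReal_cpow (by positivity)]
    simp only [polyGaussian, peval_C, finrank_euclideanSpace, Fintype.card_fin]
    push_cast
    simp only [pow_zero, smul_eq_mul, one_mul, add_zero]
    rw [show -(Real.pi : ℂ) ^ 2 * ‖ξ‖ ^ 2 / (Real.pi * t) = -(Real.pi * (t : ℂ)⁻¹) * ‖ξ‖ ^ 2 by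
      field_simp]
    ring
  | succ k ih =>
    -- Euler's identity writes (k + 1)P as Σ x_i ∂_i P with each ∂_i P solid of degree k. On the
    -- Fourier side x_i becomes a derivative: the terms ∂_i ∂_i P add up to ΔP = 0, and the
    -- derivatives of the Gaussian give P back by Euler again.
    have hh : ∀ i, (X i * MvPolynomial.pderiv i P).IsHomogeneous (1 + k) := fun i =>
      (isHomogeneous_X ℝ i).mul (hP.pderiv i).homogeneous
    have hI : ∀ i, Integrable fun x : E n =>
        (x i : ℂ) * polyGaussian t (MvPolynomial.pderiv i P) x := fun i => by
      simpa only [← polyGaussian_X_mul] using integrable_polyGaussian ht hn (hh i)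
    have h1 : 𝓕 (fun x : E n => ((k + 1 : ℕ) : ℂ) • polyGaussian t P x) ξ =
        ∑ i, 𝓕 (fun x : E n => (x i : ℂ) * polyGaussian t (MvPolynomial.pderiv i P) x) ξ := by
      simp only [Real.fourier_eq]
      rw [← integral_finsetSum]
      · congr 1; ext x
        rw [smul_eq_mul, ← sum_coord_mul_polyGaussian hP.homogeneous, Finset.smul_sum]
      · intro i _
        exact (Real.fourierIntegral_convergent_iff ξ).2 (hI i)
    rw [fourier_const_smul] at h1
    have h2 : ∀ i, 𝓕 (fun x : E n => (x i : ℂ) * polyGaussian t (MvPolynomial.pderiv i P) x) ξ =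
        Complex.I / (2 * Real.pi) *
        ((-Complex.I) ^ k * ((t ^ (-((n : ℝ) / 2 + k)) : ℝ) : ℂ) *
          (polyGaussian t⁻¹ (MvPolynomial.pderiv i (MvPolynomial.pderiv i P)) ξ -
          2 * Real.pi * (t⁻¹ : ℝ) * ξ i * polyGaussian t⁻¹ (MvPolynomial.pderiv i P) ξ)) := by
      intro i
      obtain ⟨f', hf', hj⟩ := exists_hasFDerivAt_polyGaussian t⁻¹ (MvPolynomial.pderiv i P) ξ
      have h3 : 𝓕 (polyGaussian t (MvPolynomial.pderiv i P)) = fun ξ =>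
          (-Complex.I) ^ k * ((t ^ (-((n : ℝ) / 2 + k)) : ℝ) : ℂ) *
            polyGaussian t⁻¹ (MvPolynomial.pderiv i P) ξ := funext fun ξ => ih (hP.pderiv i) ξ
      have h4 := hf'.const_mul ((-Complex.I) ^ k * ((t ^ (-((n : ℝ) / 2 + k)) : ℝ) : ℂ))
      rw [← h3] at h4
      rw [fourier_coord_mul (integrable_polyGaussian ht hn (hP.pderiv i).homogeneous) ?_ i ξ h4,
        smul_apply, hj, smul_eq_mul]
      obtain ⟨C, hC0, hC⟩ := exists_abs_peval_le (hP.pderiv i).homogeneous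
      refine ((integrable_norm_pow_mul_gaussian (k + 1) (b := Real.pi * t) (by positivity)
        hn).const_mul C).mono' ?_ (Eventually.of_forall fun x => ?_)
      · exact (continuous_norm.mul
          (continuous_polyGaussian t _).norm).aestronglyMeasurable
      · rw [norm_mul, norm_norm, norm_norm, norm_polyGaussian]
        calc _ ≤ ‖x‖ * (C * ‖x‖ ^ k * Real.exp (-(Real.pi * t) * ‖x‖ ^ 2)) := by
              gcongr; exact hC x
          _ = _ := by ring
    simp only [h2, ← Finset.mul_sum, Finset.sum_sub_distrib] at h1
    have h5 : ∑ i, 2 * (Real.pi : ℂ) * (t⁻¹ : ℝ) * ξ i * polyGaussian t⁻¹ (MvPolynomial.pderiv i P) ξ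
        = 2 * Real.pi * (t⁻¹ : ℝ) * ((k + 1 : ℕ) * polyGaussian t⁻¹ P ξ) := by
      rw [← sum_coord_mul_polyGaussian hP.homogeneous, Finset.mul_sum]
      exact Finset.sum_congr rfl fun i _ => by ring
    have h6 : ∑ i, polyGaussian t⁻¹ (MvPolynomial.pderiv i (MvPolynomial.pderiv i P)) ξ = 0 := by
      rw [← polyGaussian_sum]
      have := hP.lap_eq
      rw [lap] at this
      simp [this, polyGaussian]
    rw [h5, h6, zero_sub] at h1
    have hk : ((k + 1 : ℕ) : ℂ) ≠ 0 := by exact_mod_cast Nat.succ_ne_zero k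
    have hpi : (Real.pi : ℂ) ≠ 0 := by exact_mod_cast Real.pi_ne_zero
    refine mul_left_cancel₀ hk ?_
    rw [smul_eq_mul] at h1
    rw [h1]
    have h7 : t ^ (-((n : ℝ) / 2 + (k + 1 : ℕ))) = t ^ (-((n : ℝ) / 2 + k)) * t⁻¹ := by
      rw [← Real.rpow_neg_one, ← Real.rpow_add ht]; push_cast; ring_nf
    rw [h7, pow_succ]
    push_cast
    field_simp

/-! ### Superposition of Gaussians and the functional equation. -/

lemma ofReal_cpow_eq_exp {r : ℝ} (hr : 0 < r) (w : ℂ) :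
    (r : ℂ) ^ w = Complex.exp (Real.log r * w) := by
  rw [Complex.cpow_def_of_ne_zero (by exact_mod_cast hr.ne'), Complex.ofReal_log hr.le]

lemma integral_cpow_mul_exp_sq {a : ℂ} (ha : 0 < a.re) {r : ℝ} (hr : 0 < r) :
    ∫ t in Ioi (0 : ℝ), (t : ℂ) ^ (a - 1) * (Real.exp (-(Real.pi * t) * r ^ 2) : ℂ) =
      Complex.Gamma a * (Real.pi : ℂ) ^ (-a) * (r : ℂ) ^ (-2 * a) := by
  have h := Complex.integral_cpow_mul_exp_neg_mul_Ioi ha (r := Real.pi * r ^ 2) (by positivity)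
  have h2 : (1 / ((Real.pi * r ^ 2 : ℝ) : ℂ)) ^ a =
      (Real.pi : ℂ) ^ (-a) * (r : ℂ) ^ (-2 * a) := by
    have h3 : 1 / ((Real.pi * r ^ 2 : ℝ) : ℂ) = (((Real.pi * r ^ 2)⁻¹ : ℝ) : ℂ) := by
      push_cast; rw [one_div]
    rw [h3, ofReal_cpow_eq_exp (by positivity), ofReal_cpow_eq_exp Real.pi_pos,
      ofReal_cpow_eq_exp hr, ← Complex.exp_add, Real.log_inv,
      Real.log_mul Real.pi_ne_zero (by positivity), Real.log_pow]
    push_cast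
    ring_nf
  rw [h2] at h
  rw [mul_assoc, mul_comm (Complex.Gamma a), ← h]
  refine setIntegral_congr_fun measurableSet_Ioi fun t _ => ?_
  push_cast
  ring_nf

lemma integral_rpow_mul_exp_sq {a : ℝ} (ha : 0 < a) {r : ℝ} (hr : 0 < r) :
    ∫ t in Ioi (0 : ℝ), t ^ (a - 1) * Real.exp (-(Real.pi * t) * r ^ 2) =
      Real.Gamma a * Real.pi ^ (-a) * r ^ (-2 * a) := by
  have h := Real.integral_rpow_mul_exp_neg_mul_Ioi ha (r := Real.pi * r ^ 2) (by positivity)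
  have h2 : (1 / (Real.pi * r ^ 2)) ^ a = Real.pi ^ (-a) * r ^ (-2 * a) := by
    rw [one_div, Real.inv_rpow (by positivity), ← Real.rpow_neg (by positivity),
      Real.mul_rpow Real.pi_pos.le (by positivity), ← Real.rpow_natCast r 2,
      ← Real.rpow_mul hr.le]
    push_cast; ring_nf
  rw [h2] at h
  rw [mul_assoc, mul_comm (Real.Gamma a), ← h]
  refine setIntegral_congr_fun measurableSet_Ioi fun t _ => ?_
  ring_nf

lemma integrableOn_rpow_mul_exp_sq {a : ℝ} (ha : 0 < a) {r : ℝ} (hr : 0 < r) :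
    IntegrableOn (fun t => t ^ (a - 1) * Real.exp (-(Real.pi * t) * r ^ 2)) (Ioi (0 : ℝ)) := by
  -- A nonintegrable function has integral 0 by convention, while this integral is positive.
  refine not_imp_comm.1 integral_undef ?_
  rw [integral_rpow_mul_exp_sq ha hr]
  have := Real.Gamma_pos_of_pos ha
  positivity

lemma ae_ne_zero (hn : 0 < n) : ∀ᵐ x : E n, x ≠ 0 := by
  have : Nontrivial (E n) := Module.nontrivial_of_finrank_pos (R := ℝ) (by simpa using hn)
  exact compl_mem_ae_iff.2 (measure_singleton 0)

/-- Justifies Fubini: integrating the modulus over t first leaves at most a constant times ‖x‖^(k -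
2 Re a) ‖g x‖. -/
lemma integrable_gaussian_superposition (hn : 0 < n) {k : ℕ} {P : MvPolynomial (Fin n) ℝ}
    (hP : P.IsHomogeneous k) {a : ℂ} (ha : 0 < a.re) {g : E n → ℂ} (hg : AEStronglyMeasurable g)
    (hint : Integrable fun x : E n => ‖x‖ ^ ((k : ℝ) - 2 * a.re) * ‖g x‖) :
    Integrable (fun q : E n × ℝ => (q.2 : ℂ) ^ (a - 1) * (polyGaussian q.2 P q.1 * g q.1))
      (volume.prod (volume.restrict (Ioi 0))) := by
  obtain ⟨C, hC0, hC⟩ := exists_abs_peval_le hP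
  have hm : AEStronglyMeasurable
      (fun q : E n × ℝ => (q.2 : ℂ) ^ (a - 1) * (polyGaussian q.2 P q.1 * g q.1))
      (volume.prod (volume.restrict (Ioi 0))) := by
    refine AEStronglyMeasurable.mul ?_ (AEStronglyMeasurable.mul ?_ hg.comp_fst)
    · exact (by fun_prop : Measurable fun q : E n × ℝ => (q.2 : ℂ) ^ (a - 1)).aestronglyMeasurable
    · have := continuous_peval P
      unfold polyGaussian
      exact (by fun_prop : Continuous _).aestronglyMeasurable
  have hnorm : ∀ x : E n, ∀ t ∈ Ioi (0 : ℝ),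
      ‖(t : ℂ) ^ (a - 1) * (polyGaussian t P x * g x)‖ =
      |peval P x| * ‖g x‖ * (t ^ (a.re - 1) * Real.exp (-(Real.pi * t) * ‖x‖ ^ 2)) := by
    intro x t ht
    rw [norm_mul, norm_mul, norm_polyGaussian, Complex.norm_cpow_eq_rpow_re_of_pos ht]
    simp only [Complex.sub_re, Complex.one_re]
    ring
  refine (integrable_prod_iff hm).2 ⟨?_, ?_⟩
  · filter_upwards [ae_ne_zero hn, hm.prodMk_left] with x hx hmx
    refine (integrable_norm_iff hmx).1 ?_
    refine IntegrableOn.congr_fun ?_ (fun t ht => (hnorm x t ht).symm) measurableSet_Ioi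
    exact (integrableOn_rpow_mul_exp_sq ha (norm_pos_iff.2 hx)).const_mul _
  · refine (hint.const_mul (C * (Real.Gamma a.re * Real.pi ^ (-a.re)))).mono'
      hm.norm.integral_prod_right' ?_
    filter_upwards [ae_ne_zero hn] with x hx
    have hx' := norm_pos_iff.2 hx
    rw [setIntegral_congr_fun measurableSet_Ioi (hnorm x), integral_const_mul,
      integral_rpow_mul_exp_sq ha hx']
    have hG := Real.Gamma_pos_of_pos ha
    rw [Real.norm_of_nonneg (by positivity), sub_eq_add_neg, Real.rpow_add hx', Real.rpow_natCast]
    calc |peval P x| * ‖g x‖ * (Real.Gamma a.re * Real.pi ^ (-a.re) * ‖x‖ ^ (-2 * a.re))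
        ≤ C * ‖x‖ ^ k * ‖g x‖ * (Real.Gamma a.re * Real.pi ^ (-a.re) * ‖x‖ ^ (-2 * a.re)) := by
          gcongr; exact hC x
      _ = _ := by rw [neg_mul]; ring

/-- The pairing of `P / |x| ^ (2 a)` with `g`. -/
def zetaPairing (P : MvPolynomial (Fin n) ℝ) (a : ℂ) (g : E n → ℂ) : ℂ :=
  ∫ x : E n, peval P x * (‖x‖ : ℂ) ^ (-2 * a) * g x

/-- Since |x|^(-2a) is a Mellin superposition of Gaussians, pairings with P |x|^(-2a) reduce to
pairings with `polyGaussian`, whose Fourier transform is explicit. -/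
lemma gaussian_superposition (hn : 0 < n) {k : ℕ} {P : MvPolynomial (Fin n) ℝ}
    (hP : P.IsHomogeneous k) {a : ℂ} (ha : 0 < a.re) {g : E n → ℂ} (hg : AEStronglyMeasurable g)
    (hint : Integrable fun x : E n => ‖x‖ ^ ((k : ℝ) - 2 * a.re) * ‖g x‖) :
    Complex.Gamma a * (Real.pi : ℂ) ^ (-a) * zetaPairing P a g =
      ∫ t in Ioi (0 : ℝ), (t : ℂ) ^ (a - 1) * ∫ x, polyGaussian t P x * g x := by
  have h := integral_integral_swap (f := fun (x : E n) (t : ℝ) =>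
    (t : ℂ) ^ (a - 1) * (polyGaussian t P x * g x))
    (integrable_gaussian_superposition hn hP ha hg hint)
  simp only [integral_const_mul] at h
  rw [← h, zetaPairing, ← integral_const_mul]
  refine integral_congr_ae ?_
  filter_upwards [ae_ne_zero hn] with x hx
  have h1 : ∀ t : ℝ, (t : ℂ) ^ (a - 1) * (polyGaussian t P x * g x) =
      (peval P x * g x) * ((t : ℂ) ^ (a - 1) * (Real.exp (-(Real.pi * t) * ‖x‖ ^ 2) : ℂ)) := by
    intro t; simp only [polyGaussian]; push_cast; ring
  simp only [h1]
  rw [integral_const_mul, integral_cpow_mul_exp_sq ha (norm_pos_iff.2 hx)]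
  ring

lemma integral_fourier_mul_eq {f g : E n → ℂ} (hf : Integrable f) (hg : Integrable g) :
    ∫ x, 𝓕 f x * g x = ∫ x, f x * 𝓕 g x := by
  have := VectorFourier.integral_fourierIntegral_smul_eq_flip (L := innerₗ (E n))
    Real.continuous_fourierChar continuous_inner hf hg
  rw [flip_innerₗ] at this
  exact this

/-- Functional equation for pairings of solid harmonics with a function and its Fourier
transform. -/
theorem zetaPairing_fourier (hn : 0 < n) {k : ℕ} {P : MvPolynomial (Fin n) ℝ} (hP : IsSolid k P)
    {a b : ℂ} (ha : 0 < a.re) (hb : 0 < b.re) (hab : a + b = n / 2 + k) {f : E n → ℂ}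
    (hf : Integrable f)
    (h1 : Integrable fun x : E n => ‖x‖ ^ ((k : ℝ) - 2 * a.re) * ‖𝓕 f x‖)
    (h2 : Integrable fun x : E n => ‖x‖ ^ ((k : ℝ) - 2 * b.re) * ‖f x‖) :
    Complex.Gamma a * (Real.pi : ℂ) ^ (-a) * zetaPairing P a (𝓕 f) =
      (-Complex.I) ^ k * (Complex.Gamma b * (Real.pi : ℂ) ^ (-b) * zetaPairing P b f) := by
  have hm : AEStronglyMeasurable (𝓕 f) :=
    (VectorFourier.fourierIntegral_continuous Real.continuous_fourierChar
      (L := innerₗ (E n)) continuous_inner hf).aestronglyMeasurable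
  rw [gaussian_superposition hn hP.homogeneous ha hm h1,
    gaussian_superposition hn hP.homogeneous hb hf.1 h2]
  -- Bochner–Hecke replaces t by 1/t; after the same inversion on the right the powers of t agree
  -- exactly because a + b = n/2 + k.
  rw [← integral_comp_rpow_Ioi (fun t : ℝ => (t : ℂ) ^ (b - 1) * ∫ x, polyGaussian t P x * f x)
    (p := -1) (by norm_num), ← integral_const_mul]
  refine setIntegral_congr_fun measurableSet_Ioi fun t (ht : 0 < t) => ?_
  have h3 : ∫ x, polyGaussian t P x * 𝓕 f x = ∫ x, (-Complex.I) ^ k *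
      ((t ^ (-((n : ℝ) / 2 + k)) : ℝ) : ℂ) * (polyGaussian t⁻¹ P x * f x) := by
    rw [← integral_fourier_mul_eq (integrable_polyGaussian ht hn hP.homogeneous) hf]
    congr 1; ext x
    rw [fourier_polyGaussian hn ht hP]; ring
  simp only [h3, integral_const_mul, Real.rpow_neg_one]
  have h4 : (t : ℂ) ^ (a - 1) * ((t ^ (-((n : ℝ) / 2 + k)) : ℝ) : ℂ) =
      ((|(-1 : ℝ)| * t ^ (-1 - 1 : ℝ) : ℝ) : ℂ) * ((t⁻¹ : ℝ) : ℂ) ^ (b - 1) := by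
    rw [abs_neg, abs_one, one_mul, Complex.ofReal_cpow ht.le, Complex.ofReal_cpow ht.le,
      ofReal_cpow_eq_exp ht, ofReal_cpow_eq_exp ht, ofReal_cpow_eq_exp ht,
      ofReal_cpow_eq_exp (inv_pos.2 ht), ← Complex.exp_add, ← Complex.exp_add, Real.log_inv,
      eq_sub_of_add_eq hab]
    push_cast
    ring_nf
  rw [Complex.real_smul, ← mul_assoc ((_ : ℝ) : ℂ), ← h4]
  ring

/-! ### Weighted integrability of test functions and their transforms. -/

lemma integrableOn_rpow_mul_one_add_rpow {β c : ℝ} (hβ : -1 < β) (hc : β + 1 < c) :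
    IntegrableOn (fun r : ℝ => r ^ β * (1 + r) ^ (-c)) (Ioi 0) := by
  have hm : Measurable (fun r : ℝ => r ^ β * (1 + r) ^ (-c)) := by fun_prop
  rw [← Ioc_union_Ioi_eq_Ioi zero_le_one]
  refine IntegrableOn.union ?_ ?_
  · refine Integrable.mono' ((intervalIntegrable_iff_integrableOn_Ioc_of_le zero_le_one).1
      (intervalIntegral.intervalIntegrable_rpow' hβ)) hm.aestronglyMeasurable
      ((ae_restrict_iff' measurableSet_Ioc).2 (Eventually.of_forall fun r hr => ?_))
    have hr0 : 0 < r := hr.1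
    rw [Real.norm_of_nonneg (by positivity)]
    refine mul_le_of_le_one_right (by positivity) ?_
    exact Real.rpow_le_one_of_one_le_of_nonpos (by linarith) (by linarith)
  · refine Integrable.mono' (integrableOn_Ioi_rpow_of_lt (a := β - c) (by linarith) one_pos)
      hm.aestronglyMeasurable
      ((ae_restrict_iff' measurableSet_Ioi).2 (Eventually.of_forall fun r (hr : 1 < r) => ?_))
    have hr0 : 0 < r := by linarith
    rw [Real.norm_of_nonneg (by positivity), sub_eq_add_neg, Real.rpow_add hr0]
    refine mul_le_mul_of_nonneg_left ?_ (by positivity)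
    exact Real.rpow_le_rpow_of_nonpos hr0 (by linarith) (by linarith)

lemma nontrivial_E (hn : 0 < n) : Nontrivial (E n) :=
  Module.nontrivial_of_finrank_pos (R := ℝ) (by simpa using hn)

lemma integrable_norm_rpow_mul_one_add (hn : 0 < n) {b c : ℝ} (hb : -(n : ℝ) < b)
    (hc : n + b < c) : Integrable fun x : E n => ‖x‖ ^ b * (1 + ‖x‖) ^ (-c) := by
  have := nontrivial_E hn
  refine (integrable_fun_norm_addHaar (volume : Measure (E n))
    (f := fun r => r ^ b * (1 + r) ^ (-c))).2 ?_
  refine (integrableOn_rpow_mul_one_add_rpow (β := n - 1 + b) (c := c) (by linarith)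
    (by linarith)).congr_fun (fun r (hr : 0 < r) => ?_) measurableSet_Ioi
  simp only [finrank_euclideanSpace, Fintype.card_fin, smul_eq_mul]
  rw [Real.rpow_add hr, ← Real.rpow_natCast, Nat.cast_sub (by omega), Nat.cast_one, mul_assoc]

/-- A test function as a complex valued Schwartz function. -/
def IsTest.toSchwartz {Ω : Set (E n)} {φ : E n → ℝ} (hφ : IsTest Ω φ) : SchwartzMap (E n) ℂ :=
  (hφ.compact.comp_left (g := fun r : ℝ => (r : ℂ)) rfl).toSchwartzMap
    (Complex.ofRealCLM.contDiff.comp hφ.smooth)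

lemma SchwartzMap_integrable_norm_rpow_mul (hn : 0 < n) {b : ℝ} (hb : -(n : ℝ) < b)
    (f : SchwartzMap (E n) ℂ) : Integrable fun x : E n => ‖x‖ ^ b * ‖f x‖ := by
  obtain ⟨N, hN⟩ := exists_nat_gt ((n : ℝ) + b)
  obtain ⟨C, hC⟩ : ∃ C, ∀ x, (1 + ‖x‖) ^ N * ‖f x‖ ≤ C := by
    refine ⟨2 ^ N * (Finset.Iic (N, 0)).sup
      (fun m => SchwartzMap.seminorm ℝ m.1 m.2) f, fun x => ?_⟩
    have := SchwartzMap.one_add_le_sup_seminorm_apply (𝕜 := ℝ) (m := (N, 0)) (k := N) (n := 0)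
      le_rfl le_rfl f x
    rwa [norm_iteratedFDeriv_zero] at this
  refine ((integrable_norm_rpow_mul_one_add hn hb hN).const_mul C).mono' ?_
    (Eventually.of_forall fun x => ?_)
  · exact (by fun_prop : Measurable fun x : E n => ‖x‖ ^ b).aestronglyMeasurable.mul
      f.continuous.norm.aestronglyMeasurable
  · rw [Real.norm_of_nonneg (by positivity), Real.rpow_neg (by positivity), Real.rpow_natCast]
    have h := hC x
    have h1 : 0 < (1 + ‖x‖) ^ N := by positivity
    rw [mul_comm] at h
    have h2 := (le_div_iff₀ h1).2 h
    calc ‖x‖ ^ b * ‖f x‖ ≤ ‖x‖ ^ b * (C / (1 + ‖x‖) ^ N) := by gcongr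
      _ = _ := by rw [div_eq_mul_inv]; ring

lemma IsTest.integrable_mul {φ : E n → ℝ} (hφ : IsTest {0}ᶜ φ) {F : Type*}
    [NormedAddCommGroup F] [NormedSpace ℝ F] {g : E n → F} (hg : ContinuousOn g {0}ᶜ) :
    Integrable fun x => φ x • g x := by
  refine (integrableOn_iff_integrable_of_support_subset (s := tsupport φ) ?_).1 ?_
  · exact (Function.support_smul_subset_left _ _).trans (subset_tsupport φ)
  · exact ((hφ.smooth.continuous.continuousOn).smul (hg.mono hφ.support)).integrableOn_compact
      hφ.compact

/-- Any exponent is allowed, since φ vanishes near the origin and has compact support. -/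
lemma IsTest.integrable_norm_rpow_mul {φ : E n → ℝ} (hφ : IsTest {0}ᶜ φ) (b : ℝ) :
    Integrable fun x : E n => ‖x‖ ^ b * ‖((φ x : ℝ) : ℂ)‖ := by
  have h := (hφ.integrable_mul (g := fun x => ‖x‖ ^ b) fun x hx =>
    (continuous_norm.continuousAt.rpow_const
      (Or.inl (norm_ne_zero_iff.2 hx))).continuousWithinAt).norm
  refine h.congr (Eventually.of_forall fun x => ?_)
  simp only [norm_smul, Complex.norm_real, Real.norm_eq_abs]
  rw [abs_of_nonneg (by positivity : 0 ≤ ‖x‖ ^ b), mul_comm]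

/-- The Fourier transform of the fractional Laplacian. -/
def fracSymbol (s : ℝ) (φ : E n → ℝ) (ξ : E n) : ℂ :=
  (((2 * Real.pi * ‖ξ‖) ^ (2 * s) : ℝ) : ℂ) * 𝓕 (fun y : E n => (φ y : ℂ)) ξ

lemma fourier_ofReal_neg (φ : E n → ℝ) (ξ : E n) :
    𝓕 (fun y : E n => (φ y : ℂ)) (-ξ) = (starRingEnd ℂ) (𝓕 (fun y : E n => (φ y : ℂ)) ξ) := by
  rw [Real.fourier_eq', Real.fourier_eq', ← integral_conj]
  congr 1; ext y
  rw [smul_eq_mul, smul_eq_mul, map_mul, Complex.conj_ofReal, ← Complex.exp_conj]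
  simp [Complex.conj_ofNat]

/-- For real φ the multiplier satisfies F(-ξ) = conj F(ξ), so its inverse transform is real. -/
lemma fourierInv_fracSymbol (s : ℝ) (φ : E n → ℝ) (x : E n) :
    𝓕⁻ (fracSymbol s φ) x = (fracLaplacian s φ x : ℂ) := by
  have h : (starRingEnd ℂ) (𝓕⁻ (fracSymbol s φ) x) = 𝓕⁻ (fracSymbol s φ) x := by
    rw [Real.fourierInv_eq', ← integral_conj, ← integral_neg_eq_self]
    congr 1; ext ξ
    rw [smul_eq_mul, smul_eq_mul, map_mul, ← Complex.exp_conj]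
    congr 1
    · simp [Complex.conj_ofNat]
    · rw [fracSymbol, fracSymbol, fourier_ofReal_neg, map_mul, Complex.conj_ofReal,
        Complex.conj_conj, norm_neg]
  exact (Complex.conj_eq_iff_re.1 h).symm

lemma norm_fracSymbol (s : ℝ) (φ : E n → ℝ) (ξ : E n) :
    ‖fracSymbol s φ ξ‖ =
      (2 * Real.pi) ^ (2 * s) * (‖ξ‖ ^ (2 * s) * ‖𝓕 (fun y : E n => (φ y : ℂ)) ξ‖) := by
  rw [fracSymbol, norm_mul, Complex.norm_real, Real.norm_of_nonneg (by positivity),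
    Real.mul_rpow (by positivity) (by positivity), mul_assoc]

lemma IsTest.integrable_norm_rpow_mul_fourier (hn : 0 < n) {Ω : Set (E n)} {φ : E n → ℝ}
    (hφ : IsTest Ω φ) {b : ℝ} (hb : -(n : ℝ) < b) :
    Integrable fun ξ : E n => ‖ξ‖ ^ b * ‖𝓕 (fun y : E n => (φ y : ℂ)) ξ‖ :=
  SchwartzMap_integrable_norm_rpow_mul hn hb (𝓕 hφ.toSchwartz)

lemma IsTest.integrable {Ω : Set (E n)} {φ : E n → ℝ} (hφ : IsTest Ω φ) :
    Integrable fun y : E n => (φ y : ℂ) := hφ.toSchwartz.integrable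

lemma IsTest.continuous_fourier {Ω : Set (E n)} {φ : E n → ℝ} (hφ : IsTest Ω φ) :
    Continuous (𝓕 (fun y : E n => (φ y : ℂ))) := (𝓕 hφ.toSchwartz).continuous

lemma IsTest.integrable_norm_rpow_mul_fracSymbol (hn : 0 < n) {s : ℝ} {Ω : Set (E n)}
    {φ : E n → ℝ} (hφ : IsTest Ω φ) {b : ℝ} (hb : -(n : ℝ) < b + 2 * s) :
    Integrable fun ξ : E n => ‖ξ‖ ^ b * ‖fracSymbol s φ ξ‖ := by
  refine ((hφ.integrable_norm_rpow_mul_fourier hn hb).const_mul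
    ((2 * Real.pi) ^ (2 * s))).congr ?_
  filter_upwards [ae_ne_zero hn] with ξ hξ
  rw [norm_fracSymbol, Real.rpow_add (norm_pos_iff.2 hξ)]
  ring

lemma IsTest.continuous_fracSymbol {s : ℝ} (hs : 0 < s) {Ω : Set (E n)} {φ : E n → ℝ}
    (hφ : IsTest Ω φ) : Continuous (fracSymbol s φ) := by
  refine (Complex.continuous_ofReal.comp ?_).mul hφ.continuous_fourier
  exact (continuous_const.mul continuous_norm).rpow_const fun _ => Or.inr (by positivity)

lemma IsTest.integrable_fracSymbol (hn : 0 < n) {s : ℝ} (hs : 0 < s) {Ω : Set (E n)}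
    {φ : E n → ℝ} (hφ : IsTest Ω φ) : Integrable (fracSymbol s φ) := by
  refine (integrable_norm_iff (hφ.continuous_fracSymbol hs).aestronglyMeasurable).1 ?_
  have hn' : (0 : ℝ) < n := by exact_mod_cast hn
  simpa using hφ.integrable_norm_rpow_mul_fracSymbol hn (s := s) (b := 0) (by linarith)

lemma IsTest.continuous_fracLaplacian (hn : 0 < n) {s : ℝ} (hs : 0 < s) {Ω : Set (E n)}
    {φ : E n → ℝ} (hφ : IsTest Ω φ) : Continuous (fracLaplacian s φ) := by
  refine Complex.continuous_re.comp (f := 𝓕⁻ (fracSymbol s φ)) ?_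
  have h := VectorFourier.fourierIntegral_continuous Real.continuous_fourierChar
    (L := -(innerₗ (E n))) (continuous_inner.neg) (hφ.integrable_fracSymbol hn hs)
  exact h

lemma abs_fracLaplacian_le (s : ℝ) (φ : E n → ℝ) (x : E n) :
    |fracLaplacian s φ x| ≤ ∫ ξ, ‖fracSymbol s φ ξ‖ := by
  refine (Complex.abs_re_le_norm _).trans ?_
  exact VectorFourier.norm_fourierIntegral_le_integral_norm _ _ _ _ _

/-! ### Subordination and the decay of the fractional Laplacian. -/

/-- The density `t ^ (-1 - s) (1 - exp (-π t r ^ 2)) ^ 2`, which subordinates `r ^ (2 s)`. -/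
def subDensity (s r t : ℝ) : ℝ := t ^ (-1 - s) * (1 - Real.exp (-(Real.pi * t) * r ^ 2)) ^ 2

lemma subDensity_nonneg {s r t : ℝ} (ht : 0 ≤ t) : 0 ≤ subDensity s r t := by
  unfold subDensity; positivity

lemma measurable_subDensity (s : ℝ) : Measurable fun q : ℝ × ℝ => subDensity s q.1 q.2 := by
  unfold subDensity; fun_prop

/-- The square contributes t² near 0, leaving t^(1-s), integrable for s < 2; at infinity t^(-1-s)
suffices. Without the square only s < 1 would be possible. -/
lemma integrableOn_subDensity_one {s : ℝ} (hs0 : 0 < s) (hs2 : s < 2) :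
    IntegrableOn (subDensity s 1) (Ioi 0) := by
  have hm : Measurable (subDensity s 1) := by unfold subDensity; fun_prop
  rw [← Ioc_union_Ioi_eq_Ioi zero_le_one]
  refine IntegrableOn.union ?_ ?_
  · refine Integrable.mono' (((intervalIntegrable_iff_integrableOn_Ioc_of_le zero_le_one).1
      (intervalIntegral.intervalIntegrable_rpow' (r := 1 - s) (by linarith))).const_mul
      (Real.pi ^ 2)) hm.aestronglyMeasurable
      ((ae_restrict_iff' measurableSet_Ioc).2 (Eventually.of_forall fun t ht => ?_))
    have ht0 : 0 < t := ht.1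
    rw [Real.norm_of_nonneg (subDensity_nonneg ht0.le), subDensity,
      show 1 - s = -1 - s + 2 by ring, Real.rpow_add ht0]
    have h1 := Real.add_one_le_exp (-(Real.pi * t) * 1 ^ 2)
    have h2 : Real.exp (-(Real.pi * t) * 1 ^ 2) ≤ 1 := Real.exp_le_one_iff.2 (by
      have := Real.pi_pos; nlinarith)
    have h3 : (1 - Real.exp (-(Real.pi * t) * 1 ^ 2)) ^ 2 ≤ (Real.pi * t) ^ 2 :=
      pow_le_pow_left₀ (by linarith) (by linarith) 2
    calc _ ≤ t ^ (-1 - s) * (Real.pi * t) ^ 2 := by gcongr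
      _ = _ := by rw [Real.rpow_two]; ring
  · refine Integrable.mono' (integrableOn_Ioi_rpow_of_lt (a := -1 - s) (by linarith) one_pos)
      hm.aestronglyMeasurable
      ((ae_restrict_iff' measurableSet_Ioi).2 (Eventually.of_forall fun t (ht : 1 < t) => ?_))
    have ht0 : 0 < t := by linarith
    rw [Real.norm_of_nonneg (subDensity_nonneg ht0.le), subDensity]
    refine mul_le_of_le_one_right (by positivity) ?_
    have h2 : Real.exp (-(Real.pi * t) * 1 ^ 2) ≤ 1 := Real.exp_le_one_iff.2 (by
      have := Real.pi_pos; nlinarith)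
    have := Real.exp_pos (-(Real.pi * t) * 1 ^ 2)
    exact pow_le_one₀ (by linarith) (by linarith)

/-- The total mass of `subDensity s 1`. -/
def subMass (s : ℝ) : ℝ := ∫ t in Ioi (0 : ℝ), subDensity s 1 t

lemma subMass_pos {s : ℝ} (hs0 : 0 < s) (hs2 : s < 2) : 0 < subMass s := by
  rw [subMass, setIntegral_pos_iff_support_of_nonneg_ae
    ((ae_restrict_iff' measurableSet_Ioi).2 (Eventually.of_forall fun t ht =>
      subDensity_nonneg (le_of_lt ht))) (integrableOn_subDensity_one hs0 hs2)]
  have : Ioi (0 : ℝ) ⊆ Function.support (subDensity s 1) ∩ Ioi 0 := by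
    intro t (ht : 0 < t)
    refine ⟨?_, ht⟩
    have h2 : Real.exp (-(Real.pi * t) * 1 ^ 2) < 1 := by
      have h0 : -(Real.pi * t) * 1 ^ 2 < 0 := by have := Real.pi_pos; nlinarith
      simpa only [Real.exp_zero] using Real.exp_lt_exp.2 h0
    have : 0 < 1 - Real.exp (-(Real.pi * t) * 1 ^ 2) := by linarith
    exact (by unfold subDensity; positivity : 0 < subDensity s 1 t).ne'
  exact lt_of_lt_of_le (by simp) (measure_mono this)

lemma subDensity_eq_scaled {s r t : ℝ} (hr : 0 < r) (ht : 0 < t) :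
    subDensity s r t = r ^ (2 * s + 2) * subDensity s 1 (r ^ 2 * t) := by
  unfold subDensity
  rw [Real.mul_rpow (by positivity) ht.le, ← Real.rpow_natCast r 2, ← Real.rpow_mul hr.le,
    ← mul_assoc, ← mul_assoc, ← Real.rpow_add hr]
  push_cast
  rw [show 2 * s + 2 + 2 * (-1 - s) = 0 by ring, Real.rpow_zero, one_mul,
    show -(Real.pi * (r ^ (2 : ℝ) * t)) * 1 ^ 2 = -(Real.pi * t) * r ^ (2 : ℝ) by ring]

lemma integrableOn_subDensity {s r : ℝ} (hs0 : 0 < s) (hs2 : s < 2) (hr : 0 < r) :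
    IntegrableOn (subDensity s r) (Ioi 0) := by
  have h : IntegrableOn (fun t => subDensity s 1 (r ^ 2 * t)) (Ioi 0) := by
    have := (integrableOn_Ioi_comp_mul_left_iff (subDensity s 1) 0 (a := r ^ 2) (by positivity)).2
      (by simpa using integrableOn_subDensity_one hs0 hs2)
    exact this
  refine IntegrableOn.congr_fun (Integrable.const_mul h (r ^ (2 * s + 2))) (fun t ht => ?_)
    measurableSet_Ioi
  exact (subDensity_eq_scaled hr ht).symm

/-- Scaling t by r² extracts r^(2s), the radial part of the Fourier multiplier. -/
lemma integral_subDensity {s r : ℝ} (hr : 0 < r) :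
    ∫ t in Ioi (0 : ℝ), subDensity s r t = r ^ (2 * s) * subMass s := by
  rw [setIntegral_congr_fun measurableSet_Ioi fun t ht => subDensity_eq_scaled hr ht,
    integral_const_mul, integral_comp_mul_left_Ioi (subDensity s 1) 0 (b := r ^ 2) (by positivity),
    mul_zero, ← subMass, smul_eq_mul, Real.rpow_add hr, Real.rpow_two]
  field_simp

lemma integrable_subDensity_prod (hn : 0 < n) {s : ℝ} (hs0 : 0 < s) (hs2 : s < 2) {g : E n → ℂ}
    (hg : AEStronglyMeasurable g) (hint : Integrable fun ξ : E n => ‖ξ‖ ^ (2 * s) * ‖g ξ‖) :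
    Integrable (fun q : E n × ℝ => (subDensity s ‖q.1‖ q.2 : ℂ) * g q.1)
      (volume.prod (volume.restrict (Ioi 0))) := by
  have hm : AEStronglyMeasurable
      (fun q : E n × ℝ => (subDensity s ‖q.1‖ q.2 : ℂ) * g q.1)
      (volume.prod (volume.restrict (Ioi 0))) := by
    refine AEStronglyMeasurable.mul ?_ hg.comp_fst
    exact (Complex.measurable_ofReal.comp ((measurable_subDensity s).comp
      (by fun_prop : Measurable fun q : E n × ℝ => (‖q.1‖, q.2)))).aestronglyMeasurable
  have hnorm : ∀ x : E n, ∀ t ∈ Ioi (0 : ℝ),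
      ‖(subDensity s ‖x‖ t : ℂ) * g x‖ = ‖g x‖ * subDensity s ‖x‖ t := by
    intro x t ht
    rw [norm_mul, Complex.norm_real, Real.norm_of_nonneg (subDensity_nonneg (le_of_lt ht)),
      mul_comm]
  refine (integrable_prod_iff hm).2 ⟨?_, ?_⟩
  · filter_upwards [ae_ne_zero hn, hm.prodMk_left] with x hx hmx
    refine (integrable_norm_iff hmx).1 ?_
    refine IntegrableOn.congr_fun ?_ (fun t ht => (hnorm x t ht).symm) measurableSet_Ioi
    exact (integrableOn_subDensity hs0 hs2 (norm_pos_iff.2 hx)).const_mul _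
  · refine (hint.mul_const (subMass s)).congr ?_
    filter_upwards [ae_ne_zero hn] with x hx
    rw [setIntegral_congr_fun measurableSet_Ioi (hnorm x), integral_const_mul,
      integral_subDensity (norm_pos_iff.2 hx)]
    ring

/-- Subordination formula for the fractional Laplacian. -/
lemma IsTest.subMass_mul_fracLaplacian (hn : 0 < n) {s : ℝ} (hs0 : 0 < s) (hs2 : s < 2)
    {Ω : Set (E n)} {φ : E n → ℝ} (hφ : IsTest Ω φ) (x : E n) :
    (subMass s : ℂ) * fracLaplacian s φ x = ((2 * Real.pi) ^ (2 * s) : ℝ) *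
      ∫ t in Ioi (0 : ℝ), ∫ ξ : E n, (subDensity s ‖ξ‖ t : ℂ) *
        (Complex.exp (2 * Real.pi * Complex.I * inner ℝ x ξ) *
          𝓕 (fun y : E n => (φ y : ℂ)) ξ) := by
  have hexp : ∀ ξ : E n, ‖Complex.exp (2 * Real.pi * Complex.I * inner ℝ x ξ)‖ = 1 := fun ξ => by
    rw [show 2 * (Real.pi : ℂ) * Complex.I * inner ℝ x ξ =
      ((2 * Real.pi * inner ℝ x ξ : ℝ) : ℂ) * Complex.I by push_cast; ring]
    exact Complex.norm_exp_ofReal_mul_I _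
  have hc : Continuous fun ξ : E n => Complex.exp (2 * Real.pi * Complex.I * inner ℝ x ξ) *
      𝓕 (fun y : E n => (φ y : ℂ)) ξ := by
    have := hφ.continuous_fourier
    fun_prop
  have hi := integrable_subDensity_prod hn hs0 hs2 hc.aestronglyMeasurable (by
    simpa only [norm_mul, hexp, one_mul] using hφ.integrable_norm_rpow_mul_fourier hn
      (b := 2 * s) (by have : (0 : ℝ) < n := by exact_mod_cast hn
                       linarith))
  rw [← integral_integral_swap (f := fun (ξ : E n) (t : ℝ) => (subDensity s ‖ξ‖ t : ℂ) *
        (Complex.exp (2 * Real.pi * Complex.I * inner ℝ x ξ) *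
          𝓕 (fun y : E n => (φ y : ℂ)) ξ)) hi, ← fourierInv_fracSymbol, Real.fourierInv_eq',
    ← integral_const_mul, ← integral_const_mul]
  refine integral_congr_ae ?_
  filter_upwards [ae_ne_zero hn] with ξ hξ
  rw [integral_mul_const, integral_complex_ofReal, integral_subDensity (norm_pos_iff.2 hξ),
    fracSymbol, Real.mul_rpow (by positivity) (by positivity), real_inner_comm]
  push_cast
  rw [smul_eq_mul]
  ring_nf

/-- The heat flow of a test function, written on the Fourier side. -/
lemma IsTest.integral_gaussian_mul_fourier {Ω : Set (E n)} {φ : E n → ℝ} (hφ : IsTest Ω φ)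
    {t : ℝ} (ht : 0 < t) (x : E n) :
    ∫ ξ : E n, (Real.exp (-(Real.pi * t) * ‖ξ‖ ^ 2) : ℂ) *
      (Complex.exp (2 * Real.pi * Complex.I * inner ℝ x ξ) * 𝓕 (fun y : E n => (φ y : ℂ)) ξ) =
    ∫ y : E n, ((t ^ (-((n : ℝ) / 2)) * Real.exp (-(Real.pi / t) * ‖x - y‖ ^ 2) : ℝ) : ℂ) * φ y := by
  have hb : 0 < ((Real.pi * t : ℝ) : ℂ).re := by simpa using by positivity
  have h := fun y : E n => fourier_gaussian_innerProductSpace' (V := E n) hb x y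
  have hg := GaussianFourier.integrable_cexp_neg_mul_sq_norm_add (V := E n) hb
    (2 * Real.pi * Complex.I) x
  have h2 := integral_fourier_mul_eq hg hφ.integrable
  simp only [h] at h2
  refine Eq.trans ?_ (h2.symm.trans ?_)
  · congr 1; ext ξ
    rw [← mul_assoc, Complex.ofReal_exp, ← Complex.exp_add]
    push_cast; ring_nf
  · congr 1; ext y
    congr 1
    have h4 : ((Real.pi : ℂ) / ((Real.pi * t : ℝ) : ℂ)) = ((t⁻¹ : ℝ) : ℂ) := by
      have hpi : (Real.pi : ℂ) ≠ 0 := by exact_mod_cast Real.pi_ne_zero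
      push_cast; field_simp
    rw [h4, Real.rpow_neg ht.le, ← Real.inv_rpow ht.le]
    simp only [finrank_euclideanSpace, Fintype.card_fin]
    push_cast
    rw [Complex.ofReal_cpow (by positivity)]
    have hpi : (Real.pi : ℂ) ≠ 0 := by exact_mod_cast Real.pi_ne_zero
    push_cast
    congr 2
    field_simp

lemma integral_rpow_mul_exp_div {a r : ℝ} (ha : 0 < a) (hr : 0 < r) :
    IntegrableOn (fun t => t ^ (-1 - a) * Real.exp (-(Real.pi / t) * r ^ 2)) (Ioi (0 : ℝ)) ∧
    ∫ t in Ioi (0 : ℝ), t ^ (-1 - a) * Real.exp (-(Real.pi / t) * r ^ 2) =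
      Real.Gamma a * Real.pi ^ (-a) * r ^ (-2 * a) := by
  have h : ∀ t ∈ Ioi (0 : ℝ), (|(-1 : ℝ)| * t ^ (-1 - 1 : ℝ)) •
      ((t ^ (-1 : ℝ)) ^ (a - 1) * Real.exp (-(Real.pi * t ^ (-1 : ℝ)) * r ^ 2)) =
      t ^ (-1 - a) * Real.exp (-(Real.pi / t) * r ^ 2) := by
    intro t (ht : 0 < t)
    rw [abs_neg, abs_one, one_mul, smul_eq_mul, ← Real.rpow_mul ht.le, ← mul_assoc,
      ← Real.rpow_add ht, Real.rpow_neg_one, ← div_eq_mul_inv]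
    ring_nf
  constructor
  · have h1 := (integrableOn_Ioi_comp_rpow_iff
      (fun t : ℝ => t ^ (a - 1) * Real.exp (-(Real.pi * t) * r ^ 2)) (p := -1) (by norm_num)).2
      (integrableOn_rpow_mul_exp_sq ha hr)
    exact h1.congr_fun h measurableSet_Ioi
  · rw [← integral_rpow_mul_exp_sq ha hr, ← integral_comp_rpow_Ioi
      (fun t : ℝ => t ^ (a - 1) * Real.exp (-(Real.pi * t) * r ^ 2)) (p := -1) (by norm_num)]
    exact (setIntegral_congr_fun measurableSet_Ioi h).symm

/-- Off the support of `φ`, the heat flow is small for small times. -/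
lemma norm_heat_le {φ : E n → ℝ} {R : ℝ} (hR : ∀ y, φ y ≠ 0 → ‖y‖ ≤ R)
    (hi : Integrable fun y : E n => (φ y : ℂ)) {t : ℝ} (ht : 0 < t) {x : E n} (hx : 2 * R ≤ ‖x‖) :
    ‖∫ y : E n, ((t ^ (-((n : ℝ) / 2)) * Real.exp (-(Real.pi / t) * ‖x - y‖ ^ 2) : ℝ) : ℂ) * φ y‖ ≤
      t ^ (-((n : ℝ) / 2)) * Real.exp (-(Real.pi / t) * (‖x‖ / 2) ^ 2) *
        ∫ y : E n, ‖(φ y : ℂ)‖ := by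
  rw [← integral_const_mul]
  refine norm_integral_le_of_norm_le (hi.norm.const_mul _) (Eventually.of_forall fun y => ?_)
  rw [norm_mul, Complex.norm_real, Real.norm_of_nonneg (by positivity)]
  by_cases hy : φ y = 0
  · simp [hy]
  have h1 : ‖x‖ / 2 ≤ ‖x - y‖ := by
    have := norm_sub_norm_le x y
    have := hR y hy
    linarith
  have h2 : 0 < Real.pi / t := by positivity
  refine mul_le_mul_of_nonneg_right (mul_le_mul_of_nonneg_left (Real.exp_le_exp.2 ?_)
    (by positivity)) (norm_nonneg _)
  nlinarith [pow_le_pow_left₀ (by positivity) h1 2]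

lemma integral_sub_two_mul_add {A B D : E n → ℂ} (hA : Integrable A) (hB : Integrable B)
    (hD : Integrable D) :
    ∫ ξ, (A ξ - 2 * B ξ + D ξ) = (∫ ξ, A ξ) - 2 * (∫ ξ, B ξ) + ∫ ξ, D ξ := by
  have h : Integrable fun ξ => A ξ - 2 * B ξ := hA.sub (hB.const_mul 2)
  rw [integral_add h hD, integral_sub hA (hB.const_mul 2), integral_const_mul]

/-- Expanding (1 - e)² = 1 - 2e + e², with e² the same Gaussian at time 2t, gives a second
difference of the heat flow at times 0, t, 2t. The time-0 term is φ(x) by Fourier inversion, which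
vanishes off the support. -/
lemma IsTest.integral_subDensity_mul_fourier {s : ℝ} {Ω : Set (E n)} {φ : E n → ℝ}
    (hφ : IsTest Ω φ) {t : ℝ} (ht : 0 < t) (x : E n) :
    ∃ H : ℝ → ℂ, (∀ t, 0 < t → H t = ∫ y : E n,
        ((t ^ (-((n : ℝ) / 2)) * Real.exp (-(Real.pi / t) * ‖x - y‖ ^ 2) : ℝ) : ℂ) * φ y) ∧
      ∫ ξ : E n, (subDensity s ‖ξ‖ t : ℂ) *
        (Complex.exp (2 * Real.pi * Complex.I * inner ℝ x ξ) * 𝓕 (fun y : E n => (φ y : ℂ)) ξ) =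
      ((t ^ (-1 - s) : ℝ) : ℂ) * (φ x - 2 * H t + H (2 * t)) := by
  refine ⟨fun t => ∫ ξ : E n, (Real.exp (-(Real.pi * t) * ‖ξ‖ ^ 2) : ℂ) *
      (Complex.exp (2 * Real.pi * Complex.I * inner ℝ x ξ) * 𝓕 (fun y : E n => (φ y : ℂ)) ξ),
    fun t ht => hφ.integral_gaussian_mul_fourier ht x, ?_⟩
  have hexp : ∀ ξ : E n, ‖Complex.exp (2 * Real.pi * Complex.I * inner ℝ x ξ)‖ = 1 := fun ξ => by
    rw [show 2 * (Real.pi : ℂ) * Complex.I * inner ℝ x ξ =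
      ((2 * Real.pi * inner ℝ x ξ : ℝ) : ℂ) * Complex.I by push_cast; ring]
    exact Complex.norm_exp_ofReal_mul_I _
  have hcF := hφ.continuous_fourier
  have hi0 : Integrable fun ξ : E n => Complex.exp (2 * Real.pi * Complex.I * inner ℝ x ξ) *
      𝓕 (fun y : E n => (φ y : ℂ)) ξ := by
    refine (integrable_norm_iff (by fun_prop : Continuous _).aestronglyMeasurable).1 ?_
    simp only [norm_mul, hexp, one_mul]
    exact (𝓕 hφ.toSchwartz).integrable.norm
  have hi : ∀ t : ℝ, 0 < t → Integrable fun ξ : E n =>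
      (Real.exp (-(Real.pi * t) * ‖ξ‖ ^ 2) : ℂ) *
      (Complex.exp (2 * Real.pi * Complex.I * inner ℝ x ξ) * 𝓕 (fun y : E n => (φ y : ℂ)) ξ) := by
    intro t ht
    refine hi0.norm.mono' (by fun_prop : Continuous _).aestronglyMeasurable
      (Eventually.of_forall fun ξ => ?_)
    rw [norm_mul, Complex.norm_real, Real.norm_of_nonneg (Real.exp_pos _).le]
    refine mul_le_of_le_one_left (norm_nonneg _) (Real.exp_le_one_iff.2 ?_)
    have : 0 ≤ Real.pi * t * ‖ξ‖ ^ 2 := by positivity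
    linarith
  have hinv : ∫ ξ : E n, Complex.exp (2 * Real.pi * Complex.I * inner ℝ x ξ) *
      𝓕 (fun y : E n => (φ y : ℂ)) ξ = φ x := by
    have h1 : 𝓕⁻ (𝓕 (fun y : E n => (φ y : ℂ))) x = φ x :=
      congrFun (hφ.toSchwartz.continuous.fourierInv_fourier_eq hφ.toSchwartz.integrable
        (𝓕 hφ.toSchwartz).integrable) x
    rw [← h1, Real.fourierInv_eq']
    congr 1; ext ξ
    rw [real_inner_comm, smul_eq_mul]
    push_cast
    ring_nf
  rw [← hinv, ← integral_sub_two_mul_add hi0 (hi t ht) (hi (2 * t) (by positivity)),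
    ← integral_const_mul]
  congr 1; ext ξ
  have : Real.exp (-(Real.pi * (2 * t)) * ‖ξ‖ ^ 2) = Real.exp (-(Real.pi * t) * ‖ξ‖ ^ 2) ^ 2 := by
    rw [← Real.exp_nat_mul]; push_cast; ring_nf
  rw [this, subDensity]
  push_cast
  ring

/-- The fractional Laplacian of a test function decays like `|x| ^ (-n - 2 s)`. -/
theorem IsTest.exists_abs_fracLaplacian_le (hn : 0 < n) {s : ℝ} (hs0 : 0 < s) (hs2 : s < 2)
    {Ω : Set (E n)} {φ : E n → ℝ} (hφ : IsTest Ω φ) :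
    ∃ C, 0 ≤ C ∧ ∀ x, |fracLaplacian s φ x| ≤ C * (1 + ‖x‖) ^ (-((n : ℝ) + 2 * s)) := by
  obtain ⟨R, hR1, hR⟩ : ∃ R, 1 ≤ R ∧ ∀ y, φ y ≠ 0 → ‖y‖ ≤ R := by
    obtain ⟨R, hR⟩ := hφ.compact.isBounded.exists_norm_le
    exact ⟨max R 1, le_max_right _ _, fun y hy =>
      (hR y (subset_tsupport φ hy)).trans (le_max_left _ _)⟩
  have hn' : (0 : ℝ) < n := by exact_mod_cast hn
  set I := ∫ y : E n, ‖(φ y : ℂ)‖ with hI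
  have hI0 : 0 ≤ I := integral_nonneg fun _ => norm_nonneg _
  have hM := subMass_pos hs0 hs2
  set G := Real.Gamma (s + n / 2) * Real.pi ^ (-(s + n / 2)) with hG
  have hG0 : 0 < G := mul_pos (Real.Gamma_pos_of_pos (by positivity)) (by positivity)
  have hfar : ∀ x : E n, 2 * R < ‖x‖ → |fracLaplacian s φ x| ≤
      (subMass s)⁻¹ * ((2 * Real.pi) ^ (2 * s) * (3 * I * (G * (‖x‖ / 3) ^ (-2 * (s + n / 2))))) := by
    intro x hx
    have hx0 : 0 < ‖x‖ := by linarith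
    have hφx : φ x = 0 := by
      by_contra h
      have := hR x h
      linarith
    obtain ⟨hint, hval⟩ := integral_rpow_mul_exp_div (a := s + n / 2) (r := ‖x‖ / 3)
      (by positivity) (by positivity)
    -- The factor 3 = 2 + 1 counts the heat terms at t and 2t. At time ct with c ≤ 2 the exponent
    -- has size at least π‖x‖²/(8t), which exceeds π(‖x‖/3)²/t.
    have hinner : ∀ t ∈ Ioi (0 : ℝ), ‖∫ ξ : E n, (subDensity s ‖ξ‖ t : ℂ) *
        (Complex.exp (2 * Real.pi * Complex.I * inner ℝ x ξ) * 𝓕 (fun y : E n => (φ y : ℂ)) ξ)‖ ≤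
        3 * I * (t ^ (-1 - (s + n / 2)) * Real.exp (-(Real.pi / t) * (‖x‖ / 3) ^ 2)) := by
      intro t (ht : 0 < t)
      obtain ⟨H, hH, he⟩ := hφ.integral_subDensity_mul_fourier (s := s) ht x
      have b0 : ∀ c, 1 ≤ c → c ≤ 2 → ‖H (c * t)‖ ≤
          t ^ (-((n : ℝ) / 2)) * Real.exp (-(Real.pi / t) * (‖x‖ / 3) ^ 2) * I := by
        intro c hc hc2
        have hct : 0 < c * t := by positivity
        rw [hH _ hct]
        refine (norm_heat_le hR hφ.integrable hct hx.le).trans ?_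
        refine mul_le_mul_of_nonneg_right (mul_le_mul ?_ ?_ (by positivity) (by positivity)) hI0
        · exact Real.rpow_le_rpow_of_nonpos ht (by nlinarith) (by linarith)
        · refine Real.exp_le_exp.2 ?_
          rw [neg_mul, neg_mul, neg_le_neg_iff, div_mul_eq_mul_div, div_mul_eq_mul_div,
            div_le_div_iff₀ ht hct]
          have h1 : 0 < Real.pi * ‖x‖ ^ 2 * t := by positivity
          nlinarith
      have b1 := b0 1 le_rfl one_le_two
      have b2 := b0 2 one_le_two le_rfl
      rw [one_mul] at b1
      rw [he, hφx, norm_mul, Complex.norm_real, Real.norm_of_nonneg (by positivity),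
        show -1 - (s + (n : ℝ) / 2) = (-1 - s) + (-((n : ℝ) / 2)) by ring, Real.rpow_add ht]
      have b3 : ‖((0 : ℝ) : ℂ) - 2 * H t + H (2 * t)‖ ≤ 2 * ‖H t‖ + ‖H (2 * t)‖ := by
        refine (norm_add_le _ _).trans ?_
        simp
      calc _ ≤ t ^ (-1 - s) * (3 * (t ^ (-((n : ℝ) / 2)) *
            Real.exp (-(Real.pi / t) * (‖x‖ / 3) ^ 2) * I)) := by
            gcongr; linarith
        _ = _ := by ring
    have h1 := congrArg norm (hφ.subMass_mul_fracLaplacian hn hs0 hs2 x)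
    rw [norm_mul, norm_mul, Complex.norm_real, Complex.norm_real, Complex.norm_real,
      Real.norm_of_nonneg hM.le, Real.norm_eq_abs,
      Real.norm_of_nonneg (by positivity : 0 ≤ (2 * Real.pi) ^ (2 * s))] at h1
    have h2 := norm_integral_le_of_norm_le (hint.const_mul (3 * I))
      ((ae_restrict_iff' measurableSet_Ioi).2 (Eventually.of_forall hinner))
    rw [integral_const_mul, hval] at h2
    rw [le_inv_mul_iff₀ hM, h1]
    gcongr
  obtain ⟨B, hB0, hB⟩ : ∃ B, 0 ≤ B ∧ ∀ x, |fracLaplacian s φ x| ≤ B :=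
    ⟨_, integral_nonneg fun _ => norm_nonneg _, abs_fracLaplacian_le s φ⟩
  -- The base 6 comes from (1 + ‖x‖)/6 ≤ ‖x‖/3, valid where ‖x‖ ≥ 1.
  set D := (subMass s)⁻¹ * ((2 * Real.pi) ^ (2 * s) * (3 * I * (G * (6 : ℝ) ^ ((n : ℝ) + 2 * s))))
  have hD : 0 ≤ D := by positivity
  refine ⟨max (B * (1 + 2 * R) ^ ((n : ℝ) + 2 * s)) D, le_max_of_le_right hD, fun x => ?_⟩
  have hp : (0 : ℝ) < (1 + ‖x‖) ^ (-((n : ℝ) + 2 * s)) := by positivity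
  rcases le_or_gt ‖x‖ (2 * R) with hx | hx
  · calc |fracLaplacian s φ x| ≤ B * 1 := by rw [mul_one]; exact hB x
      _ ≤ B * ((1 + 2 * R) ^ ((n : ℝ) + 2 * s) * (1 + ‖x‖) ^ (-((n : ℝ) + 2 * s))) := by
        gcongr
        rw [Real.rpow_neg (by positivity), ← div_eq_mul_inv, one_le_div (by positivity)]
        gcongr
      _ ≤ _ := by
        rw [← mul_assoc]
        exact mul_le_mul_of_nonneg_right (le_max_left _ _) hp.le
  · refine (hfar x hx).trans ?_
    have hx0 : 0 < ‖x‖ := by linarith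
    have h6 : (‖x‖ / 3) ^ (-2 * (s + (n : ℝ) / 2)) ≤
        (6 : ℝ) ^ ((n : ℝ) + 2 * s) * (1 + ‖x‖) ^ (-((n : ℝ) + 2 * s)) := by
      rw [show -2 * (s + (n : ℝ) / 2) = -((n : ℝ) + 2 * s) by ring, Real.rpow_neg (by positivity),
        Real.rpow_neg (by positivity), ← div_eq_mul_inv, ← Real.div_rpow (by positivity)
        (by positivity), ← Real.inv_rpow (by positivity)]
      refine Real.rpow_le_rpow (by positivity) ?_ (by positivity)
      rw [inv_div, div_le_div_iff₀ (by positivity) (by positivity)]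
      linarith
    calc _ ≤ (subMass s)⁻¹ * ((2 * Real.pi) ^ (2 * s) * (3 * I * (G *
          ((6 : ℝ) ^ ((n : ℝ) + 2 * s) * (1 + ‖x‖) ^ (-((n : ℝ) + 2 * s)))))) := by gcongr
      _ = D * (1 + ‖x‖) ^ (-((n : ℝ) + 2 * s)) := by ring
      _ ≤ _ := mul_le_mul_of_nonneg_right (le_max_right _ _) hp.le

lemma IsTest.integrable_norm_rpow_mul_fracLaplacian (hn : 0 < n) {s : ℝ} (hs0 : 0 < s)
    (hs2 : s < 2) {Ω : Set (E n)} {φ : E n → ℝ} (hφ : IsTest Ω φ) {b : ℝ} (hb : -(n : ℝ) < b)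
    (hb' : b < 2 * s) : Integrable fun x : E n => ‖x‖ ^ b * ‖fracLaplacian s φ x‖ := by
  obtain ⟨C, hC0, hC⟩ := hφ.exists_abs_fracLaplacian_le hn hs0 hs2
  refine ((integrable_norm_rpow_mul_one_add hn (c := n + 2 * s) hb (by linarith)).const_mul
    C).mono' ?_ (Eventually.of_forall fun x => ?_)
  · exact (by fun_prop : Measurable fun x : E n => ‖x‖ ^ b).aestronglyMeasurable.mul
      (hφ.continuous_fracLaplacian hn hs0).norm.aestronglyMeasurable
  · rw [Real.norm_of_nonneg (by positivity), Real.norm_eq_abs]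
    calc ‖x‖ ^ b * |fracLaplacian s φ x|
        ≤ ‖x‖ ^ b * (C * (1 + ‖x‖) ^ (-((n : ℝ) + 2 * s))) := by gcongr; exact hC x
      _ = _ := by ring

/-! ### The symbol of the fractional Laplacian on homogeneous functions. -/

lemma zetaPairing_comp_neg {k : ℕ} {P : MvPolynomial (Fin n) ℝ} (hP : P.IsHomogeneous k) (a : ℂ)
    (g : E n → ℂ) : zetaPairing P a (fun x => g (-x)) = (-1) ^ k * zetaPairing P a g := by
  rw [zetaPairing, ← integral_neg_eq_self, zetaPairing, ← integral_const_mul]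
  congr 1; ext x
  have h : peval P (-x) = (-1) ^ k * peval P x := by
    simpa using peval_smul hP (-1) x
  rw [neg_neg, norm_neg, h]
  push_cast
  ring

lemma zetaPairing_fracSymbol (hn : 0 < n) (P : MvPolynomial (Fin n) ℝ) (a : ℂ) (s : ℝ)
    (φ : E n → ℝ) : zetaPairing P a (fracSymbol s φ) =
      (2 * Real.pi : ℂ) ^ (2 * s : ℂ) * zetaPairing P (a - s) (𝓕 (fun y : E n => (φ y : ℂ))) := by
  rw [zetaPairing, zetaPairing, ← integral_const_mul]
  refine integral_congr_ae ?_
  filter_upwards [ae_ne_zero hn] with x hx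
  have hx' := norm_pos_iff.2 hx
  have h : (‖x‖ : ℂ) ^ (-2 * a) * (((2 * Real.pi * ‖x‖) ^ (2 * s) : ℝ) : ℂ) =
      (2 * Real.pi : ℂ) ^ (2 * s : ℂ) * (‖x‖ : ℂ) ^ (-2 * (a - s)) := by
    have h2 : (2 * Real.pi : ℂ) = ((2 * Real.pi : ℝ) : ℂ) := by push_cast; rfl
    rw [Complex.ofReal_cpow (by positivity), ofReal_cpow_eq_exp hx',
      ofReal_cpow_eq_exp (by positivity), h2, ofReal_cpow_eq_exp (by positivity),
      ofReal_cpow_eq_exp hx', ← Complex.exp_add, ← Complex.exp_add,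
      Real.log_mul (by positivity) hx'.ne']
    push_cast
    ring_nf
  rw [fracSymbol, ← mul_assoc, mul_assoc ((peval P x : ℝ) : ℂ), h]
  ring

/-- On functions of the form `P / |x| ^ (γ + k)`, with `P` a solid harmonic of degree `k`, the
fractional Laplacian acts by the symbol `symbolC`. -/
theorem IsTest.zetaPairing_fracLaplacian (hn : 0 < n) {s : ℝ} (hs0 : 0 < s) (hs2 : s < 2)
    {φ : E n → ℝ} (hφ : IsTest {0}ᶜ φ) {k : ℕ} {P : MvPolynomial (Fin n) ℝ} (hP : IsSolid k P)
    {γ : ℂ} (hγ : 0 < γ.re) (hγ' : γ.re < n - 2 * s) :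
    zetaPairing P ((γ + k) / 2) (fun x => (fracLaplacian s φ x : ℂ)) =
      symbolC n s k γ * zetaPairing P ((γ + k) / 2 + s) (fun x => (φ x : ℂ)) := by
  have hk : (0 : ℝ) ≤ k := Nat.cast_nonneg k
  have hF : (fun x => (fracLaplacian s φ x : ℂ)) = 𝓕 (fun ξ => fracSymbol s φ (-ξ)) := by
    ext x
    rw [← fourierInv_fracSymbol, Real.fourierInv_eq_fourier_comp_neg]
  have ra : ((γ + k) / 2).re = (γ.re + k) / 2 := by simp
  have rb : ((n + k - γ) / 2 : ℂ).re = (n + k - γ.re) / 2 := by simp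
  have rc : ((n + k - γ) / 2 - s : ℂ).re = (n + k - γ.re) / 2 - s := by simp
  have rd : ((γ + k) / 2 + s).re = (γ.re + k) / 2 + s := by simp
  -- First use of the functional equation: from (-Δ)^s φ to its multiplier. There the factor
  -- |ξ|^(2s) is absorbed into the exponent.
  have e1 := zetaPairing_fourier hn hP (a := (γ + k) / 2) (b := (n + k - γ) / 2)
    (f := fun ξ => fracSymbol s φ (-ξ)) (by rw [ra]; linarith) (by rw [rb]; linarith) (by ring)
    (hφ.integrable_fracSymbol hn hs0).comp_neg
    (by
      rw [← hF, ra]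
      simp only [Complex.norm_real]
      exact hφ.integrable_norm_rpow_mul_fracLaplacian hn hs0 hs2 (by linarith) (by linarith))
    (by
      rw [rb]
      simpa only [norm_neg] using (hφ.integrable_norm_rpow_mul_fracSymbol hn (s := s)
        (b := k - 2 * ((n + k - γ.re) / 2)) (by linarith)).comp_neg)
  rw [← hF, zetaPairing_comp_neg hP.homogeneous, zetaPairing_fracSymbol hn] at e1
  -- Second use: from the transform of φ back to φ. The four Gamma factors of the two uses form the
  -- two ratios of `symbolC`.
  have e2 := zetaPairing_fourier hn hP (a := (n + k - γ) / 2 - s) (b := (γ + k) / 2 + s)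
    (f := fun y : E n => (φ y : ℂ)) (by rw [rc]; linarith) (by rw [rd]; linarith) (by ring)
    hφ.integrable
    (by
      rw [rc]
      exact hφ.integrable_norm_rpow_mul_fourier hn (by linarith))
    (hφ.integrable_norm_rpow_mul _)
  have g1 : Complex.Gamma ((γ + k) / 2) ≠ 0 :=
    Complex.Gamma_ne_zero_of_re_pos (by rw [ra]; linarith)
  have g2 : Complex.Gamma ((n + k - γ) / 2 - s) ≠ 0 :=
    Complex.Gamma_ne_zero_of_re_pos (by rw [rc]; linarith)
  have hsym : symbolC n s k γ = 2 ^ (2 * s : ℂ) *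
      (Complex.Gamma ((γ + k) / 2 + s) / Complex.Gamma ((γ + k) / 2)) *
      (Complex.Gamma ((n + k - γ) / 2) / Complex.Gamma ((n + k - γ) / 2 - s)) := by
    unfold symbolC gammaRatioC
    ring_nf
  set Z1 := zetaPairing P ((γ + k) / 2) (fun x => (fracLaplacian s φ x : ℂ))
  set Z2 := zetaPairing P ((n + k - γ) / 2 - s) (𝓕 (fun y : E n => (φ y : ℂ)))
  set Z3 := zetaPairing P ((γ + k) / 2 + s) (fun x => (φ x : ℂ))
  have p1 : (Real.pi : ℂ) ^ (-((γ + k) / 2)) ≠ 0 := by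
    rw [ofReal_cpow_eq_exp Real.pi_pos]; exact Complex.exp_ne_zero _
  have p2 : (Real.pi : ℂ) ^ (-((n + k - γ) / 2 - s)) ≠ 0 := by
    rw [ofReal_cpow_eq_exp Real.pi_pos]; exact Complex.exp_ne_zero _
  -- The two factors (-i)^k and the parity (-1)^k of P cancel.
  have hI : (-Complex.I) ^ k * ((-1) ^ k * (-Complex.I) ^ k) = 1 := by
    rw [← mul_pow, ← mul_pow]
    rw [show -Complex.I * (-1 * -Complex.I) = 1 by linear_combination -Complex.I_sq, one_pow]
  have hpi : (2 * Real.pi : ℂ) ^ (2 * s : ℂ) * (Real.pi : ℂ) ^ (-((n + k - γ) / 2)) *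
      (Real.pi : ℂ) ^ (-((γ + k) / 2 + s)) = 2 ^ (2 * s : ℂ) *
      ((Real.pi : ℂ) ^ (-((γ + k) / 2)) * (Real.pi : ℂ) ^ (-((n + k - γ) / 2 - s))) := by
    have h2 : (2 * Real.pi : ℂ) = ((2 * Real.pi : ℝ) : ℂ) := by push_cast; rfl
    have h3 : (2 : ℂ) = ((2 : ℝ) : ℂ) := by push_cast; rfl
    rw [h2, ofReal_cpow_eq_exp (by positivity), ofReal_cpow_eq_exp Real.pi_pos,
      ofReal_cpow_eq_exp Real.pi_pos, ofReal_cpow_eq_exp Real.pi_pos,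
      ofReal_cpow_eq_exp Real.pi_pos, Real.log_mul two_ne_zero Real.pi_ne_zero]
    have h4 : (2 : ℂ) ^ (2 * s : ℂ) = Complex.exp (Real.log 2 * (2 * s : ℂ)) := by
      rw [← ofReal_cpow_eq_exp two_pos]; norm_num
    rw [h4]
    simp only [← Complex.exp_add]
    push_cast
    ring_nf
  refine mul_left_cancel₀ (mul_ne_zero (mul_ne_zero g1 p1) (mul_ne_zero g2 p2)) ?_
  have hr : Complex.Gamma ((γ + k) / 2) * (Real.pi : ℂ) ^ (-((γ + k) / 2)) *
      (Complex.Gamma ((n + k - γ) / 2 - s) * (Real.pi : ℂ) ^ (-((n + k - γ) / 2 - s))) *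
      (symbolC n s k γ * Z3) = (Real.pi : ℂ) ^ (-((γ + k) / 2)) *
      (Real.pi : ℂ) ^ (-((n + k - γ) / 2 - s)) * 2 ^ (2 * s : ℂ) *
      Complex.Gamma ((γ + k) / 2 + s) * Complex.Gamma ((n + k - γ) / 2) * Z3 := by
    have aux : ∀ a b c d u p q z : ℂ, a ≠ 0 → b ≠ 0 →
        a * p * (b * q) * (u * (c / a) * (d / b) * z) = p * q * u * c * d * z := by
      intro a b c d u p q z ha hb
      field_simp
    rw [hsym]
    exact aux _ _ _ _ _ _ _ _ g1 g2
  rw [hr]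
  linear_combination
    (Complex.Gamma ((n + k - γ) / 2 - s) * (Real.pi : ℂ) ^ (-((n + k - γ) / 2 - s))) * e1 +
    (-Complex.I) ^ k * Complex.Gamma ((n + k - γ) / 2) * (Real.pi : ℂ) ^ (-((n + k - γ) / 2)) *
      (-1) ^ k * (2 * Real.pi : ℂ) ^ (2 * s : ℂ) * e2 +
    Complex.Gamma ((n + k - γ) / 2) * (Real.pi : ℂ) ^ (-((n + k - γ) / 2)) *
      (2 * Real.pi : ℂ) ^ (2 * s : ℂ) * Complex.Gamma ((γ + k) / 2 + s) *
      (Real.pi : ℂ) ^ (-((γ + k) / 2 + s)) * Z3 * hI +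
    Complex.Gamma ((n + k - γ) / 2) * Complex.Gamma ((γ + k) / 2 + s) * Z3 * hpi

/-! ### Polar coordinates and orthogonality of harmonics. -/

instance isFiniteMeasure_surface (n : ℕ) : IsFiniteMeasure (surface n) := by
  unfold surface; infer_instance

lemma measurePreserving_polar (n : ℕ) : MeasurePreserving (homeomorphUnitSphereProd (E n))
    ((volume : Measure (E n)).comap (↑)) ((surface n).prod (Measure.volumeIoiPow (n - 1))) := by
  simpa [surface] using (volume : Measure (E n)).measurePreserving_homeomorphUnitSphereProd

lemma smul_homeomorphUnitSphereProd (x : ({0}ᶜ : Set (E n))) :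
    (homeomorphUnitSphereProd (E n) x).2.1 • ((homeomorphUnitSphereProd (E n) x).1 : E n) = x := by
  rw [homeomorphUnitSphereProd_apply_snd_coe, homeomorphUnitSphereProd_apply_fst_coe, smul_smul,
    mul_inv_cancel₀ (norm_ne_zero_iff.2 x.2), one_smul]

section Polar

variable {F : Type*} [NormedAddCommGroup F]

lemma integral_polar [NormedSpace ℝ F] (hn : 0 < n) (f : E n → F) :
    ∫ x, f x = ∫ q : S n × Ioi (0 : ℝ), f (q.2.1 • (q.1 : E n))
      ∂((surface n).prod (Measure.volumeIoiPow (n - 1))) := by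
  have := nontrivial_E hn
  have h := (measurePreserving_polar n).integral_comp (Homeomorph.measurableEmbedding _)
    (fun q : S n × Ioi (0 : ℝ) => f (q.2.1 • (q.1 : E n)))
  have h0 : ∫ x, f x = ∫ x in {0}ᶜ, f x := by rw [restrict_compl_singleton]
  rw [← h, h0, ← integral_subtype_comap (measurableSet_singleton _).compl]
  simp only [smul_homeomorphUnitSphereProd]

lemma integral_volumeIoiPow [NormedSpace ℝ F] (m : ℕ) (f : ℝ → F) :
    ∫ r : Ioi (0 : ℝ), f r ∂(Measure.volumeIoiPow m) = ∫ r in Ioi (0 : ℝ), r ^ m • f r := by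
  simp only [Measure.volumeIoiPow, ENNReal.ofReal]
  rw [integral_withDensity_eq_integral_smul,
    integral_subtype_comap measurableSet_Ioi fun a ↦ Real.toNNReal (a ^ m) • f a,
    setIntegral_congr_fun measurableSet_Ioi fun x hx ↦ ?_]
  · rw [NNReal.smul_def, Real.coe_toNNReal _ (pow_nonneg hx.out.le _)]
  · exact (measurable_subtype_coe.pow_const _).real_toNNReal

end Polar

lemma integral_polar_mul {𝕜 : Type*} [RCLike 𝕜] (hn : 0 < n) {f : E n → 𝕜} {A : ℝ → 𝕜} {B : S n → 𝕜}
    (h : ∀ (θ : S n) (r : ℝ), 0 < r → f (r • (θ : E n)) = B θ * A r) :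
    ∫ x, f x = (∫ θ, B θ ∂(surface n)) * ∫ r in Ioi (0 : ℝ), r ^ (n - 1) • A r := by
  rw [integral_polar hn, ← integral_volumeIoiPow, ← integral_prod_mul]
  exact integral_congr_ae (Eventually.of_forall fun q => h q.1 q.2.1 q.2.2)

lemma norm_smul_sphere {r : ℝ} (hr : 0 < r) (θ : S n) : ‖r • (θ : E n)‖ = r := by
  rw [norm_smul, norm_eq_of_mem_sphere, mul_one, Real.norm_of_nonneg hr.le]

lemma homogeneous_smul (γ : ℝ) (ψ : S n → ℝ) {r : ℝ} (hr : 0 < r) (θ : S n) :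
    homogeneous γ ψ (r • (θ : E n)) = r ^ (-γ) * ψ θ := by
  have h : r • (θ : E n) ≠ 0 := by
    rw [← norm_ne_zero_iff, norm_smul_sphere hr]; exact hr.ne'
  rw [homogeneous, dif_neg h]
  congr 1
  · rw [norm_smul_sphere hr]
  · congr 1
    ext1
    simp only [norm_smul_sphere hr, smul_smul, inv_mul_cancel₀ hr.ne', one_smul]

/-- Solid harmonics of different degrees are orthogonal on the sphere. -/
theorem integral_sphere_mul_eq_zero (hn : 0 < n) {j k : ℕ} (hjk : j ≠ k)
    {P Q : MvPolynomial (Fin n) ℝ} (hP : IsSolid j P) (hQ : IsSolid k Q) :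
    ∫ θ : S n, peval P θ * peval Q θ ∂(surface n) = 0 := by
  set J := ∫ θ : S n, peval P θ * peval Q θ ∂(surface n) with hJ
  set a : ℝ := (n + j + k) / 2 with ha
  have hn' : (0 : ℝ) < n := by exact_mod_cast hn
  have ha0 : 0 < a := by positivity
  have hG := Real.Gamma_pos_of_pos ha0
  have hint : ∀ t : ℝ, 0 < t → ∀ (P Q : MvPolynomial (Fin n) ℝ) (j k : ℕ), IsSolid j P →
      IsSolid k Q → ∫ x, polyGaussian t P x * polyGaussian 1 Q x =
      ((∫ θ : S n, peval P θ * peval Q θ ∂(surface n) : ℝ) : ℂ) *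
      (((1 / 2) * Real.pi ^ (-((n + j + k : ℝ) / 2)) * Real.Gamma ((n + j + k) / 2) *
        (t + 1) ^ (-((n + j + k : ℝ) / 2)) : ℝ) : ℂ) := by
    intro t ht P Q j k hP hQ
    have h1 : ∀ (θ : S n) (r : ℝ), 0 < r →
        peval P (r • (θ : E n)) * peval Q (r • (θ : E n)) *
          Real.exp (-(Real.pi * (t + 1)) * ‖r • (θ : E n)‖ ^ 2) =
        (peval P θ * peval Q θ) * (r ^ (j + k) * Real.exp (-(Real.pi * (t + 1)) * r ^ 2)) := by
      intro θ r hr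
      rw [norm_smul_sphere hr, peval_smul hP.homogeneous, peval_smul hQ.homogeneous]
      ring
    have h2 := integral_polar_mul (𝕜 := ℝ) hn
      (f := fun x => peval P x * peval Q x * Real.exp (-(Real.pi * (t + 1)) * ‖x‖ ^ 2)) h1
    have h3 : ∀ x : E n, polyGaussian t P x * polyGaussian 1 Q x =
        ((peval P x * peval Q x * Real.exp (-(Real.pi * (t + 1)) * ‖x‖ ^ 2) : ℝ) : ℂ) := by
      intro x
      rw [polyGaussian, polyGaussian, ← Complex.ofReal_mul]
      congr 1
      rw [show -(Real.pi * (t + 1)) * ‖x‖ ^ 2 = -(Real.pi * t) * ‖x‖ ^ 2 +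
        -(Real.pi * 1) * ‖x‖ ^ 2 by ring, Real.exp_add]
      ring
    simp only [h3]
    rw [integral_complex_ofReal, h2, ← Complex.ofReal_mul]
    congr 2
    have h4 := integral_rpow_mul_exp_neg_mul_rpow (p := 2) (q := n + j + k - 1)
      (b := Real.pi * (t + 1)) two_pos (by linarith [(Nat.cast_nonneg j : (0:ℝ) ≤ j),
        (Nat.cast_nonneg k : (0:ℝ) ≤ k)]) (by positivity)
    rw [show -((n : ℝ) + j + k - 1 + 1) / 2 = -((n + j + k : ℝ) / 2) by ring,
      show ((n : ℝ) + j + k - 1 + 1) / 2 = (n + j + k : ℝ) / 2 by ring,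
      Real.mul_rpow Real.pi_pos.le (by positivity)] at h4
    rw [show 1 / 2 * Real.pi ^ (-((n + j + k : ℝ) / 2)) * Real.Gamma ((n + j + k) / 2) *
        (t + 1) ^ (-((n + j + k : ℝ) / 2)) = Real.pi ^ (-((n + j + k : ℝ) / 2)) *
        (t + 1) ^ (-((n + j + k : ℝ) / 2)) * (1 / 2) * Real.Gamma ((n + j + k) / 2) by ring, ← h4]
    refine setIntegral_congr_fun measurableSet_Ioi fun r (hr : 0 < r) => ?_
    simp only [smul_eq_mul, Real.rpow_two]
    rw [← mul_assoc, ← pow_add, ← Real.rpow_natCast]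
    congr 2
    push_cast [Nat.cast_sub (show 1 ≤ n from hn)]
    ring
  -- Moving the Fourier transform from P times a Gaussian to Q times a Gaussian gives two multiples
  -- of J. Their moduli agree only if J = 0 or 4^(a - n/2 - j) = 1, and the latter means j = k. The
  -- width 4 is used because any value other than 1 separates the degrees.
  have hflip := integral_fourier_mul_eq
    (integrable_polyGaussian (t := 4) (by norm_num) hn hP.homogeneous)
    (integrable_polyGaussian (t := 1) one_pos hn hQ.homogeneous)
  simp only [fourier_polyGaussian hn (show (0 : ℝ) < 4 by norm_num) hP,
    fourier_polyGaussian hn one_pos hQ, inv_one] at hflip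
  have e1 : ∀ c d : ℂ, (fun x : E n => c * d * polyGaussian 4⁻¹ P x * polyGaussian 1 Q x) =
      fun x => c * d * (polyGaussian 4⁻¹ P x * polyGaussian 1 Q x) := by
    intro c d; ext x; ring
  have e2 : ∀ c d : ℂ, (fun x : E n => polyGaussian 4 P x * (c * d * polyGaussian 1 Q x)) =
      fun x => c * d * (polyGaussian 4 P x * polyGaussian 1 Q x) := by
    intro c d; ext x; ring
  rw [e1, e2, integral_const_mul, integral_const_mul, hint 4⁻¹ (by norm_num) P Q j k hP hQ,
    hint 4 (by norm_num) P Q j k hP hQ, ← hJ, ← ha] at hflip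
  have hnorm := congrArg norm hflip
  simp only [norm_mul, norm_pow, norm_neg, Complex.norm_I, one_pow, one_mul, Complex.norm_real,
    Real.norm_eq_abs, Real.one_rpow, abs_one] at hnorm
  by_contra hne
  have hJ0 : 0 < |J| := abs_pos.2 hne
  rw [abs_of_pos (by positivity : (0 : ℝ) < 4 ^ (-((n : ℝ) / 2 + j))),
    abs_of_pos (by positivity : (0 : ℝ) < (1 / 2)), abs_of_pos (by positivity : (0 : ℝ) <
    Real.pi ^ (-a)), abs_of_pos hG, abs_of_pos (by positivity : (0 : ℝ) < (4⁻¹ + 1) ^ (-a)),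
    abs_of_pos (by positivity : (0 : ℝ) < (4 + 1) ^ (-a))] at hnorm
  have h5 : (4 : ℝ) ^ (-((n : ℝ) / 2 + j)) * (4⁻¹ + 1) ^ (-a) = (4 + 1) ^ (-a) := by
    have hc : 0 < |J| * (1 / 2 * Real.pi ^ (-a) * Real.Gamma a) := by positivity
    refine mul_left_cancel₀ hc.ne' ?_
    linarith
  rw [show (4 : ℝ)⁻¹ + 1 = 4⁻¹ * (4 + 1) by norm_num, Real.mul_rpow (by norm_num) (by norm_num),
    ← mul_assoc] at h5
  have h6 : (4 : ℝ) ^ (-((n : ℝ) / 2 + j)) * 4⁻¹ ^ (-a) = 1 :=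
    mul_right_cancel₀ (by positivity : ((4 : ℝ) + 1) ^ (-a) ≠ 0) (by rw [h5, one_mul])
  rw [← Real.rpow_neg_one 4, ← Real.rpow_mul (by norm_num), ← Real.rpow_add (by norm_num)] at h6
  replace h6 := congrArg Real.log h6
  rw [Real.log_rpow (by norm_num), Real.log_one] at h6
  replace h6 := (mul_eq_zero.1 h6).resolve_right (Real.log_pos (by norm_num)).ne'
  apply hjk
  have : (j : ℝ) = k := by rw [ha] at h6; linarith
  exact_mod_cast this

/-! ### Harmonic decomposition and completeness on the sphere. -/

/-- The squared norm polynomial. -/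
def normSqPoly (n : ℕ) : MvPolynomial (Fin n) ℝ := ∑ i, X i ^ 2

lemma isHomogeneous_normSqPoly : (normSqPoly n).IsHomogeneous 2 :=
  IsHomogeneous.sum _ _ _ fun i _ => by simpa using (isHomogeneous_X ℝ i).pow 2

lemma lap_add (P Q : MvPolynomial (Fin n) ℝ) : lap (P + Q) = lap P + lap Q := by
  simp [lap, Finset.sum_add_distrib]

lemma lap_smul (c : ℝ) (P : MvPolynomial (Fin n) ℝ) : lap (c • P) = c • lap P := by
  simp [lap, Finset.smul_sum]

lemma isHomogeneous_lap {k : ℕ} {P : MvPolynomial (Fin n) ℝ} (hP : P.IsHomogeneous (k + 2)) :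
    (lap P).IsHomogeneous k :=
  IsHomogeneous.sum _ _ _ fun i _ => by simpa using (hP.pderiv (i := i)).pderiv (i := i)

lemma lap_eq_zero_of_lt {k : ℕ} (hk : k < 2) {P : MvPolynomial (Fin n) ℝ}
    (hP : P.IsHomogeneous k) : lap P = 0 := by
  refine Finset.sum_eq_zero fun i _ => ?_
  have h : (pderiv i P).IsHomogeneous 0 := by
    have h' := hP.pderiv (i := i)
    rwa [show k - 1 = 0 by omega] at h'
  rw [(totalDegree_eq_zero_iff_eq_C).1 (Nat.le_zero.1 h.totalDegree_le), pderiv_C]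

lemma lap_normSqPoly_mul {m : ℕ} {Q : MvPolynomial (Fin n) ℝ} (hQ : Q.IsHomogeneous m) :
    lap (normSqPoly n * Q) = (2 * n + 4 * m : ℝ) • Q + normSqPoly n * lap Q := by
  have h1 : ∀ i : Fin n, pderiv i (normSqPoly n) = 2 * X i := by
    intro i
    rw [normSqPoly, map_sum, Finset.sum_eq_single i]
    · simp
    · intro j _ hj
      simp [pderiv_X_of_ne hj]
    · simp
  have h2 : ∀ i : Fin n, pderiv i (pderiv i (normSqPoly n * Q)) =
      2 * Q + 4 * (X i * pderiv i Q) + normSqPoly n * pderiv i (pderiv i Q) := by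
    intro i
    have h3 : pderiv i (2 : MvPolynomial (Fin n) ℝ) = 0 := by
      simpa using (pderiv (R := ℝ) i).map_natCast 2
    simp only [pderiv_mul, map_add, h1, h3, pderiv_X_self]
    ring
  simp only [lap, h2, Finset.sum_add_distrib, ← Finset.mul_sum, hQ.sum_X_mul_pderiv]
  simp only [Finset.sum_const, Finset.card_univ, Fintype.card_fin, nsmul_eq_mul, smul_eq_C_mul]
  simp only [map_add, map_mul, map_natCast, map_ofNat]
  ring

/-- Inverts c + |x|²Δ by descent in the degree. If T solves the problem for ΔR with constant c + 2n
+ 4m, then Δ(R - |x|²T) = cT, so Q = (R - |x|²T)/c works. -/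
lemma exists_smul_add_normSqPoly_mul_lap (m : ℕ) : ∀ (c : ℝ), 0 < c →
    ∀ R : MvPolynomial (Fin n) ℝ, R.IsHomogeneous m →
    ∃ Q : MvPolynomial (Fin n) ℝ, Q.IsHomogeneous m ∧ c • Q + normSqPoly n * lap Q = R := by
  induction m using Nat.twoStepInduction with
  | zero =>
    intro c hc R hR
    refine ⟨c⁻¹ • R, (homogeneousSubmodule (Fin n) ℝ 0).smul_mem _ hR, ?_⟩
    rw [lap_smul, lap_eq_zero_of_lt (by norm_num) hR, smul_smul, mul_inv_cancel₀ hc.ne']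
    simp
  | one =>
    intro c hc R hR
    refine ⟨c⁻¹ • R, (homogeneousSubmodule (Fin n) ℝ 1).smul_mem _ hR, ?_⟩
    rw [lap_smul, lap_eq_zero_of_lt (by norm_num) hR, smul_smul, mul_inv_cancel₀ hc.ne']
    simp
  | more m ih _ =>
    intro c hc R hR
    obtain ⟨T, hT, hTR⟩ := ih (c + (2 * n + 4 * m)) (by positivity) (lap R) (isHomogeneous_lap hR)
    have hNT : (normSqPoly n * T).IsHomogeneous (m + 2) := by
      have := isHomogeneous_normSqPoly.mul hT
      rwa [add_comm] at this
    refine ⟨c⁻¹ • (R + (-1 : ℝ) • (normSqPoly n * T)), (homogeneousSubmodule (Fin n) ℝ (m + 2)).smul_mem _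
      (hR.add ((homogeneousSubmodule (Fin n) ℝ (m + 2)).smul_mem _ hNT)), ?_⟩
    have h1 : lap (R + (-1 : ℝ) • (normSqPoly n * T)) = c • T := by
      rw [lap_add, lap_smul, lap_normSqPoly_mul hT, ← hTR, add_smul]
      module
    rw [lap_smul, h1, smul_smul, smul_smul, mul_inv_cancel₀ hc.ne', inv_mul_cancel₀ hc.ne']
    simp

/-- Decomposition of a homogeneous polynomial into a solid harmonic and a multiple of the squared
norm. -/
lemma exists_isSolid_add {k : ℕ} (hn : 0 < n) {P : MvPolynomial (Fin n) ℝ}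
    (hP : P.IsHomogeneous (k + 2)) :
    ∃ H Q : MvPolynomial (Fin n) ℝ, IsSolid (k + 2) H ∧ Q.IsHomogeneous k ∧
      P = H + normSqPoly n * Q := by
  have hn' : (0 : ℝ) < n := by exact_mod_cast hn
  -- P - |x|²Q is harmonic exactly when (2n + 4k)Q + |x|²ΔQ = ΔP.
  obtain ⟨Q, hQ, hQP⟩ := exists_smul_add_normSqPoly_mul_lap k (2 * n + 4 * k) (by positivity)
    (lap P) (isHomogeneous_lap hP)
  have hNQ : (normSqPoly n * Q).IsHomogeneous (k + 2) := by
    have := isHomogeneous_normSqPoly.mul hQ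
    rwa [add_comm] at this
  refine ⟨P + (-1 : ℝ) • (normSqPoly n * Q), Q,
    ⟨hP.add ((homogeneousSubmodule (Fin n) ℝ (k + 2)).smul_mem _ hNQ), ?_⟩, hQ, ?_⟩
  · rw [lap_add, lap_smul, lap_normSqPoly_mul hQ, hQP]
    module
  · module

/-- Restriction of polynomials to the unit sphere. -/
def sphereMap (n : ℕ) : MvPolynomial (Fin n) ℝ →ₐ[ℝ] C(S n, ℝ) :=
  aeval fun i => ⟨fun θ => (θ : E n) i, by fun_prop⟩

lemma sphereMap_apply (P : MvPolynomial (Fin n) ℝ) (θ : S n) : sphereMap n P θ = peval P θ := by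
  induction P using MvPolynomial.induction_on with
  | C a => simp [sphereMap, peval_C]
  | add p q hp hq => simp [hp, hq]
  | mul_X p j hp => rw [map_mul, ContinuousMap.mul_apply, hp]; simp [sphereMap]

lemma sphereMap_normSqPoly : sphereMap n (normSqPoly n) = 1 := by
  ext θ
  have h : ‖(θ : E n)‖ ^ 2 = 1 := by rw [norm_eq_of_mem_sphere]; norm_num
  rw [EuclideanSpace.norm_sq_eq] at h
  rw [sphereMap_apply, normSqPoly, peval_sum]
  simpa [sq, peval] using h

/-- The space of solid harmonics of degree `k`. -/
def solidSubmodule (n k : ℕ) : Submodule ℝ (MvPolynomial (Fin n) ℝ) where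
  carrier := {P | IsSolid k P}
  add_mem' hP hQ := ⟨hP.1.add hQ.1, by rw [lap_add, hP.2, hQ.2, add_zero]⟩
  zero_mem' := ⟨isHomogeneous_zero _ _ _, by simp [lap]⟩
  smul_mem' c P hP := ⟨(homogeneousSubmodule (Fin n) ℝ k).smul_mem c hP.1, by
    rw [lap_smul, hP.2, smul_zero]⟩

/-- Makes the spaces of spherical harmonics complete, as a Hilbert sum requires. -/
instance finiteDimensional_solidSubmodule (n k : ℕ) :
    FiniteDimensional ℝ (solidSubmodule n k) := by
  have h : FiniteDimensional ℝ (homogeneousSubmodule (Fin n) ℝ k) :=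
    Module.Finite.iff_fg.2 (homogeneousSubmodule_fg _ _ k)
  exact Submodule.finiteDimensional_of_le (S₂ := homogeneousSubmodule (Fin n) ℝ k)
    fun P hP => hP.1

/-- On the sphere |x|² = 1, so a homogeneous polynomial equals a harmonic one plus one of degree
lower by 2. -/
lemma sphereMap_mem_iSup (hn : 0 < n) {k : ℕ} {P : MvPolynomial (Fin n) ℝ}
    (hP : P.IsHomogeneous k) :
    sphereMap n P ∈ ⨆ k, (solidSubmodule n k).map (sphereMap n).toLinearMap := by
  have hsolid : ∀ {k : ℕ} {P : MvPolynomial (Fin n) ℝ}, IsSolid k P →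
      sphereMap n P ∈ ⨆ k, (solidSubmodule n k).map (sphereMap n).toLinearMap := fun {k P} h =>
    Submodule.mem_iSup_of_mem k (Submodule.mem_map_of_mem (f := (sphereMap n).toLinearMap) h)
  induction k using Nat.twoStepInduction generalizing P with
  | zero => exact hsolid ⟨hP, lap_eq_zero_of_lt (by norm_num) hP⟩
  | one => exact hsolid ⟨hP, lap_eq_zero_of_lt (by norm_num) hP⟩
  | more k ih _ =>
    obtain ⟨H, Q, hH, hQ, rfl⟩ := exists_isSolid_add hn hP
    rw [map_add, map_mul, sphereMap_normSqPoly, one_mul]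
    exact add_mem (hsolid hH) (ih hQ)

lemma sphereMap_mem_iSup' (hn : 0 < n) (P : MvPolynomial (Fin n) ℝ) :
    sphereMap n P ∈ ⨆ k, (solidSubmodule n k).map (sphereMap n).toLinearMap := by
  rw [← sum_homogeneousComponent P, map_sum]
  exact sum_mem fun i _ => sphereMap_mem_iSup hn (homogeneousComponent_isHomogeneous i P)

/-- Stone–Weierstrass: the coordinates separate points. -/
lemma denseRange_sphereMap (n : ℕ) : DenseRange (sphereMap n) := by
  have h := ContinuousMap.subalgebra_topologicalClosure_eq_top_of_separatesPoints
    (sphereMap n).range (by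
      intro x y hxy
      have : ∃ i, (x : E n) i ≠ (y : E n) i := by
        by_contra! h
        exact hxy (Subtype.ext (by ext i; exact h i))
      obtain ⟨i, hi⟩ := this
      refine ⟨_, ⟨sphereMap n (X i), ⟨X i, rfl⟩, rfl⟩, ?_⟩
      simpa [sphereMap_apply] using hi)
  intro f
  have hf : f ∈ (sphereMap n).range.topologicalClosure := by rw [h]; trivial
  exact hf

/-- Restriction of polynomials to the unit sphere, as square integrable functions. -/
def sphereL2 (n : ℕ) : MvPolynomial (Fin n) ℝ →ₗ[ℝ] Lp ℝ 2 (surface n) :=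
  (ContinuousMap.toLp 2 (surface n) ℝ).toLinearMap ∘ₗ (sphereMap n).toLinearMap

lemma coeFn_sphereL2 (P : MvPolynomial (Fin n) ℝ) :
    sphereL2 n P =ᵐ[surface n] fun θ => peval P (θ : E n) := by
  filter_upwards [ContinuousMap.coeFn_toLp (p := 2) (𝕜 := ℝ) (surface n) (sphereMap n P)] with θ hθ
  rw [← sphereMap_apply]
  exact hθ

lemma inner_sphereL2 (P : MvPolynomial (Fin n) ℝ) (f : Lp ℝ 2 (surface n)) :
    inner ℝ f (sphereL2 n P) = ∫ θ : S n, f θ * peval P (θ : E n) ∂(surface n) := by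
  rw [L2.inner_def]
  refine integral_congr_ae ?_
  filter_upwards [coeFn_sphereL2 P] with θ hθ
  rw [hθ]
  simp [mul_comm]

lemma inner_sphereL2_sphereL2 (P Q : MvPolynomial (Fin n) ℝ) :
    inner ℝ (sphereL2 n P) (sphereL2 n Q) =
      ∫ θ : S n, peval P (θ : E n) * peval Q (θ : E n) ∂(surface n) := by
  rw [inner_sphereL2]
  refine integral_congr_ae ?_
  filter_upwards [coeFn_sphereL2 P] with θ hθ
  rw [hθ]

lemma isHilbertSum_sphereL2 (hn : 0 < n) : IsHilbertSum ℝ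
    (fun k => (solidSubmodule n k).map (sphereL2 n))
    fun k => ((solidSubmodule n k).map (sphereL2 n)).subtypeₗᵢ := by
  refine IsHilbertSum.mkInternal (F := fun k => (solidSubmodule n k).map (sphereL2 n)) ?_ ?_
  · refine OrthogonalFamily.of_pairwise fun j k hjk => ?_
    rw [Function.onFun, Submodule.isOrtho_iff_inner_eq]
    rintro _ ⟨P, hP, rfl⟩ _ ⟨Q, hQ, rfl⟩
    rw [inner_sphereL2_sphereL2]
    exact integral_sphere_mul_eq_zero hn hjk hP hQ
  · intro f _
    have hd : DenseRange (sphereL2 n) :=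
      (ContinuousMap.toLp_denseRange ℝ (surface n) ℝ (by norm_num : (2 : ENNReal) ≠ ⊤)).comp
        (denseRange_sphereMap n) (ContinuousMap.toLp 2 (surface n) ℝ).continuous
    refine closure_mono ?_ (hd f)
    rintro _ ⟨P, rfl⟩
    have h := Submodule.mem_map_of_mem (f := (ContinuousMap.toLp 2 (surface n) ℝ).toLinearMap)
      (sphereMap_mem_iSup' hn P)
    rw [Submodule.map_iSup] at h
    simp only [← Submodule.map_comp] at h
    exact h

/-- Expansion of a square integrable function on the sphere in spherical harmonics. -/
theorem exists_harmonic_expansion (hn : 0 < n) {ψ : S n → ℝ} (hψ : MemLp ψ 2 (surface n)) :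
    ∃ Y : ℕ → MvPolynomial (Fin n) ℝ, (∀ k, IsSolid k (Y k)) ∧
      (∀ k, ∫ θ : S n, ψ θ * peval (Y k) (θ : E n) ∂(surface n) =
        ∫ θ : S n, peval (Y k) (θ : E n) ^ 2 ∂(surface n)) ∧
      ∃ N : ℕ → ℕ, ∀ᵐ θ : S n ∂(surface n),
        Tendsto (fun i => ∑ k ∈ Finset.range (N i), peval (Y k) (θ : E n)) atTop (𝓝 (ψ θ)) := by
  have hV := isHilbertSum_sphereL2 hn
  set f := hψ.toLp ψ with hf
  set w := hV.linearIsometryEquiv f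
  have hsum := hV.hasSum_linearIsometryEquiv_symm w
  rw [LinearIsometryEquiv.symm_apply_apply] at hsum
  choose Y hY hYw using fun k => (w k).2
  replace hsum : HasSum (fun k => sphereL2 n (Y k)) f := by
    refine hsum.congr_fun fun k => ?_
    exact hYw k
  refine ⟨Y, hY, fun k => ?_, ?_⟩
  · have h1 : HasSum (fun j => inner ℝ (sphereL2 n (Y j)) (sphereL2 n (Y k)))
        (inner ℝ f (sphereL2 n (Y k))) :=
      hsum.mapL ((innerSL ℝ).flip (sphereL2 n (Y k)))
    have h2 := hasSum_single (f := fun j => inner ℝ (sphereL2 n (Y j)) (sphereL2 n (Y k))) k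
      (fun j hj => by
        rw [inner_sphereL2_sphereL2]
        exact integral_sphere_mul_eq_zero hn hj (hY j) (hY k))
    have h3 := h1.unique h2
    rw [inner_sphereL2_sphereL2, inner_sphereL2] at h3
    simp only [sq]
    rw [← h3]
    refine integral_congr_ae ?_
    filter_upwards [hψ.coeFn_toLp] with θ hθ
    rw [hf, hθ]
  -- The L² convergence gives convergence in measure, hence a.e. convergence along a subsequence N;
  -- this is the form Fatou needs later.
  · have h1 := tendstoInMeasure_of_tendsto_Lp hsum.tendsto_sum_nat
    obtain ⟨N, -, hN⟩ := h1.exists_seq_tendsto_ae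
    refine ⟨N, ?_⟩
    have h2 : ∀ m, ((∑ k ∈ Finset.range m, sphereL2 n (Y k) : Lp ℝ 2 (surface n)) : S n → ℝ)
        =ᵐ[surface n] fun θ => ∑ k ∈ Finset.range m, peval (Y k) (θ : E n) := by
      intro m
      rw [← map_sum]
      filter_upwards [coeFn_sphereL2 (∑ k ∈ Finset.range m, Y k)] with θ hθ
      rw [hθ, peval_sum]
    filter_upwards [hN, hψ.coeFn_toLp, ae_all_iff.2 h2] with θ h3 h4 h5
    rw [hf, h4] at h3
    exact h3.congr fun i => h5 (N i)

lemma continuous_peval_sphere (P : MvPolynomial (Fin n) ℝ) :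
    Continuous fun θ : S n => peval P (θ : E n) :=
  (continuous_peval P).comp continuous_subtype_val

lemma memLp_peval_sphere (P : MvPolynomial (Fin n) ℝ) (q : ENNReal) :
    MemLp (fun θ : S n => peval P (θ : E n)) q (surface n) := by
  obtain ⟨C, hC⟩ := isCompact_univ.exists_bound_of_continuousOn
    (continuous_peval_sphere P).continuousOn
  exact MemLp.of_bound (continuous_peval_sphere P).aestronglyMeasurable C
    (Eventually.of_forall fun θ => hC θ (mem_univ θ))

/-- A square integrable function orthogonal to all spherical harmonics vanishes. -/
theorem ae_eq_zero_of_forall_integral_peval (hn : 0 < n) {ψ : S n → ℝ} (hψ : MemLp ψ 2 (surface n))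
    (h : ∀ k P, IsSolid k P → ∫ θ : S n, ψ θ * peval P (θ : E n) ∂(surface n) = 0) :
    ψ =ᵐ[surface n] 0 := by
  obtain ⟨Y, hY, hYY, N, hN⟩ := exists_harmonic_expansion hn hψ
  have h0 : ∀ k, (fun θ : S n => peval (Y k) (θ : E n)) =ᵐ[surface n] 0 := by
    intro k
    have h1 := hYY k
    rw [h k _ (hY k)] at h1
    have h2 := (integral_eq_zero_iff_of_nonneg (fun θ => sq_nonneg _)
      ((memLp_peval_sphere (Y k) 2).integrable_sq)).1 h1.symm
    filter_upwards [h2] with θ hθ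
    exact pow_eq_zero_iff two_ne_zero |>.1 hθ
  filter_upwards [hN, ae_all_iff.2 h0] with θ h1 h2
  simp only [Pi.zero_apply] at h2 ⊢
  simp only [h2, Finset.sum_const_zero] at h1
  exact tendsto_nhds_unique h1 tendsto_const_nhds

/-! ### Radial test functions and radial moments. -/

/-- The radial function `h (log |x|)`, set to `0` at the origin. -/
def logRadial (h : ℝ → ℝ) (x : E n) : ℝ := if x = 0 then 0 else h (Real.log ‖x‖)

lemma logRadial_smul (h : ℝ → ℝ) {r : ℝ} (hr : 0 < r) (θ : S n) :
    logRadial h (r • (θ : E n)) = h (Real.log r) := by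
  have hne : r • (θ : E n) ≠ 0 := by
    rw [← norm_ne_zero_iff, norm_smul_sphere hr]; exact hr.ne'
  rw [logRadial, if_neg hne, norm_smul_sphere hr]

/-- If h lives in [-R, R], the function lives in the annulus e^(-R) ≤ |x| ≤ e^R, where log |x| is
smooth. -/
lemma isTest_logRadial {h : ℝ → ℝ} (hh : ContDiff ℝ ∞ h) (hc : HasCompactSupport h) :
    IsTest ({0}ᶜ : Set (E n)) (logRadial h) := by
  obtain ⟨R, hR⟩ : ∃ R, ∀ t, h t ≠ 0 → |t| ≤ R := by
    obtain ⟨R, hR⟩ := hc.isBounded.exists_norm_le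
    exact ⟨R, fun t ht => hR t (subset_tsupport h ht)⟩
  set A : Set (E n) := Metric.closedBall 0 (Real.exp R) ∩ {x | Real.exp (-R) ≤ ‖x‖} with hA
  have hAc : IsCompact A := (isCompact_closedBall _ _).inter_right
    (isClosed_le continuous_const continuous_norm)
  have hsub : Function.support (logRadial h) ⊆ A := by
    intro x hx
    have hx0 : x ≠ 0 := by
      rintro rfl; exact hx (by simp [logRadial])
    have hx' := norm_pos_iff.2 hx0
    have h1 : |Real.log ‖x‖| ≤ R := hR _ (by simpa [logRadial, hx0] using hx)
    rw [abs_le] at h1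
    refine ⟨?_, ?_⟩
    · rw [mem_closedBall_zero_iff, ← Real.exp_log hx']
      exact Real.exp_le_exp.2 h1.2
    · change Real.exp (-R) ≤ ‖x‖
      rw [← Real.exp_log hx']
      exact Real.exp_le_exp.2 h1.1
  refine ⟨contDiff_iff_contDiffAt.2 fun x => ?_, HasCompactSupport.of_support_subset_isCompact hAc
    hsub, (closure_minimal hsub hAc.isClosed).trans fun x hx => ?_⟩
  · rcases eq_or_ne x 0 with rfl | hx
    · refine (contDiffAt_const (c := (0 : ℝ))).congr_of_eventuallyEq ?_
      have : Metric.ball (0 : E n) (Real.exp (-R)) ∈ 𝓝 (0 : E n) :=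
        Metric.ball_mem_nhds _ (Real.exp_pos _)
      filter_upwards [this] with y hy
      by_contra hne
      have h2 := (hsub hne).2
      rw [mem_ball_zero_iff] at hy
      exact absurd h2 (not_le.2 hy)
    · have h1 : ContDiffAt ℝ ∞ (fun y : E n => h (Real.log ‖y‖)) x :=
        hh.contDiffAt.comp x ((Real.contDiffAt_log.2 (norm_ne_zero_iff.2 hx)).comp x
          (contDiffAt_norm ℝ hx))
      refine h1.congr_of_eventuallyEq ?_
      filter_upwards [isOpen_compl_singleton.mem_nhds hx] with y hy
      rw [logRadial, if_neg (show y ≠ 0 from hy)]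
  · rintro rfl
    have this : Real.exp (-R) ≤ ‖(0 : E n)‖ := hx.2
    rw [norm_zero] at this
    exact absurd this (not_le.2 (Real.exp_pos _))

lemma IsTest.mul_left {Ω : Set (E n)} {φ g : E n → ℝ} (hφ : IsTest Ω φ) (hg : ContDiff ℝ ∞ g) :
    IsTest Ω fun x => g x * φ x :=
  ⟨hg.mul hφ.smooth, hφ.compact.mul_left, (tsupport_mul_subset_right).trans hφ.support⟩

lemma IsTest.sum {ι : Type*} (t : Finset ι) {Ω : Set (E n)} {φ : ι → E n → ℝ}
    (hφ : ∀ i, IsTest Ω (φ i)) : IsTest Ω fun x => ∑ i ∈ t, φ i x := by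
  classical
  induction t using Finset.induction_on with
  | empty =>
    simp only [Finset.sum_empty]
    exact ⟨contDiff_const, HasCompactSupport.zero, by simp [tsupport]⟩
  | insert i t hi ih =>
    simp only [Finset.sum_insert hi]
    exact ⟨(hφ i).smooth.add ih.smooth, (hφ i).compact.add ih.compact,
      (tsupport_add (φ i) _).trans (union_subset (hφ i).support ih.support)⟩

lemma integrable_volumeIoiPow {F : Type*} [NormedAddCommGroup F] [NormedSpace ℝ F] {m : ℕ}
    {f : ℝ → F} (hf : IntegrableOn (fun r => r ^ m • f r) (Ioi 0)) :
    Integrable (fun r : Ioi (0 : ℝ) => f r) (Measure.volumeIoiPow m) := by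
  rw [Measure.volumeIoiPow, integrable_withDensity_iff_integrable_smul₀' (by fun_prop)
    (by simp)]
  rw [integrableOn_iff_comap_subtypeVal measurableSet_Ioi] at hf
  refine hf.congr (Eventually.of_forall fun r => ?_)
  simp [ENNReal.toReal_ofReal (pow_nonneg (le_of_lt r.2) m)]

lemma integrable_radialWeight (hn : 0 < n) {γ c : ℝ} (hγ : γ < n) (hc : n - γ < c) :
    Integrable (fun r : Ioi (0 : ℝ) => (r : ℝ) ^ (-γ) * (1 + (r : ℝ)) ^ (-c))
      (Measure.volumeIoiPow (n - 1)) := by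
  refine integrable_volumeIoiPow (f := fun r => r ^ (-γ) * (1 + r) ^ (-c)) ?_
  refine (integrableOn_rpow_mul_one_add_rpow (β := n - 1 - γ) (c := c) (by linarith)
    (by linarith)).congr_fun (fun r (hr : 0 < r) => ?_) measurableSet_Ioi
  simp only [smul_eq_mul]
  rw [sub_eq_add_neg _ γ, Real.rpow_add hr, ← Real.rpow_natCast,
    Nat.cast_sub (show 1 ≤ n from hn), Nat.cast_one, mul_assoc]

/-- The weighted radial integral `∫ r ^ (-γ) F (r θ) r ^ (n - 1) dr`. -/
def radialMoment (γ : ℝ) (F : E n → ℝ) (θ : S n) : ℝ :=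
  ∫ r : Ioi (0 : ℝ), (r : ℝ) ^ (-γ) * F ((r : ℝ) • (θ : E n)) ∂(Measure.volumeIoiPow (n - 1))

lemma continuous_polar_comp {F : E n → ℝ} (hF : Continuous F) :
    Continuous fun q : S n × Ioi (0 : ℝ) => F ((q.2 : ℝ) • (q.1 : E n)) := by fun_prop

lemma memLp_radialMoment (hn : 0 < n) {γ c C : ℝ} (hγ : γ < n) (hc : n - γ < c) {F : E n → ℝ}
    (hF : Continuous F) (hC : ∀ x, |F x| ≤ C * (1 + ‖x‖) ^ (-c)) (q : ENNReal) :
    MemLp (radialMoment γ F) q (surface n) := by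
  have hm : Measurable fun q : S n × Ioi (0 : ℝ) => (q.2 : ℝ) ^ (-γ) := by fun_prop
  refine MemLp.of_bound
    (AEStronglyMeasurable.integral_prod_right'
      (hm.aestronglyMeasurable.mul (continuous_polar_comp hF).aestronglyMeasurable))
    (∫ r : Ioi (0 : ℝ), C * ((r : ℝ) ^ (-γ) * (1 + (r : ℝ)) ^ (-c))
      ∂(Measure.volumeIoiPow (n - 1))) (Eventually.of_forall fun θ => ?_)
  refine norm_integral_le_of_norm_le ((integrable_radialWeight hn hγ hc).const_mul C)
    (Eventually.of_forall fun r => ?_)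
  have hr : (0 : ℝ) < r := r.2
  rw [norm_mul, Real.norm_of_nonneg (by positivity), Real.norm_eq_abs]
  have h := hC ((r : ℝ) • (θ : E n))
  rw [norm_smul_sphere hr] at h
  calc _ ≤ (r : ℝ) ^ (-γ) * (C * (1 + (r : ℝ)) ^ (-c)) := by gcongr
    _ = _ := by ring

/-- Fubini in polar coordinates turns a pairing in space into one on the sphere, with ψ merely
integrable. -/
lemma integral_homogeneous_mul (hn : 0 < n) {γ c C : ℝ} (hγ : γ < n) (hc : n - γ < c)
    {F : E n → ℝ} (hF : Continuous F) (hC : ∀ x, |F x| ≤ C * (1 + ‖x‖) ^ (-c)) {ψ : S n → ℝ}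
    (hψ : Integrable ψ (surface n)) :
    ∫ x, homogeneous γ ψ x * F x = ∫ θ : S n, ψ θ * radialMoment γ F θ ∂(surface n) := by
  have hm : Measurable fun q : S n × Ioi (0 : ℝ) => (q.2 : ℝ) ^ (-γ) := by fun_prop
  have he : ∀ q : S n × Ioi (0 : ℝ), homogeneous γ ψ ((q.2 : ℝ) • (q.1 : E n)) *
      F ((q.2 : ℝ) • (q.1 : E n)) =
      ψ q.1 * ((q.2 : ℝ) ^ (-γ) * F ((q.2 : ℝ) • (q.1 : E n))) := by
    intro q
    rw [homogeneous_smul γ ψ q.2.2]; ring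
  rw [integral_polar hn]
  simp only [he]
  rw [integral_prod]
  · simp only [integral_const_mul, radialMoment]
  · refine ((hψ.norm.mul_prod ((integrable_radialWeight hn hγ hc).const_mul C))).mono'
      (hψ.1.comp_fst.mul (hm.aestronglyMeasurable.mul
        (continuous_polar_comp hF).aestronglyMeasurable)) (Eventually.of_forall fun q => ?_)
    have hr : (0 : ℝ) < q.2 := q.2.2
    rw [norm_mul, norm_mul, Real.norm_of_nonneg (by positivity : 0 ≤ (q.2 : ℝ) ^ (-γ)),
      Real.norm_eq_abs (F _)]
    have h := hC ((q.2 : ℝ) • (q.1 : E n))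
    rw [norm_smul_sphere hr] at h
    calc _ ≤ ‖ψ q.1‖ * ((q.2 : ℝ) ^ (-γ) * (C * (1 + (q.2 : ℝ)) ^ (-c))) := by gcongr
      _ = _ := by ring

lemma homogeneous_peval {k : ℕ} {P : MvPolynomial (Fin n) ℝ} (hP : P.IsHomogeneous k) (γ : ℝ)
    {x : E n} (hx : x ≠ 0) :
    (homogeneous γ (fun θ : S n => peval P (θ : E n)) x : ℂ) =
      peval P x * (‖x‖ : ℂ) ^ (-2 * (((γ : ℂ) + k) / 2)) := by
  have hx' := norm_pos_iff.2 hx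
  have h1 : homogeneous γ (fun θ : S n => peval P (θ : E n)) x =
      peval P x * ‖x‖ ^ (-(γ + k)) := by
    rw [homogeneous, dif_neg hx, peval_smul hP, neg_add, Real.rpow_add hx', Real.rpow_neg hx'.le k,
      Real.rpow_natCast, inv_pow]
    ring
  rw [h1, Complex.ofReal_mul, Complex.ofReal_cpow hx'.le]
  congr 2
  push_cast
  ring

/-- Pairing of the fractional Laplacian of a test function with a homogeneous extension of a
spherical harmonic. -/
theorem IsTest.integral_homogeneous_peval_mul_fracLaplacian (hn : 0 < n) {s : ℝ} (hs0 : 0 < s)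
    (hs2 : s < 2) {φ : E n → ℝ} (hφ : IsTest {0}ᶜ φ) {k : ℕ} {P : MvPolynomial (Fin n) ℝ}
    (hP : IsSolid k P) {γ : ℝ} (hγ : 0 < γ) (hγ' : γ < n - 2 * s) :
    ∫ x, homogeneous γ (fun θ : S n => peval P (θ : E n)) x * fracLaplacian s φ x =
      symbol n s k γ *
        ∫ x, homogeneous (γ + 2 * s) (fun θ : S n => peval P (θ : E n)) x * φ x := by
  have h := hφ.zetaPairing_fracLaplacian hn hs0 hs2 hP (γ := γ) (by simpa using hγ)
    (by simpa using hγ')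
  rw [symbolC_ofReal] at h
  have e1 : zetaPairing P (((γ : ℂ) + k) / 2) (fun x => (fracLaplacian s φ x : ℂ)) =
      ((∫ x, homogeneous γ (fun θ : S n => peval P (θ : E n)) x * fracLaplacian s φ x : ℝ) : ℂ) := by
    rw [zetaPairing, ← integral_complex_ofReal]
    refine integral_congr_ae ?_
    filter_upwards [ae_ne_zero hn] with x hx
    rw [Complex.ofReal_mul, homogeneous_peval hP.homogeneous γ hx]
  have e2 : zetaPairing P (((γ : ℂ) + k) / 2 + s) (fun x => (φ x : ℂ)) =
      ((∫ x, homogeneous (γ + 2 * s) (fun θ : S n => peval P (θ : E n)) x * φ x : ℝ) : ℂ) := by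
    rw [zetaPairing, ← integral_complex_ofReal]
    refine integral_congr_ae ?_
    filter_upwards [ae_ne_zero hn] with x hx
    rw [Complex.ofReal_mul, homogeneous_peval hP.homogeneous _ hx]
    push_cast
    ring_nf
  rw [e1, e2] at h
  exact_mod_cast h

/-! ### Projection of the equation onto spherical harmonics. -/

lemma integral_Ioi_eq_integral_exp {F : Type*} [NormedAddCommGroup F] [NormedSpace ℝ F]
    (f : ℝ → F) : ∫ r in Ioi (0 : ℝ), f r = ∫ ρ : ℝ, Real.exp ρ • f (Real.exp ρ) := by
  have h := integral_image_eq_integral_abs_deriv_smul (s := univ) (f := Real.exp)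
    (f' := Real.exp) MeasurableSet.univ (fun x _ => (Real.hasDerivAt_exp x).hasDerivWithinAt)
    Real.exp_injective.injOn f
  rw [image_univ, Real.range_exp, Measure.restrict_univ] at h
  simpa only [abs_of_pos (Real.exp_pos _)] using h

/-- With r = e^ρ, the weight r^(n-1+β) dr becomes e^((n+β)ρ) dρ, which the exponential prefactor
cancels. -/
lemma integral_radial_weight (hn : 0 < n) (β : ℝ) {g : ℝ → ℝ} :
    ∫ r in Ioi (0 : ℝ), r ^ (n - 1) • (r ^ β * (Real.exp (-(n + β) * Real.log r) *
      g (Real.log r))) = ∫ ρ, g ρ := by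
  rw [integral_Ioi_eq_integral_exp]
  congr 1; ext ρ
  rw [Real.log_exp, ← Real.exp_mul, ← Real.exp_nat_mul, smul_eq_mul, smul_eq_mul, ← mul_assoc,
    ← mul_assoc, ← mul_assoc, ← Real.exp_add, ← Real.exp_add, ← Real.exp_add]
  rw [Nat.cast_sub (show 1 ≤ n from hn)]
  push_cast
  rw [show ρ + (n - 1) * ρ + ρ * β + -(n + β) * ρ = 0 by ring, Real.exp_zero, one_mul]

/-- Testing the equation against a solid harmonic. -/
theorem IsSolution.symbol_mul_integral (hn : 0 < n) {s p γ : ℝ} (hs0 : 0 < s) (hs2 : s < 2)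
    (hγ : 0 < γ) (hγ' : γ < n - 2 * s) (hγp : γ * (p - 1) = 2 * s) {ψ : S n → ℝ}
    (hψ : MemLp ψ 2 (surface n)) (hsol : IsSolution s p {0}ᶜ (homogeneous γ ψ)) {k : ℕ}
    {Q : MvPolynomial (Fin n) ℝ} (hQ : IsSolid k Q) :
    symbol n s k γ * ∫ θ : S n, ψ θ * peval Q (θ : E n) ∂(surface n) =
      ∫ θ : S n, |ψ θ| ^ (p - 1) * ψ θ * peval Q (θ : E n) ∂(surface n) := by
  set g : ContDiffBump (0 : ℝ) := default
  -- Total power of r when the test function Q(x) h(log |x|) meets something homogeneous of degree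
  -- -(γ + 2s).
  set β : ℝ := k - (γ + 2 * s) with hβ
  set h : ℝ → ℝ := fun ρ => Real.exp (-(n + β) * ρ) * g ρ with hh
  have hsm : ContDiff ℝ ∞ h := by
    have h1 : ContDiff ℝ ∞ (fun ρ => g ρ) := g.contDiff (n := ⊤)
    have h2 : ContDiff ℝ ∞ fun ρ : ℝ => Real.exp (-(n + β) * ρ) := by fun_prop
    exact h2.mul h1
  have hcs : HasCompactSupport h := g.hasCompactSupport.mul_left
  set φ : E n → ℝ := fun x => peval Q x * logRadial h x with hφ
  have htest : IsTest ({0}ᶜ : Set (E n)) φ := (isTest_logRadial hsm hcs).mul_left (contDiff_peval Q)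
  have hg : 0 < ∫ ρ, g ρ := g.integral_pos
  have hφr : ∀ (θ : S n) (r : ℝ), 0 < r → φ (r • (θ : E n)) =
      peval Q (θ : E n) * (r ^ (k : ℝ) * h (Real.log r)) := by
    intro θ r hr
    rw [hφ]
    simp only [peval_smul hQ.homogeneous, logRadial_smul h hr, Real.rpow_natCast]
    ring
  have hhr : ∀ ρ, h ρ = Real.exp (-(n + β) * ρ) * g ρ := fun _ => rfl
  have hpair : ∀ χ : S n → ℝ, ∫ x, homogeneous (γ + 2 * s) χ x * φ x =
      (∫ θ : S n, χ θ * peval Q (θ : E n) ∂(surface n)) * ∫ ρ, g ρ := by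
    intro χ
    rw [← integral_radial_weight hn β]
    refine integral_polar_mul hn fun θ r hr => ?_
    have h1 : r ^ β = r ^ (k : ℝ) * r ^ (-(γ + 2 * s)) := by
      rw [hβ, sub_eq_add_neg, Real.rpow_add hr]
    rw [homogeneous_smul _ _ hr, hφr θ r hr, hhr, h1]
    ring
  obtain ⟨C, hC0, hC⟩ := htest.exists_abs_fracLaplacian_le hn hs0 hs2
  have hFc := htest.continuous_fracLaplacian hn hs0
  have hn' : (0 : ℝ) < n := by exact_mod_cast hn
  have hγn : γ < n := by linarith
  have hc : (n : ℝ) - γ < n + 2 * s := by linarith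
  -- (-Δ)^s φ is not computed pointwise. Only its moment B enters, and pairings with harmonics
  -- determine it: B = cQ a.e. by completeness. This moves the symbol identity from harmonics to an
  -- arbitrary ψ in L².
  set B := radialMoment γ (fracLaplacian s φ) with hB
  have hBL : MemLp B 2 (surface n) := memLp_radialMoment hn hγn hc hFc hC 2
  have hQL := memLp_peval_sphere Q 2
  have hBQ : ∀ j P, IsSolid j P → ∫ θ : S n, B θ * peval P (θ : E n) ∂(surface n) =
      symbol n s k γ * (∫ ρ, g ρ) *
        ∫ θ : S n, peval Q (θ : E n) * peval P (θ : E n) ∂(surface n) := by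
    intro j P hP
    have h1 := htest.integral_homogeneous_peval_mul_fracLaplacian hn hs0 hs2 hP hγ hγ'
    rw [hpair, integral_homogeneous_mul hn hγn hc hFc hC
      ((memLp_peval_sphere P 2).integrable (by norm_num))] at h1
    simp only [mul_comm (B _), mul_comm (peval Q _)]
    rw [h1]
    rcases eq_or_ne j k with rfl | hjk
    · ring
    · rw [integral_sphere_mul_eq_zero hn hjk hP hQ]; ring
  set c := symbol n s k γ * ∫ ρ, g ρ with hc'
  have hz : (fun θ : S n => B θ - c * peval Q (θ : E n)) =ᵐ[surface n] 0 := by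
    refine ae_eq_zero_of_forall_integral_peval hn (hBL.sub (hQL.const_mul c)) fun j P hP => ?_
    have hPL := memLp_peval_sphere P 2
    have i1 : Integrable (fun θ : S n => B θ * peval P (θ : E n)) (surface n) :=
      hBL.integrable_mul hPL
    have i2 : Integrable (fun θ : S n => c * (peval Q (θ : E n) * peval P (θ : E n)))
        (surface n) := (hQL.integrable_mul hPL).const_mul c
    simp only [sub_mul, mul_assoc]
    rw [integral_sub i1 i2,
      integral_const_mul, hBQ j P hP, hc', sub_self]
  have heq := hsol.eqn φ htest
  rw [integral_homogeneous_mul hn hγn hc hFc hC (hψ.integrable (by norm_num))] at heq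
  have hl : ∫ θ : S n, ψ θ * radialMoment γ (fracLaplacian s φ) θ ∂(surface n) =
      c * ∫ θ : S n, ψ θ * peval Q (θ : E n) ∂(surface n) := by
    rw [← integral_const_mul]
    refine integral_congr_ae ?_
    filter_upwards [hz] with θ hθ
    have : B θ = c * peval Q (θ : E n) := sub_eq_zero.1 hθ
    rw [← hB, this]; ring
  have hr : ∫ x, |homogeneous γ ψ x| ^ (p - 1) * homogeneous γ ψ x * φ x =
      (∫ θ : S n, |ψ θ| ^ (p - 1) * ψ θ * peval Q (θ : E n) ∂(surface n)) * ∫ ρ, g ρ := by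
    rw [← integral_radial_weight hn β]
    refine integral_polar_mul hn fun θ r hr => ?_
    have h1 : r ^ β = r ^ (-γ * (p - 1)) * r ^ (-γ) * r ^ (k : ℝ) := by
      rw [hβ, show (k : ℝ) - (γ + 2 * s) = -γ * (p - 1) + -γ + k by rw [← hγp]; ring,
        Real.rpow_add hr, Real.rpow_add hr]
    rw [homogeneous_smul _ _ hr, hφr θ r hr, hhr, h1, abs_mul,
      abs_of_pos (Real.rpow_pos_of_pos hr _),
      Real.mul_rpow (by positivity) (abs_nonneg _), ← Real.rpow_mul hr.le]
    ring
  rw [hl, hr, hc'] at heq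
  refine mul_right_cancel₀ hg.ne' ?_
  linarith

/-! ### The energy on the critical line. -/

lemma IsTest.integral_mul_fracLaplacian (hn : 0 < n) {s : ℝ} (hs0 : 0 < s) {Ω : Set (E n)}
    {φ : E n → ℝ} (hφ : IsTest Ω φ) : ∫ x, φ x * fracLaplacian s φ x = fracEnergy s φ := by
  have h := integral_fourier_mul_eq hφ.integrable (hφ.integrable_fracSymbol hn hs0).comp_neg
  have e1 : (fun x : E n => (φ x : ℂ) * 𝓕 (fun ξ => fracSymbol s φ (-ξ)) x) =
      fun x => ((φ x * fracLaplacian s φ x : ℝ) : ℂ) := by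
    ext x
    rw [Complex.ofReal_mul, ← fourierInv_fracSymbol, Real.fourierInv_eq_fourier_comp_neg]
  have e2 : (fun ξ : E n => 𝓕 (fun y : E n => (φ y : ℂ)) ξ * fracSymbol s φ (-ξ)) =
      fun ξ => (((2 * Real.pi * ‖ξ‖) ^ (2 * s) * ‖𝓕 (fun y : E n => (φ y : ℂ)) ξ‖ ^ 2 : ℝ) : ℂ) := by
    ext ξ
    rw [fracSymbol, fourier_ofReal_neg, norm_neg, Complex.ofReal_mul, Complex.ofReal_pow,
      ← Complex.mul_conj']
    ring
  rw [e1, e2, integral_complex_ofReal, integral_complex_ofReal] at h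
  exact_mod_cast h.symm

lemma schwartz_eq_integral_fourier (G : SchwartzMap ℝ ℂ) (ρ : ℝ) :
    G ρ = ∫ σ : ℝ, Complex.exp (((2 * Real.pi * σ * ρ : ℝ) : ℂ) * Complex.I) * 𝓕 G σ := by
  have h : 𝓕⁻ (𝓕 G) = G := FourierTransform.fourierInv_fourier_eq G
  conv_lhs => rw [← h, SchwartzMap.fourierInv_coe, Real.fourierInv_eq']
  congr 1; ext σ
  rw [smul_eq_mul, real_inner_eq_re_inner ℝ]
  simp
  left
  ring_nf

lemma conj_fourier_eq_integral {g : ℝ → ℝ} {G : SchwartzMap ℝ ℂ} (hG : ∀ ρ, G ρ = g ρ) (σ : ℝ) :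
    (starRingEnd ℂ) (𝓕 G σ) =
      ∫ ρ : ℝ, Complex.exp (((2 * Real.pi * σ * ρ : ℝ) : ℂ) * Complex.I) * g ρ := by
  rw [SchwartzMap.fourier_coe, Real.fourier_real_eq_integral_exp_smul, ← integral_conj]
  congr 1; ext ρ
  rw [smul_eq_mul, map_mul, hG, Complex.conj_ofReal, ← Complex.exp_conj, map_mul,
    Complex.conj_ofReal, Complex.conj_I]
  congr 2
  push_cast
  ring

/-- The Mellin pairing of a function `r ^ (-γ₀) g (ε log r) B` with a homogeneous extension of a
spherical harmonic, on the critical line. -/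
lemma zetaPairing_critical (hn : 0 < n) {s γ₀ ε σ : ℝ} (hε : 0 < ε) (hγ₀ : 2 * γ₀ = n - 2 * s)
    {g : ℝ → ℝ} {G : SchwartzMap ℝ ℂ} (hG : ∀ ρ, G ρ = g ρ) {φ : E n → ℝ} {B : S n → ℝ}
    (hφ : ∀ (θ : S n) (r : ℝ), 0 < r →
      φ (r • (θ : E n)) = B θ * (r ^ (-γ₀) * g (ε * Real.log r)))
    {k : ℕ} {Q : MvPolynomial (Fin n) ℝ} (hQ : IsSolid k Q) :
    zetaPairing Q (((γ₀ - (2 * Real.pi * ε * σ : ℝ) * Complex.I : ℂ) + k) / 2 + s)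
        (fun x => (φ x : ℂ)) =
      ((∫ θ : S n, peval Q (θ : E n) * B θ ∂(surface n) : ℝ) : ℂ) *
        ((ε⁻¹ : ℝ) * (starRingEnd ℂ) (𝓕 G σ)) := by
  set a : ℂ := ((γ₀ - (2 * Real.pi * ε * σ : ℝ) * Complex.I : ℂ) + k) / 2 + s with ha
  rw [zetaPairing, integral_polar_mul hn (B := fun θ : S n => ((peval Q (θ : E n) * B θ : ℝ) : ℂ))
    (A := fun r => (r : ℂ) ^ k * (r : ℂ) ^ (-2 * a) * ((r ^ (-γ₀) * g (ε * Real.log r) : ℝ) : ℂ)),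
    integral_complex_ofReal]
  swap
  · intro θ r hr
    rw [peval_smul hQ.homogeneous, norm_smul_sphere hr, hφ θ r hr]
    push_cast
    ring
  congr 1
  rw [integral_Ioi_eq_integral_exp, conj_fourier_eq_integral hG]
  have h := Measure.integral_comp_mul_left
    (fun ρ : ℝ => Complex.exp (((2 * Real.pi * σ * ρ : ℝ) : ℂ) * Complex.I) * g ρ) ε
  rw [abs_of_pos (inv_pos.2 hε), Complex.real_smul] at h
  rw [← h]
  congr 1; ext ρ
  have e1 : (((Real.exp ρ) ^ (-γ₀) : ℝ) : ℂ) = Complex.exp (ρ * (-γ₀)) := by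
    rw [← Real.exp_mul]; push_cast; rfl
  rw [ofReal_cpow_eq_exp (Real.exp_pos _), Real.log_exp, Complex.real_smul, Complex.real_smul,
    Complex.ofReal_mul ((Real.exp ρ) ^ (-γ₀)), e1, Complex.ofReal_pow, Complex.ofReal_exp,
    ← Complex.exp_nat_mul, ← Complex.exp_nat_mul, ← Complex.exp_add, ← mul_assoc, ← mul_assoc,
    ← mul_assoc, ← Complex.exp_add, ← Complex.exp_add, ← Complex.exp_add]
  congr 2
  rw [Nat.cast_sub (show 1 ≤ n from hn), ha]
  have h2 : (2 * γ₀ : ℂ) = n - 2 * s := by exact_mod_cast congrArg (fun x : ℝ => (x : ℂ)) hγ₀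
  push_cast
  linear_combination (-(ρ : ℂ)) * h2

/-- Fourier inversion of g in the variable log |x| writes χ as a superposition of Q |x|^(-(z+k))
with Re z = γ₀. Each piece is multiplied by the symbol at z, and its pairing with φ yields the
conjugate transform of g, whence the squared modulus. -/
theorem IsTest.integral_critical_mul_fracLaplacian (hn : 0 < n) {s γ₀ ε : ℝ} (hs0 : 0 < s)
    (hs2 : s < 2) (hγ : 0 < γ₀) (hε : 0 < ε) (hγ₀ : 2 * γ₀ = n - 2 * s)
    {g : ℝ → ℝ} {G : SchwartzMap ℝ ℂ} (hG : ∀ ρ, G ρ = g ρ) {φ : E n → ℝ}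
    (hφt : IsTest {0}ᶜ φ) {B : S n → ℝ}
    (hφ : ∀ (θ : S n) (r : ℝ), 0 < r →
      φ (r • (θ : E n)) = B θ * (r ^ (-γ₀) * g (ε * Real.log r)))
    {k : ℕ} {Q : MvPolynomial (Fin n) ℝ} (hQ : IsSolid k Q) {χ : E n → ℝ}
    (hχ : ∀ x, x ≠ 0 → χ x = peval Q x * (‖x‖ ^ (-(γ₀ + k)) * g (ε * Real.log ‖x‖))) :
    ((∫ x, χ x * fracLaplacian s φ x : ℝ) : ℂ) =
      ((ε⁻¹ * ∫ θ : S n, peval Q (θ : E n) * B θ ∂(surface n) : ℝ) : ℂ) *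
        ∫ σ : ℝ, symbolC n s k (γ₀ - (2 * Real.pi * ε * σ : ℝ) * Complex.I) *
          ((‖𝓕 G σ‖ ^ 2 : ℝ) : ℂ) := by
  have hn' : (0 : ℝ) < n := by exact_mod_cast hn
  set z : ℝ → ℂ := fun σ => γ₀ - (2 * Real.pi * ε * σ : ℝ) * Complex.I with hz
  have hzre : ∀ σ, (z σ).re = γ₀ := fun σ => by simp [hz]
  set F := fracLaplacian s φ with hF
  have hFc : Continuous F := hφt.continuous_fracLaplacian hn hs0
  set K : E n → ℝ → ℂ := fun x σ =>
    (peval Q x * (‖x‖ : ℂ) ^ (-2 * ((z σ + k) / 2)) * F x) * 𝓕 G σ with hK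
  have hKx : ∀ᵐ x : E n, ((χ x * F x : ℝ) : ℂ) = ∫ σ, K x σ := by
    filter_upwards [ae_ne_zero hn] with x hx
    have hx' := norm_pos_iff.2 hx
    have e : ∀ σ, K x σ = ((peval Q x * ‖x‖ ^ (-(γ₀ + k)) * F x : ℝ) : ℂ) *
        (Complex.exp (((2 * Real.pi * σ * (ε * Real.log ‖x‖) : ℝ) : ℂ) * Complex.I) * 𝓕 G σ) := by
      intro σ
      have e1 : (‖x‖ : ℂ) ^ (-2 * ((z σ + k) / 2)) = ((‖x‖ ^ (-(γ₀ + k)) : ℝ) : ℂ) *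
          Complex.exp (((2 * Real.pi * σ * (ε * Real.log ‖x‖) : ℝ) : ℂ) * Complex.I) := by
        rw [Complex.ofReal_cpow hx'.le, ofReal_cpow_eq_exp hx', ofReal_cpow_eq_exp hx',
          ← Complex.exp_add, hz]
        congr 1
        push_cast
        ring
      simp only [hK, e1]
      push_cast
      ring
    simp only [e]
    rw [integral_const_mul, ← schwartz_eq_integral_fourier, hG, hχ x hx]
    push_cast
    ring
  have hKi : Integrable (Function.uncurry K) ((volume : Measure (E n)).prod volume) := by
    obtain ⟨C, hC0, hC⟩ := exists_abs_peval_le hQ.homogeneous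
    have i1 : Integrable fun x : E n => C * (‖x‖ ^ (-γ₀) * ‖F x‖) :=
      (hφt.integrable_norm_rpow_mul_fracLaplacian hn hs0 hs2 (by linarith) (by linarith)).const_mul C
    refine (i1.mul_prod (𝓕 G).integrable.norm).mono' ?_ ?_
    · have m1 : Measurable fun q : E n × ℝ => (‖q.1‖ : ℂ) ^ (-2 * ((z q.2 + k) / 2)) := by
        have : Measurable z := by fun_prop
        fun_prop
      have m2 : Continuous fun q : E n × ℝ => ((peval Q q.1 : ℝ) : ℂ) :=
        Complex.continuous_ofReal.comp ((continuous_peval Q).comp continuous_fst)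
      have m3 : Continuous fun q : E n × ℝ => ((F q.1 : ℝ) : ℂ) :=
        Complex.continuous_ofReal.comp (hFc.comp continuous_fst)
      have m4 : Continuous fun q : E n × ℝ => 𝓕 G q.2 := (𝓕 G).continuous.comp continuous_snd
      exact (((m2.measurable.mul m1).mul m3.measurable).mul m4.measurable).aestronglyMeasurable
    · have h0 : ∀ᵐ q : E n × ℝ ∂((volume : Measure (E n)).prod volume), q.1 ≠ 0 :=
        Measure.quasiMeasurePreserving_fst.ae (ae_ne_zero hn)
      filter_upwards [h0] with q hq
      have hq' := norm_pos_iff.2 hq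
      have e1 : ‖(‖q.1‖ : ℂ) ^ (-2 * ((z q.2 + k) / 2))‖ = ‖q.1‖ ^ (-(γ₀ + k)) := by
        rw [Complex.norm_cpow_eq_rpow_re_of_pos hq']
        congr 1
        rw [show -2 * ((z q.2 + k) / 2) = -(z q.2 + k) by ring]
        simp [hzre]
      simp only [Function.uncurry, hK, norm_mul, e1, Complex.norm_real]
      have e2 : ‖q.1‖ ^ (-γ₀) = ‖q.1‖ ^ k * ‖q.1‖ ^ (-(γ₀ + k)) := by
        rw [← Real.rpow_natCast, ← Real.rpow_add hq']; congr 1; ring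
      rw [e2, ← mul_assoc C, ← mul_assoc C]
      gcongr
      exact hC q.1
  rw [← integral_complex_ofReal, integral_congr_ae hKx, integral_integral_swap hKi,
    ← integral_const_mul]
  congr 1; ext σ
  simp only [hK]
  rw [integral_mul_const]
  have h1 := hφt.zetaPairing_fracLaplacian hn hs0 hs2 hQ (γ := z σ) (by rw [hzre]; exact hγ)
    (by rw [hzre]; linarith)
  rw [zetaPairing_critical hn hε hγ₀ hG hφ hQ, zetaPairing] at h1
  change _ = _ * (symbolC n s k (z σ) * _)
  rw [h1, Complex.ofReal_pow, ← Complex.mul_conj']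
  push_cast
  ring

/-- Each of the two Gamma ratios grows at most quadratically; this crude bound serves as a
dominating function. -/
lemma exists_norm_symbolC_le {s γ : ℝ} (hs0 : 0 < s) (hs2 : s < 2) (hγ : 0 < γ)
    (hγ' : γ < n - 2 * s) (k : ℕ) :
    ∃ C, 0 ≤ C ∧ ∀ t : ℝ, ‖symbolC n s k (γ - (t : ℝ) * Complex.I)‖ ≤ C * (1 + |t|) ^ 4 := by
  have hk : (0 : ℝ) ≤ k := Nat.cast_nonneg k
  set a₁ : ℝ := γ / 2 + k / 2 with ha₁
  set a₂ : ℝ := n / 2 - s - γ / 2 + k / 2 with ha₂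
  have h₁ : 0 < a₁ := by positivity
  have h₂ : 0 < a₂ := by rw [ha₂]; linarith
  have key : ∀ a : ℝ, 0 < a → ∃ C, 0 ≤ C ∧ ∀ z : ℂ, ∀ t : ℝ, z.re = a → |z.im| ≤ |t| →
      ‖gammaRatioC s z‖ ≤ C * (1 + |t|) ^ 2 := by
    intro a ha
    obtain ⟨C, hC⟩ := exists_norm_gammaRatioC_le hs0 hs2 ha
    refine ⟨|C| * (a + 1) ^ 2, by positivity, fun z t hz ht => (hC z hz).trans ?_⟩
    have hn := Complex.norm_le_abs_re_add_abs_im z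
    rw [hz, abs_of_pos ha] at hn
    have h0 := abs_nonneg t
    have hb : ‖z‖ + 1 ≤ (a + 1) * (1 + |t|) := by nlinarith
    calc C * (‖z‖ * (‖z‖ + 1)) ≤ |C| * ((‖z‖ + 1) * (‖z‖ + 1)) := by
          gcongr
          · exact le_abs_self C
          · linarith
      _ ≤ |C| * (((a + 1) * (1 + |t|)) * ((a + 1) * (1 + |t|))) := by gcongr
      _ = _ := by ring
  obtain ⟨C₁, hC₁0, hC₁⟩ := key a₁ h₁
  obtain ⟨C₂, hC₂0, hC₂⟩ := key a₂ h₂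
  refine ⟨‖(2 : ℂ) ^ (2 * s : ℂ)‖ * C₁ * C₂, by positivity, fun t => ?_⟩
  have ht : |t / 2| ≤ |t| := by
    rw [abs_div, abs_two]; linarith [abs_nonneg t]
  have b₁ := hC₁ ((γ - (t : ℝ) * Complex.I) / 2 + k / 2) t (by simp [ha₁]) (by
    have : ((γ - (t : ℝ) * Complex.I) / 2 + k / 2 : ℂ).im = -(t / 2) := by simp; ring
    rw [this, abs_neg]; exact ht)
  have b₂ := hC₂ (n / 2 - s - (γ - (t : ℝ) * Complex.I) / 2 + k / 2) t (by simp [ha₂]) (by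
    have : (n / 2 - s - (γ - (t : ℝ) * Complex.I) / 2 + k / 2 : ℂ).im = t / 2 := by simp; ring
    rw [this]; exact ht)
  rw [symbolC, norm_mul, norm_mul]
  calc _ ≤ ‖(2 : ℂ) ^ (2 * s : ℂ)‖ * (C₁ * (1 + |t|) ^ 2) * (C₂ * (1 + |t|) ^ 2) := by gcongr
    _ = _ := by ring

lemma continuous_symbolC_line {s γ : ℝ} (hs0 : 0 < s) (hγ : 0 < γ) (hγ' : γ < n - 2 * s) (k : ℕ) :
    Continuous fun t : ℝ => symbolC n s k (γ - (t : ℝ) * Complex.I) := by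
  have hk : (0 : ℝ) ≤ k := Nat.cast_nonneg k
  refine continuous_iff_continuousAt.2 fun t => ?_
  refine (continuousAt_const.mul ?_).mul ?_
  · refine ContinuousAt.comp (g := gammaRatioC s) (continuousAt_gammaRatioC hs0 ?_) (by fun_prop)
    have : ((γ - (t : ℝ) * Complex.I) / 2 + k / 2 : ℂ).re = γ / 2 + k / 2 := by simp
    rw [this]; positivity
  · refine ContinuousAt.comp (g := gammaRatioC s) (continuousAt_gammaRatioC hs0 ?_) (by fun_prop)
    have : (n / 2 - s - (γ - (t : ℝ) * Complex.I) / 2 + k / 2 : ℂ).re =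
      n / 2 - s - γ / 2 + k / 2 := by simp
    rw [this]; linarith

lemma integrable_one_add_abs_pow_mul_sq (w : SchwartzMap ℝ ℂ) :
    Integrable fun σ : ℝ => (1 + |σ|) ^ 4 * ‖w σ‖ ^ 2 := by
  obtain ⟨C, hC⟩ : ∃ C, ∀ x, (1 + ‖x‖) ^ 4 * ‖w x‖ ≤ C := by
    refine ⟨2 ^ 4 * (Finset.Iic (4, 0)).sup
      (fun m => SchwartzMap.seminorm ℝ m.1 m.2) w, fun x => ?_⟩
    have := SchwartzMap.one_add_le_sup_seminorm_apply (𝕜 := ℝ) (m := (4, 0)) (k := 4) (n := 0)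
      le_rfl le_rfl w x
    simpa using this
  refine (w.integrable.norm.const_mul C).mono' ?_ (Eventually.of_forall fun x => ?_)
  · exact (by have := w.continuous; fun_prop :
      Continuous fun σ : ℝ => (1 + |σ|) ^ 4 * ‖w σ‖ ^ 2).aestronglyMeasurable
  · rw [Real.norm_of_nonneg (by positivity), sq, ← mul_assoc]
    exact mul_le_mul_of_nonneg_right (hC x) (norm_nonneg _)

/-- As g(ε log r) spreads out, its frequencies concentrate at 0 and the symbol freezes at the real
point γ, by dominated convergence. -/
lemma tendsto_integral_symbolC {s γ : ℝ} (hs0 : 0 < s) (hs2 : s < 2) (hγ : 0 < γ)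
    (hγ' : γ < n - 2 * s) (k : ℕ) (w : SchwartzMap ℝ ℂ) :
    Tendsto (fun m : ℕ => ∫ σ : ℝ,
        symbolC n s k (γ - (2 * Real.pi * (1 / ((m : ℝ) + 1)) * σ : ℝ) * Complex.I) *
          ((‖w σ‖ ^ 2 : ℝ) : ℂ)) atTop
      (𝓝 ((symbol n s k γ * ∫ σ, ‖w σ‖ ^ 2 : ℝ) : ℂ)) := by
  obtain ⟨C, hC0, hC⟩ := exists_norm_symbolC_le hs0 hs2 hγ hγ' k
  have hcont := continuous_symbolC_line hs0 hγ hγ' k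
  have hw := w.continuous
  have hlim : ((symbol n s k γ * ∫ σ, ‖w σ‖ ^ 2 : ℝ) : ℂ) =
      ∫ σ : ℝ, symbolC n s k γ * ((‖w σ‖ ^ 2 : ℝ) : ℂ) := by
    rw [integral_const_mul, integral_complex_ofReal, symbolC_ofReal, Complex.ofReal_mul]
  rw [hlim]
  refine tendsto_integral_of_dominated_convergence
    (fun σ => C * (2 * Real.pi + 1) ^ 4 * ((1 + |σ|) ^ 4 * ‖w σ‖ ^ 2)) (fun m => ?_)
    ((integrable_one_add_abs_pow_mul_sq w).const_mul _) (fun m => Eventually.of_forall fun σ => ?_)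
    (Eventually.of_forall fun σ => ?_)
  · refine Continuous.aestronglyMeasurable (Continuous.mul ?_ (by fun_prop))
    exact hcont.comp (by fun_prop : Continuous fun σ : ℝ => 2 * Real.pi * (1 / ((m : ℝ) + 1)) * σ)
  · rw [norm_mul, Complex.norm_real, Real.norm_of_nonneg (by positivity : 0 ≤ ‖w σ‖ ^ 2),
      ← mul_assoc]
    refine mul_le_mul_of_nonneg_right ((hC _).trans ?_) (by positivity)
    rw [mul_assoc C, ← mul_pow]
    have h1 : 1 / ((m : ℝ) + 1) ≤ 1 := by
      rw [div_le_one (by positivity)]; linarith [Nat.cast_nonneg (α := ℝ) m]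
    have h2 : |2 * Real.pi * (1 / ((m : ℝ) + 1)) * σ| ≤ 2 * Real.pi * 1 * |σ| := by
      rw [abs_mul, abs_of_nonneg (by positivity)]
      have := Real.pi_pos
      gcongr
    gcongr
    nlinarith [abs_nonneg σ, Real.pi_pos]
  · refine Tendsto.mul ?_ tendsto_const_nhds
    have h1 : Tendsto (fun m : ℕ => 2 * Real.pi * (1 / ((m : ℝ) + 1)) * σ) atTop (𝓝 0) := by
      have := (tendsto_one_div_add_atTop_nhds_zero_nat (𝕜 := ℝ)).const_mul (2 * Real.pi)
      simpa using this.mul_const σ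
    have h2 := (hcont.tendsto 0).comp h1
    simpa [Function.comp_def] using h2

/-! ### Stability on spreading test functions. -/

/-- Stability, tested on functions concentrating on the critical frequency, bounds the potential
by the critical symbol. -/
theorem IsStable.mul_integral_le (hn : 0 < n) {s p γ γ₀ : ℝ} (hs0 : 0 < s) (hs2 : s < 2)
    (hγ : 0 < γ₀) (hγ₀ : 2 * γ₀ = n - 2 * s) (hγp : γ * (p - 1) = 2 * s) {ψ : S n → ℝ}
    (hst : IsStable s p {0}ᶜ (homogeneous γ ψ)) {Q : ℕ → MvPolynomial (Fin n) ℝ}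
    (hQ : ∀ k, IsSolid k (Q k)) (N : ℕ) :
    p * ∫ θ : S n, |ψ θ| ^ (p - 1) * (∑ k ∈ Finset.range N, peval (Q k) (θ : E n)) ^ 2
        ∂(surface n) ≤
      ∑ k ∈ Finset.range N, symbol n s k γ₀ * ∫ θ : S n, peval (Q k) (θ : E n) ^ 2
        ∂(surface n) := by
  set g : ContDiffBump (0 : ℝ) := default
  have hgs : ContDiff ℝ ∞ (fun ρ => g ρ) := g.contDiff (n := ⊤)
  have hgc : HasCompactSupport fun ρ => g ρ := g.hasCompactSupport
  set G : SchwartzMap ℝ ℂ :=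
    (hgc.comp_left (g := fun r : ℝ => (r : ℂ)) rfl).toSchwartzMap
      (Complex.ofRealCLM.contDiff.comp hgs) with hGdef
  have hG : ∀ ρ, G ρ = g ρ := fun _ => rfl
  set I : ℝ := ∫ ρ, g ρ ^ 2 with hI
  have hIpos : 0 < I := by
    refine (integral_pos_iff_support_of_nonneg (fun _ => sq_nonneg _) ?_).2 ?_
    · exact (g.continuous.pow 2).integrable_of_hasCompactSupport (by
        simpa [sq] using hgc.mul_left (f := fun ρ => g ρ))
    · have : Function.support (fun ρ => g ρ ^ 2) = Metric.ball (0 : ℝ) g.rOut := by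
        rw [← g.support_eq]; ext; simp
      rw [this]
      exact Metric.measure_ball_pos _ _ g.rOut_pos
  have hPl : ∫ σ, ‖𝓕 G σ‖ ^ 2 = I := by
    rw [SchwartzMap.integral_norm_sq_fourier]
    simp [hG, hI]
  set B : S n → ℝ := fun θ => ∑ k ∈ Finset.range N, peval (Q k) (θ : E n) with hB
  set A : ℝ := ∫ θ : S n, |ψ θ| ^ (p - 1) * B θ ^ 2 ∂(surface n) with hA
  set q : ℕ → ℝ := fun k => ∫ θ : S n, peval (Q k) (θ : E n) ^ 2 ∂(surface n) with hq
  have hqB : ∀ k ∈ Finset.range N,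
      ∫ θ : S n, peval (Q k) (θ : E n) * B θ ∂(surface n) = q k := by
    intro k hk
    simp only [hB, Finset.mul_sum]
    rw [integral_finsetSum, Finset.sum_eq_single_of_mem k hk]
    · simp only [hq, sq]
    · intro j _ hjk
      exact integral_sphere_mul_eq_zero hn hjk.symm (hQ k) (hQ j)
    · exact fun j _ => (memLp_peval_sphere (Q k) 2).integrable_mul (memLp_peval_sphere (Q j) 2)
  -- The energy and the potential term both carry a factor 1/ε, the length scale of g(ε log r) in
  -- log r; T is ε times the energy.
  have main : ∀ ε : ℝ, 0 < ε → ∃ T : ℝ, p * A * I ≤ T ∧ (T : ℂ) =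
      ∑ k ∈ Finset.range N, (q k : ℂ) *
        ∫ σ : ℝ, symbolC n s k (γ₀ - (2 * Real.pi * ε * σ : ℝ) * Complex.I) *
          ((‖𝓕 G σ‖ ^ 2 : ℝ) : ℂ) := by
    intro ε hε
    set h : ℕ → ℝ → ℝ := fun k ρ => Real.exp (-(γ₀ + k) * ρ) * g (ε * ρ) with hh
    have hhr : ∀ k ρ, h k ρ = Real.exp (-(γ₀ + k) * ρ) * g (ε * ρ) := fun _ _ => rfl
    have hsm : ∀ k, ContDiff ℝ ∞ (h k) := by
      intro k
      have h1 : ContDiff ℝ ∞ fun ρ => g (ε * ρ) := hgs.comp (contDiff_const.mul contDiff_id)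
      have h2 : ContDiff ℝ ∞ fun ρ : ℝ => Real.exp (-(γ₀ + k) * ρ) := by fun_prop
      exact h2.mul h1
    have hcs : ∀ k, HasCompactSupport (h k) := fun k =>
      (hgc.comp_homeomorph (Homeomorph.mulLeft₀ ε hε.ne')).mul_left
    set χ : ℕ → E n → ℝ := fun k x => peval (Q k) x * logRadial (h k) x with hχ
    have hχt : ∀ k, IsTest ({0}ᶜ : Set (E n)) (χ k) := fun k =>
      (isTest_logRadial (hsm k) (hcs k)).mul_left (contDiff_peval (Q k))
    set φ : E n → ℝ := fun x => ∑ k ∈ Finset.range N, χ k x with hφ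
    have hφt : IsTest ({0}ᶜ : Set (E n)) φ := IsTest.sum _ hχt
    have hφr : ∀ (θ : S n) (r : ℝ), 0 < r →
        φ (r • (θ : E n)) = B θ * (r ^ (-γ₀) * g (ε * Real.log r)) := by
      intro θ r hr
      simp only [hφ, hχ, hB, Finset.sum_mul]
      refine Finset.sum_congr rfl fun k _ => ?_
      have e1 : Real.exp (-(γ₀ + k) * Real.log r) = r ^ (-γ₀) * (r ^ k)⁻¹ := by
        rw [mul_comm, ← Real.rpow_def_of_pos hr, neg_add, Real.rpow_add hr, Real.rpow_neg hr.le k,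
          Real.rpow_natCast]
      rw [peval_smul (hQ k).homogeneous, logRadial_smul (h k) hr, hhr, e1]
      have := (pow_pos hr k).ne'
      field_simp
    have hχx : ∀ k x, x ≠ 0 →
        χ k x = peval (Q k) x * (‖x‖ ^ (-(γ₀ + k)) * g (ε * Real.log ‖x‖)) := by
      intro k x hx
      simp only [hχ]
      rw [logRadial, if_neg hx, hhr, mul_comm (-(γ₀ + (k : ℝ))),
        ← Real.rpow_def_of_pos (norm_pos_iff.2 hx)]
    have hFc := hφt.continuous_fracLaplacian hn hs0
    have hE : fracEnergy s φ = ∑ k ∈ Finset.range N, ∫ x, χ k x * fracLaplacian s φ x := by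
      rw [← hφt.integral_mul_fracLaplacian hn hs0, ← integral_finsetSum]
      · simp only [hφ, Finset.sum_mul]
      · exact fun k _ => ((hχt k).smooth.continuous.mul hFc).integrable_of_hasCompactSupport
          (hχt k).compact.mul_right
    have hV : ∫ x, |homogeneous γ ψ x| ^ (p - 1) * φ x ^ 2 = A * (ε⁻¹ * I) := by
      have h1 : ∫ ρ, g (ε * ρ) ^ 2 = ε⁻¹ * I := by
        rw [Measure.integral_comp_mul_left (fun ρ => g ρ ^ 2) ε, abs_of_pos (inv_pos.2 hε),
          smul_eq_mul]
      -- Here β = -2s - 2γ₀ = -n, so the measure is dr/r and the exponential prefactor is trivial.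
      rw [← h1, ← integral_radial_weight hn (-2 * s - 2 * γ₀) (g := fun ρ => g (ε * ρ) ^ 2)]
      refine integral_polar_mul hn fun θ r hr => ?_
      have e1 : r ^ (-2 * s - 2 * γ₀) = r ^ (-γ * (p - 1)) * (r ^ (-γ₀) * r ^ (-γ₀)) := by
        rw [← Real.rpow_add hr, ← Real.rpow_add hr]
        congr 1
        linear_combination hγp
      have e2 : -((n : ℝ) + (-2 * s - 2 * γ₀)) * Real.log r = 0 := by rw [hγ₀]; ring
      rw [homogeneous_smul _ _ hr, hφr θ r hr, e1, e2, Real.exp_zero, abs_mul,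
        abs_of_pos (Real.rpow_pos_of_pos hr _),
        Real.mul_rpow (by positivity) (abs_nonneg _), ← Real.rpow_mul hr.le]
      ring
    refine ⟨ε * fracEnergy s φ, ?_, ?_⟩
    · have h1 := hst.form_nonneg φ hφt
      rw [hV] at h1
      have h2 := mul_nonneg hε.le h1
      have h3 : ε * (fracEnergy s φ - p * (A * (ε⁻¹ * I))) = ε * fracEnergy s φ - p * A * I := by
        field_simp
      linarith
    · rw [hE, Finset.mul_sum, Complex.ofReal_sum]
      refine Finset.sum_congr rfl fun k hk => ?_
      rw [Complex.ofReal_mul, hφt.integral_critical_mul_fracLaplacian hn hs0 hs2 hγ hε hγ₀ hG hφr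
        (hQ k) (hχx k), hqB k hk, ← mul_assoc, ← Complex.ofReal_mul, mul_inv_cancel_left₀ hε.ne']
  choose T hT1 hT2 using fun m : ℕ => main (1 / ((m : ℝ) + 1)) (by positivity)
  have hlim : Tendsto (fun m => (T m : ℂ)) atTop
      (𝓝 (∑ k ∈ Finset.range N, (q k : ℂ) * ((symbol n s k γ₀ * I : ℝ) : ℂ))) := by
    simp only [hT2]
    refine tendsto_finsetSum _ fun k _ => Tendsto.const_mul _ ?_
    have := tendsto_integral_symbolC hs0 hs2 hγ (n := n) (by linarith) k (𝓕 G)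
    rwa [hPl] at this
  have hlim' := (Complex.continuous_re.tendsto _).comp hlim
  have hle := ge_of_tendsto' hlim' (fun m => by simpa using hT1 m)
  have e : (∑ k ∈ Finset.range N, (q k : ℂ) * ((symbol n s k γ₀ * I : ℝ) : ℂ)).re =
      (∑ k ∈ Finset.range N, symbol n s k γ₀ * q k) * I := by
    rw [Finset.sum_mul, Complex.re_sum]
    refine Finset.sum_congr rfl fun k _ => ?_
    rw [← Complex.ofReal_mul, Complex.ofReal_re]; ring
  rw [e] at hle
  exact le_of_mul_le_mul_right hle hIpos

/-! ### Conclusion. -/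

lemma symbol_zero_eq (n : ℕ) (s γ : ℝ) : symbol n s 0 γ = 2 ^ (2 * s) *
    (Real.Gamma (n / 2 - γ / 2) * Real.Gamma (s + γ / 2) /
      (Real.Gamma (γ / 2) * Real.Gamma ((n - 2 * s) / 2 - γ / 2))) := by
  simp only [symbol, gammaRatio]
  rw [show γ / 2 + ((0 : ℕ) : ℝ) / 2 + s = s + γ / 2 by simp; ring,
    show γ / 2 + ((0 : ℕ) : ℝ) / 2 = γ / 2 by simp,
    show (n : ℝ) / 2 - s - γ / 2 + ((0 : ℕ) : ℝ) / 2 + s = n / 2 - γ / 2 by simp; ring,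
    show (n : ℝ) / 2 - s - γ / 2 + ((0 : ℕ) : ℝ) / 2 = (n - 2 * s) / 2 - γ / 2 by simp; ring,
    mul_assoc, div_mul_div_comm]
  ring

lemma symbol_zero_critical (n : ℕ) (s : ℝ) : symbol n s 0 ((n - 2 * s) / 2) = 2 ^ (2 * s) *
    (Real.Gamma ((n + 2 * s) / 4) ^ 2 / Real.Gamma ((n - 2 * s) / 4) ^ 2) := by
  rw [symbol_zero_eq]
  rw [show (n : ℝ) / 2 - (n - 2 * s) / 2 / 2 = (n + 2 * s) / 4 by ring,
    show s + (n - 2 * s) / 2 / 2 = ((n : ℝ) + 2 * s) / 4 by ring,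
    show ((n : ℝ) - 2 * s) / 2 - (n - 2 * s) / 2 / 2 = (n - 2 * s) / 4 by ring,
    show ((n : ℝ) - 2 * s) / 2 / 2 = (n - 2 * s) / 4 by ring, sq, sq]

/-- If stability controls the quadratic form of the potential with a constant `θ < 1` relative to
the equation, the profile vanishes. -/
lemma ae_eq_zero_of_forall_integral_le {α : Type*} [MeasurableSpace α] {μ : Measure α} {p θ : ℝ}
    (hp : 1 < p) (hθ0 : 0 ≤ θ) (hθ : θ < 1) {ψ : α → ℝ}
    (hM : Integrable (fun x => |ψ x| ^ (p + 1)) μ) {f : ℕ → α → ℝ}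
    (hD : ∀ i, Integrable (fun x => |ψ x| ^ (p - 1) * ψ x * f i x) μ)
    (hA : ∀ i, Integrable (fun x => |ψ x| ^ (p - 1) * f i x ^ 2) μ)
    (hlim : ∀ᵐ x ∂μ, Tendsto (fun i => f i x) atTop (𝓝 (ψ x)))
    (hle : ∀ i, ∫ x, |ψ x| ^ (p - 1) * f i x ^ 2 ∂μ ≤
      θ * ∫ x, |ψ x| ^ (p - 1) * ψ x * f i x ∂μ) : ψ =ᵐ[μ] 0 := by
  set M := ∫ x, |ψ x| ^ (p + 1) ∂μ with hMdef
  have hpow : ∀ x, |ψ x| ^ (p + 1) = |ψ x| ^ (p - 1) * ψ x ^ 2 := by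
    intro x
    rw [← sq_abs (ψ x), ← Real.rpow_natCast, ← Real.rpow_add' (abs_nonneg _)
      (by push_cast; linarith)]
    congr 1; push_cast; ring
  have hbound : ∀ i, ∫ x, |ψ x| ^ (p - 1) * f i x ^ 2 ∂μ ≤ θ ^ 2 * M := by
    intro i
    -- Let A be the quadratic and D the mixed integral. The square gives 0 ≤ θ²M - 2θD + A, and A ≤
    -- θD turns this into A ≤ θ²M.
    have h0 : 0 ≤ ∫ x, |ψ x| ^ (p - 1) * (θ * ψ x - f i x) ^ 2 ∂μ :=
      integral_nonneg fun x => by positivity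
    have e : ∀ x, |ψ x| ^ (p - 1) * (θ * ψ x - f i x) ^ 2 =
        θ ^ 2 * |ψ x| ^ (p + 1) - 2 * θ * (|ψ x| ^ (p - 1) * ψ x * f i x) +
          |ψ x| ^ (p - 1) * f i x ^ 2 := by
      intro x; rw [hpow]; ring
    simp only [e] at h0
    have i1 : Integrable (fun x => θ ^ 2 * |ψ x| ^ (p + 1)) μ := hM.const_mul _
    have i2 : Integrable (fun x => 2 * θ * (|ψ x| ^ (p - 1) * ψ x * f i x)) μ :=
      (hD i).const_mul _
    rw [integral_add (i1.sub' i2) (hA i), integral_sub i1 i2, integral_const_mul,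
      integral_const_mul] at h0
    linarith [hle i]
  have hM0 : 0 ≤ M := integral_nonneg fun x => by positivity
  -- Only a.e. convergence of f i is known, so Fatou replaces convergence of the integrals.
  have hfatou : M ≤ θ ^ 2 * M := by
    rw [← ENNReal.ofReal_le_ofReal_iff (by positivity)]
    calc ENNReal.ofReal M = ∫⁻ x, ENNReal.ofReal (|ψ x| ^ (p + 1)) ∂μ :=
          ofReal_integral_eq_lintegral_ofReal hM (Eventually.of_forall fun x => by positivity)
      _ = ∫⁻ x, liminf (fun i => ENNReal.ofReal (|ψ x| ^ (p - 1) * f i x ^ 2)) atTop ∂μ := by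
          refine lintegral_congr_ae ?_
          filter_upwards [hlim] with x hx
          rw [hpow]
          exact ((ENNReal.continuous_ofReal.tendsto _).comp
            ((hx.pow 2).const_mul _)).liminf_eq.symm
      _ ≤ liminf (fun i => ∫⁻ x, ENNReal.ofReal (|ψ x| ^ (p - 1) * f i x ^ 2) ∂μ) atTop :=
          lintegral_liminf_le' fun i => (hA i).1.aemeasurable.ennreal_ofReal
      _ ≤ ENNReal.ofReal (θ ^ 2 * M) := by
          refine liminf_le_of_le (by isBoundedDefault) fun b hb => ?_
          obtain ⟨i, hi⟩ := hb.exists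
          refine hi.trans ?_
          rw [← ofReal_integral_eq_lintegral_ofReal (hA i)
            (Eventually.of_forall fun x => by positivity)]
          exact ENNReal.ofReal_le_ofReal (hbound i)
  have hMz : M = 0 := by
    have : θ ^ 2 < 1 := pow_lt_one₀ hθ0 hθ two_ne_zero
    nlinarith
  have h := (integral_eq_zero_iff_of_nonneg (fun x => by positivity) hM).1 hMz
  filter_upwards [h] with x hx
  have hx' : |ψ x| ^ (p + 1) = 0 := hx
  rw [Real.rpow_eq_zero (abs_nonneg _) (by linarith)] at hx'
  exact abs_eq_zero.1 hx'

/-- A homogeneous stable solution vanishes when the critical symbol lies below `p` times the symbol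
at its own degree. -/
theorem IsSolution.ae_eq_zero_of_isStable (hn0 : 0 < n) {s p γ γ₀ : ℝ} (hs0 : 0 < s) (hs2 : s < 2)
    (hp1 : 1 < p) (hγp : γ * (p - 1) = 2 * s) (hγ : 0 < γ) (hγγ₀ : γ < γ₀)
    (hγ₀def : γ₀ = (n - 2 * s) / 2) (hsym : symbol n s 0 γ₀ < p * symbol n s 0 γ) {ψ : S n → ℝ}
    (hψ : MemLp ψ (ENNReal.ofReal (p + 1)) (surface n))
    (hsol : IsSolution s p {0}ᶜ (homogeneous γ ψ))
    (hstable : IsStable s p {0}ᶜ (homogeneous γ ψ)) : ψ =ᵐ[surface n] 0 := by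
  have hγ₀ : 0 < γ₀ := hγ.trans hγγ₀
  have hγ' : γ < n - 2 * s := by linarith
  have hq2 : (2 : ENNReal) ≤ ENNReal.ofReal (p + 1) := by
    rw [show (2 : ENNReal) = ENNReal.ofReal 2 by norm_num]
    exact ENNReal.ofReal_le_ofReal (by linarith)
  have hψ2 : MemLp ψ 2 (surface n) := hψ.mono_exponent hq2
  have hint : ∀ b : ℝ, 0 < b → b ≤ p + 1 → Integrable (fun θ => |ψ θ| ^ b) (surface n) := by
    intro b hb hb'
    have h := (hψ.mono_exponent (ENNReal.ofReal_le_ofReal hb')).integrable_norm_rpow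
      (by simpa using hb) ENNReal.ofReal_ne_top
    simpa [ENNReal.toReal_ofReal hb.le] using h
  have hpos := symbol_pos (n := n) hs0.le hγ hγ' 0
  have hpos₀ := symbol_pos (n := n) hs0.le hγ₀ (by linarith) 0
  have hp0 : 0 < p := by linarith
  obtain ⟨Y, hY, hYψ, N, hN⟩ := exists_harmonic_expansion hn0 hψ2
  set f : ℕ → S n → ℝ := fun i θ => ∑ k ∈ Finset.range (N i), peval (Y k) (θ : E n) with hf
  have hfc : ∀ i, Continuous (f i) := fun i =>
    continuous_finsetSum _ fun k _ => (continuous_peval (Y k)).comp continuous_subtype_val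
  have hfb : ∀ i, ∃ C, ∀ θ, ‖f i θ‖ ≤ C := fun i => by
    obtain ⟨C, hC⟩ := isCompact_univ.exists_bound_of_continuousOn (hfc i).continuousOn
    exact ⟨C, fun θ => hC θ (mem_univ θ)⟩
  have hm : AEStronglyMeasurable (fun θ => |ψ θ| ^ (p - 1) * ψ θ) (surface n) :=
    ((hint (p - 1) (by linarith) (by linarith)).1).mul hψ.1
  have hmi : Integrable (fun θ => |ψ θ| ^ (p - 1) * ψ θ) (surface n) := by
    refine (hint p hp0 (by linarith)).mono' hm (Eventually.of_forall fun θ => le_of_eq ?_)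
    rw [norm_mul, Real.norm_of_nonneg (by positivity), Real.norm_eq_abs]
    nth_rw 2 [← Real.rpow_one |ψ θ|]
    rw [← Real.rpow_add' (abs_nonneg _) (by linarith)]
    congr 1; ring
  have hD : ∀ {h : S n → ℝ}, Continuous h →
      Integrable (fun θ => |ψ θ| ^ (p - 1) * ψ θ * h θ) (surface n) := fun {h} hh => by
    obtain ⟨C, hC⟩ := isCompact_univ.exists_bound_of_continuousOn hh.continuousOn
    exact hmi.mul_bdd (c := C) hh.aestronglyMeasurable
      (Eventually.of_forall fun θ => hC θ (mem_univ θ))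
  refine ae_eq_zero_of_forall_integral_le (θ := symbol n s 0 γ₀ / (p * symbol n s 0 γ)) hp1
    (by positivity) ((div_lt_one (by positivity)).2 hsym) (hint (p + 1) (by linarith) le_rfl)
    (f := f) (fun i => hD (hfc i)) (fun i => ?_) hN
    (fun i => ?_)
  · obtain ⟨C, hC⟩ := hfb i
    refine (hint (p - 1) (by linarith) (by linarith)).mul_bdd (c := C ^ 2)
      ((hfc i).pow 2).aestronglyMeasurable (Eventually.of_forall fun θ => ?_)
    rw [norm_pow]
    exact pow_le_pow_left₀ (norm_nonneg _) (hC θ) 2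
  · have h1 := hstable.mul_integral_le hn0 hs0 hs2 hγ₀ (by rw [hγ₀def]; ring) hγp hY (N i)
    have h2 : ∫ θ : S n, |ψ θ| ^ (p - 1) * ψ θ * f i θ ∂(surface n) =
        ∑ k ∈ Finset.range (N i), symbol n s k γ * ∫ θ : S n, peval (Y k) (θ : E n) ^ 2
          ∂(surface n) := by
      simp only [hf, Finset.mul_sum]
      rw [integral_finsetSum]
      · refine Finset.sum_congr rfl fun k _ => ?_
        rw [← hYψ k, hsol.symbol_mul_integral hn0 hs0 hs2 hγ hγ' hγp hψ2 (hY k)]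
      · exact fun k _ => hD ((continuous_peval (Y k)).comp continuous_subtype_val)
    -- Termwise, λ_0(γ) λ_k(γ₀) ≤ λ_0(γ₀) λ_k(γ), with nonnegative weights ‖Y_k‖².
    have h3 : symbol n s 0 γ * ∑ k ∈ Finset.range (N i), symbol n s k γ₀ *
        ∫ θ : S n, peval (Y k) (θ : E n) ^ 2 ∂(surface n) ≤
        symbol n s 0 γ₀ * ∫ θ : S n, |ψ θ| ^ (p - 1) * ψ θ * f i θ ∂(surface n) := by
      rw [h2, Finset.mul_sum, Finset.mul_sum]
      refine Finset.sum_le_sum fun k _ => ?_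
      rw [← mul_assoc, ← mul_assoc, mul_comm (symbol n s 0 γ)]
      exact mul_le_mul_of_nonneg_right (hγ₀def ▸ symbol_mul_symbol_zero_le hs0.le hγ (hγ₀def ▸ hγγ₀) k)
        (integral_nonneg fun θ => sq_nonneg _)
    rw [div_mul_eq_mul_div, le_div_iff₀ (by positivity)]
    nlinarith [mul_le_mul_of_nonneg_left h1 hpos.le]

end FracLaneEmden

end

theorem theorem3p1 (n : ℕ) (s p : ℝ) (hs1 : 1 < s) (hs2 : s < 2) (hn : 2 * s < (n : ℝ))
    (hp : ((n : ℝ) + 2 * s) / ((n : ℝ) - 2 * s) < p)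
    (hcond : Real.Gamma (((n : ℝ) + 2 * s) / 4) ^ 2 / Real.Gamma (((n : ℝ) - 2 * s) / 4) ^ 2 <
      p * (Real.Gamma ((n : ℝ) / 2 - s / (p - 1)) * Real.Gamma (s + s / (p - 1)) /
        (Real.Gamma (s / (p - 1)) * Real.Gamma (((n : ℝ) - 2 * s) / 2 - s / (p - 1)))))
    (ψ : FracLaneEmden.S n → ℝ)
    (hψ : MemLp ψ (ENNReal.ofReal (p + 1)) (FracLaneEmden.surface n))
    (hsol : FracLaneEmden.IsSolution s p {0}ᶜ
      (FracLaneEmden.homogeneous (2 * s / (p - 1)) ψ))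
    (hstable : FracLaneEmden.IsStable s p {0}ᶜ
      (FracLaneEmden.homogeneous (2 * s / (p - 1)) ψ)) :
    ψ =ᵐ[FracLaneEmden.surface n] 0 := by
  have hs0 : 0 < s := by linarith
  have hn2 : 0 < (n : ℝ) - 2 * s := by linarith
  have hn0 : 0 < n := by
    have : (0 : ℝ) < n := by linarith
    exact_mod_cast this
  have hp' : (n : ℝ) + 2 * s < p * (n - 2 * s) := (div_lt_iff₀ hn2).1 hp
  have hp1 : 1 < p := by
    by_contra h
    nlinarith [mul_le_mul_of_nonneg_right (not_lt.1 h) hn2.le]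
  set γ := 2 * s / (p - 1) with hγdef
  set γ₀ : ℝ := (n - 2 * s) / 2 with hγ₀def
  have hγp : γ * (p - 1) = 2 * s := div_mul_cancel₀ _ (by linarith)
  have hγ : 0 < γ := div_pos (by linarith) (by linarith)
  -- Equivalent to p > (n + 2s)/(n - 2s).
  have hγγ₀ : γ < γ₀ := by
    rw [hγdef, hγ₀def, div_lt_iff₀ (by linarith)]; nlinarith
  refine hsol.ae_eq_zero_of_isStable hn0 hs0 hs2 hp1 hγp hγ hγγ₀ hγ₀def ?_ hψ hstable
  -- Both symbols carry the factor 2^(2s); once it is removed, `hcond` remains.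
  rw [hγ₀def, FracLaneEmden.symbol_zero_critical, FracLaneEmden.symbol_zero_eq, mul_left_comm,
    show γ / 2 = s / (p - 1) by rw [hγdef]; ring]
  exact mul_lt_mul_of_pos_left hcond (by positivity)
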